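/- **Corollary (Evolution in the time basis with potential).** Let $d\in\mathbb N$, $T_0>0$, $\omega=2\pi/T_0$, $\sigma\in(0,d)$, $n_0\in(0,d-1)$. Let $\{|E_n\rangle\}_{n=0}^{d-1}$ be an orthonormal basis of $\mathbb C^d$, let $\hat H_c=\sum_{n=0}^{d-1}n\omega|E_n\rangle\langle E_n|$ and, for $k\in\mathbb Z$, $|\theta_k\rangle=d^{-1/2}\sum_{n=0}^{d-1}e^{-i2\pi nk/d}|E_n\rangle$. Let $V_0:\mathbb R\to\mathbb R$ be infinitely differentiable with period $2\pi$ and $\int_x^{x+2\pi}V_0=\Omega\in[-\pi,\pi)$, and put $V_d(x)=\frac{2\pi}{d}V_0(2\pi x/d)$, $\hat V_d=\frac{d}{T_0}\sum_{k=0}^{d-1}V_d(k)|\theta_k\rangle\langle\theta_k|$. Let $b$ be a real number with $b\ge\sup_{k\ge1}\big(2\max_{x\in[0,2\pi]}|V_0^{(k-1)}(x)|\big)^{1/k}$. For $k_0\in\mathbb R$ let $\mathcal S_d(k_0)=\{k\in\mathbb Z:-\frac d2\le k_0-k<\frac d2\}$, $g(k_0)=\sum_{k\in\mathcal S_d(k_0)}e^{-\frac{2\pi}{\sigma^2}(k-k_0)^2}$,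 $A=g(k_0)^{-1/2}$, $$\psi_{\rm nor}(k_0;x)=A\,e^{-\frac{\pi}{\sigma^2}(x-k_0)^2}e^{i2\pi n_0(x-k_0)/d}\ (x\in\mathbb R),\qquad |\Psi_{\rm nor}(k_0)\rangle=\sum_{k\in\mathcal S_d(k_0)}\psi_{\rm nor}(k_0;k)|\theta_k\rangle .$$ For $t\in\mathbb R$ and $x\in\mathcal S_d(k_0+t\,d/T_0)$ let $\bar\psi(x,t)=\langle\theta_x|e^{-it(\hat H_c+\hat V_d)}|\Psi_{\rm nor}(k_0)\rangle$. At $t=0$ one has $\bar\psi(x,0)=\psi_{\rm nor}(k_0;x)$ for $x\in\mathcal S_d(k_0)$, and by this formula $\bar\psi(\cdot,0)$ is extended to all real arguments: $\bar\psi(y,0):=\psi_{\rm nor}(k_0;y)$. Then for all $k_0,t\in\mathbb R$ and $x\in\mathcal S_d(k_0+t\,d/T_0)$, $$\bar\psi(x,t)=e^{-i\int_{x-t d/T_0}^{x}V_d(y)\,dy}\;\bar\psi\big(x-\tfrac{d}{T_0}t,0\big)+\bar\varepsilon_v,\qquad \bar\varepsilon_v\in\mathbb C,\quad |\bar\varepsilon_v|<|t|\tfrac{d}{T_0}\,\epsilon_T+\big(|t|\tfrac{d}{T_0}+1\big)\bar\epsilon_{\rm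 step}+\epsilon_{\rm nor},$$ where, with $\kappa=0.792$, $\alpha_0=\frac{2}{d-1}\min\{n_0,d-1-n_0\}$, $$\bar\upsilon=\frac{\pi\alpha_0\kappa}{\ln(\pi\alpha_0^2\sigma^2)}\,b,\qquad \mathcal N=\left\lfloor\frac{\pi\alpha_0^2}{2(\bar\upsilon+d/\sigma^2)^2}\Big(\frac d\sigma\Big)^2\right\rfloor ,$$ $$\epsilon_T=\epsilon_2+2A\left(\frac{2\pi}{1-e^{-\pi d/\sigma^2}}+\frac{b+\frac{2\pi}{d}}{1-e^{-\pi d^2/\sigma^2}}+2\pi\frac{d}{\sigma^2}+\pi\frac{d^2}{\sigma^2}+\frac1d\right)e^{-\frac{\pi}{4}\frac{d^2}{\sigma^2}},\qquad \bar\epsilon_{\rm step}=2A\,e^{-\frac{\pi d^2}{4\sigma^2}},$$ $$\epsilon_2=\begin{cases}(2\pi)^{5/4}\sigma^{3/2}A\big(1+\frac{\pi^2}{8}\big)\sqrt{\frac e2\frac{\alpha_0}{\bar\upsilon\sigma^2/d+1}}\;\exp\!\Big(-\frac\pi4\frac{\alpha_0^2}{(d/\sigma^2+\bar\upsilon)^2}\big(\frac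 d\sigma\big)^2\Big)&\text{if }\mathcal N\ge8\text{ and }\bar\upsilon\ge0,\\[6pt]\frac{3^{7/4}}{\sqrt{2\pi}\,e}\frac{A(8+\pi^2)}{\alpha_0^3}\Big(\frac{\kappa\sqrt{6\pi}}{\ln 3}b+\frac d\sigma\Big)^3\frac{\sigma}{d^3}&\text{otherwise}\end{cases}$$ ($\bar\upsilon:=0$ if $b=0$; if $b>0$ and $\pi\alpha_0^2\sigma^2=1$ the second case applies), and where $\epsilon_{\rm nor}$ may be taken to be either of $$\left|\sqrt{\frac{g(k_0+t\,d/T_0)}{g(k_0)}}-1\right|\qquad\text{or}\qquad\begin{cases}8\sqrt{\frac2d}\,\frac{e^{-\pi d/2}}{1-e^{-\pi d}}&\text{if }\sigma=\sqrt d,\\[6pt]\frac{4\sqrt2}{\sigma}\left(\frac{e^{-\pi d^2/(2\sigma^2)}}{1-e^{-2\pi d/\sigma^2}}+\frac{e^{-\pi\sigma^2/2}}{1-e^{-\pi\sigma^2}}\right)&\text{otherwise.}\end{cases}$$ -/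

import Mathlib

open scoped ContDiff

namespace QuantumClock

noncomputable section

/-- The Hilbert space of the `d`-dimensional clock; the standard basis is the energy basis. -/
abbrev ClockSpace (d : ℕ) : Type := EuclideanSpace ℂ (Fin d)

/-- The energy eigenstate `|E_n⟩`. -/
def energyState (d : ℕ) (n : Fin d) : ClockSpace d := EuclideanSpace.single n (1 : ℂ)

/-- The time state `|θ_k⟩ = d^{-1/2} ∑_{n<d} e^{-i 2π n k / d} |E_n⟩`, for every integer `k`. -/
def timeState (d : ℕ) (k : ℤ) : ClockSpace d :=
  ((1 / Real.sqrt d : ℝ) : ℂ) •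
    ∑ n : Fin d, Complex.exp (-Complex.I * (2 * Real.pi * (n : ℕ) * k / d)) • energyState d n

/-- The clock Hamiltonian `H_c = ∑_{n<d} n ω |E_n⟩⟨E_n|` with `ω = 2π / T0`. -/
def clockHamiltonian (d : ℕ) (T0 : ℝ) : ClockSpace d →L[ℂ] ClockSpace d :=
  ∑ n : Fin d, (((n : ℕ) * (2 * Real.pi / T0) : ℝ) : ℂ) •
    InnerProductSpace.rankOne ℂ (energyState d n) (energyState d n)

/-- The rescaled potential `V_d(x) = (2π/d) V_0(2π x / d)`. -/
def potential (d : ℕ) (V0 : ℝ → ℝ) (x : ℝ) : ℝ :=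
  2 * Real.pi / d * V0 (2 * Real.pi * x / d)

/-- The interaction potential `V̂_d = (d/T0) ∑_{k<d} V_d(k) |θ_k⟩⟨θ_k|`. -/
def interaction (d : ℕ) (T0 : ℝ) (V0 : ℝ → ℝ) : ClockSpace d →L[ℂ] ClockSpace d :=
  ((d / T0 : ℝ) : ℂ) • ∑ k ∈ Finset.range d, ((potential d V0 k : ℝ) : ℂ) •
    InnerProductSpace.rankOne ℂ (timeState d k) (timeState d k)

/-- The set `S_d(k0)` of the `d` integers closest to `k0`. -/
def closestInts (d : ℕ) (k0 : ℝ) : Finset ℤ :=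
  Finset.Ioc ⌊k0 - d / 2⌋ ⌊k0 + d / 2⌋

theorem mem_closestInts (d : ℕ) (k0 : ℝ) (k : ℤ) :
    k ∈ closestInts d k0 ↔ -((d : ℝ) / 2) ≤ k0 - k ∧ k0 - k < (d : ℝ) / 2 := by
  rw [closestInts, Finset.mem_Ioc, Int.floor_lt, Int.le_floor]
  constructor <;> rintro ⟨h1, h2⟩ <;> constructor <;> linarith

/-- `∑_{k ∈ S_d(k0)} e^{-2π (k - k0)² / σ²}`. -/
def gaussSum (d : ℕ) (σ k0 : ℝ) : ℝ :=
  ∑ k ∈ closestInts d k0, Real.exp (-(2 * Real.pi / σ ^ 2) * (k - k0) ^ 2)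

/-- The normalisation constant `A(σ; k0)`. -/
def normConst (d : ℕ) (σ k0 : ℝ) : ℝ := 1 / Real.sqrt (gaussSum d σ k0)

/-- `ψ_nor(k0; x) = A(σ; k0) e^{-π (x - k0)² / σ²} e^{i 2π n0 (x - k0) / d}`, for real `x`. -/
def psiNor (d : ℕ) (σ n0 k0 x : ℝ) : ℂ :=
  normConst d σ k0 * Real.exp (-(Real.pi / σ ^ 2) * (x - k0) ^ 2) *
    Complex.exp (Complex.I * (2 * Real.pi * n0 * (x - k0) / d))

/-- The normalised Gaussian clock state `|Ψ_nor(k0)⟩`. -/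
def gaussianState (d : ℕ) (σ n0 k0 : ℝ) : ClockSpace d :=
  ∑ k ∈ closestInts d k0, psiNor d σ n0 k0 k • timeState d k

/-- The discrete wave function `⟨θ_x| e^{-i t (H_c + V̂_d)} |Ψ_nor(k0)⟩`. -/
def waveFunction (d : ℕ) (T0 σ n0 : ℝ) (V0 : ℝ → ℝ) (k0 : ℝ) (x : ℤ) (t : ℝ) : ℂ :=
  inner ℂ (timeState d x)
    (NormedSpace.exp ((-Complex.I * t) • (clockHamiltonian d T0 + interaction d T0 V0))
      (gaussianState d σ n0 k0))

/-- The phase function `Θ(Δ; x) = ∫_{x-Δ}^x V_d(y) dy`. -/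
def phase (d : ℕ) (V0 : ℝ → ℝ) (Δ x : ℝ) : ℝ := ∫ y in (x - Δ)..x, potential d V0 y

/-- `α_0 = (2 / (d - 1)) min {n0, (d - 1) - n0}`. -/
def alphaZero (d : ℕ) (n0 : ℝ) : ℝ := 2 / ((d : ℝ) - 1) * min n0 ((d : ℝ) - 1 - n0)

/-- The numerical constant `κ = 0.792`. -/
def kappa : ℝ := 0.792

/-- The rate parameter `ῡ = π α_0 κ b / ln (π α_0² σ²)`. -/
def rateParam (d : ℕ) (σ n0 b : ℝ) : ℝ :=
  Real.pi * alphaZero d n0 * kappa / Real.log (Real.pi * alphaZero d n0 ^ 2 * σ ^ 2) * b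

/-- `𝒩 = ⌊ π α_0² / (2 (ῡ + d/σ²)²) · (d/σ)² ⌋`. -/
def decayNumber (d : ℕ) (σ n0 b : ℝ) : ℕ :=
  ⌊Real.pi * alphaZero d n0 ^ 2 / (2 * (rateParam d σ n0 b + d / σ ^ 2) ^ 2) * (d / σ) ^ 2⌋₊

open scoped Classical in
/-- The explicit bound on `|ε̄_2|`. -/
def epsTwo (d : ℕ) (σ n0 b k0 : ℝ) : ℝ :=
  if 8 ≤ decayNumber d σ n0 b ∧ 0 ≤ rateParam d σ n0 b then
    (2 * Real.pi) ^ (5 / 4 : ℝ) * σ ^ (3 / 2 : ℝ) * normConst d σ k0 * (1 + Real.pi ^ 2 / 8) *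
      Real.sqrt (Real.exp 1 / 2 *
        (alphaZero d n0 / (rateParam d σ n0 b * σ ^ 2 / d + 1))) *
      Real.exp (-(Real.pi / 4) * (alphaZero d n0 ^ 2 / (d / σ ^ 2 + rateParam d σ n0 b) ^ 2) *
        (d / σ) ^ 2)
  else
    3 ^ (7 / 4 : ℝ) / (Real.sqrt (2 * Real.pi) * Real.exp 1) *
      (normConst d σ k0 * (8 + Real.pi ^ 2) / alphaZero d n0 ^ 3) *
      (kappa * Real.sqrt (6 * Real.pi) / Real.log 3 * b + d / σ) ^ 3 * (σ / d ^ 3)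

/-- The explicit bound on `ε_T`. For `σ = √d` this is the expression with `σ²` replaced by `d`. -/
def epsTotal (d : ℕ) (σ n0 b k0 : ℝ) : ℝ :=
  epsTwo d σ n0 b k0 + 2 * normConst d σ k0 *
    (2 * Real.pi / (1 - Real.exp (-(Real.pi * d / σ ^ 2)))
      + (b + 2 * Real.pi / d) / (1 - Real.exp (-(Real.pi * (d ^ 2 / σ ^ 2))))
      + (2 * Real.pi * (d / σ ^ 2) + Real.pi * (d ^ 2 / σ ^ 2) + 1 / d)) *
    Real.exp (-(Real.pi / 4) * (d ^ 2 / σ ^ 2))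

/-- The explicit bound on `ε̄_step`. -/
def epsStep (d : ℕ) (σ k0 : ℝ) : ℝ :=
  2 * normConst d σ k0 * Real.exp (-(Real.pi * d ^ 2 / (4 * σ ^ 2)))

/-- The relative change of the normalisation constant when the centre moves from `k0` to
`k0 + t d / T0`, that is `|A(σ; k0) / A(σ; k0 + t d / T0) - 1|`. -/
def epsNor (d : ℕ) (T0 σ k0 t : ℝ) : ℝ :=
  |Real.sqrt (gaussSum d σ (k0 + t * d / T0) / gaussSum d σ k0) - 1|

open scoped Classical in
/-- The explicit form of the renormalisation error. -/
def epsNorExplicit (d : ℕ) (σ : ℝ) : ℝ :=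
  if σ = Real.sqrt d then
    8 * Real.sqrt (2 / d) * (Real.exp (-(Real.pi * d / 2)) / (1 - Real.exp (-(Real.pi * d))))
  else
    4 * Real.sqrt 2 / σ *
      (Real.exp (-(Real.pi * d ^ 2 / (2 * σ ^ 2))) / (1 - Real.exp (-(2 * Real.pi * d / σ ^ 2)))
        + Real.exp (-(Real.pi * σ ^ 2 / 2)) / (1 - Real.exp (-(Real.pi * σ ^ 2))))

/-- `ε_v(t, d) = |t| (d/T0) ε_T + (|t| d/T0 + 1) ε̄_step + ε_nor`, for a given value of `ε_nor`. -/
def epsV (d : ℕ) (T0 σ n0 b k0 t nor : ℝ) : ℝ :=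
  |t| * (d / T0) * epsTotal d σ n0 b k0 + (|t| * (d / T0) + 1) * epsStep d σ k0 + nor

end

end QuantumClock

/-! Put s = t d/T0 and let φ_s(y) = e^{-iΘ(s;y)} ψ_nor(k0; y - s) be `shiftedWave`. It solves the
transport equation ∂_s φ = -∂_y φ - i V_d φ exactly, and every |θ_k⟩ is an eigenvector of the
interaction. The comparison state Φ(s) = Σ φ_s(k)|θ_k⟩, summed over the d integers closest to k0 +
s, therefore fails the Schrödinger equation only through the clock Hamiltonian, which is not exactly
a derivative on this grid. The defect is the sum of `residual` over the window. By unitarity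
(`hasDerivAt_pulledBackState`, `norm_pulledBackState_sub_lt`) the error is at most |s| times the
supremum of the defect, plus the jumps of Φ as its window slides. A jump swaps two sites at distance
d/2 from the centre and costs at most `epsStep`; fewer than |s| + 1 jumps occur, which makes the
final inequality strict.

The n-th coordinate of the residual at k is -d^{-1/2} times the derivative at k of φ_s(y) e^{-2πi n
y/d}. Summed over all of ℤ, Poisson summation leaves only the frequencies m ≠ 0
(`norm_tsum_deriv_le`). The bounds |V0^{(k)}| ≤ b^{k+1}/2 make Θ entire of exponential type, so
shifting the contour shows that the remaining Fourier coefficients are small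
(`norm_fourier_shiftedWave_le`). The depth of the shift is a free parameter h; the choices in
`exists_shift_cubic` and `exists_scale_exponential` yield the two branches of `epsTwo`.

Passing from ℤ back to the window costs two Gaussian tails. Their potential part is the delicate
one: it is absorbed by three different arguments according to b and d
(`norm_window_residual_le_epsTotal`), so that the total is `epsTotal`.

The comparison keeps the amplitude A(k0) throughout, so no renormalisation error arises; both forms
of ε_nor enter only as nonnegative additions. -/

namespace QuantumClock

/-! ### Entire extension of functions with geometrically bounded derivatives -/

/-- The Taylor series of a real function at `x₀`, evaluated at a complex point. -/
noncomputable def taylorExtension (f : ℝ → ℝ) (x₀ : ℝ) (z : ℂ) : ℂ :=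
  ∑' k : ℕ, ((iteratedDeriv k f x₀ / (k.factorial : ℝ) : ℝ) : ℂ) * (z - x₀) ^ k

section TaylorExtension

variable {f : ℝ → ℝ} {C b : ℝ}

/-- The hypothesis says nothing about k = 0, so the constant is enlarged by |f x₀| to cover that
term. -/
theorem norm_taylorTerm_le (hb : 0 ≤ b) (hC : 0 ≤ C)
    (h : ∀ k : ℕ, 1 ≤ k → ∀ x, |iteratedDeriv k f x| ≤ C * b ^ k) (x₀ : ℝ) {r : ℝ} (z : ℂ)
    (hz : ‖z - x₀‖ ≤ r) (k : ℕ) :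
    ‖((iteratedDeriv k f x₀ / (k.factorial : ℝ) : ℝ) : ℂ) * (z - x₀) ^ k‖
      ≤ (|f x₀| + C) * ((b * r) ^ k / (k.factorial : ℝ)) := by
  have hr : 0 ≤ r := (norm_nonneg _).trans hz
  have h1 : |iteratedDeriv k f x₀| ≤ (|f x₀| + C) * b ^ k := by
    rcases Nat.eq_zero_or_pos k with rfl | hk
    · simp [hC]
    · refine (h k hk x₀).trans ?_
      gcongr
      linarith [abs_nonneg (f x₀)]
  rw [norm_mul, norm_pow, Complex.norm_real, Real.norm_eq_abs, abs_div, Nat.abs_cast]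
  calc |iteratedDeriv k f x₀| / (k.factorial : ℝ) * ‖z - x₀‖ ^ k
      ≤ ((|f x₀| + C) * b ^ k) / (k.factorial : ℝ) * r ^ k := by gcongr
    _ = _ := by rw [mul_pow]; ring

theorem summable_taylorTerm (hb : 0 ≤ b) (hC : 0 ≤ C)
    (h : ∀ k : ℕ, 1 ≤ k → ∀ x, |iteratedDeriv k f x| ≤ C * b ^ k) (x₀ : ℝ) (z : ℂ) :
    Summable fun k : ℕ =>
      ((iteratedDeriv k f x₀ / (k.factorial : ℝ) : ℝ) : ℂ) * (z - x₀) ^ k :=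
  .of_norm_bounded ((Real.summable_pow_div_factorial _).mul_left _)
    (norm_taylorTerm_le hb hC h x₀ z le_rfl)

theorem differentiable_taylorExtension (hb : 0 ≤ b) (hC : 0 ≤ C)
    (h : ∀ k : ℕ, 1 ≤ k → ∀ x, |iteratedDeriv k f x| ≤ C * b ^ k) (x₀ : ℝ) :
    Differentiable ℂ (taylorExtension f x₀) := by
  intro z
  have hd : DifferentiableOn ℂ (taylorExtension f x₀)
      (Metric.ball (x₀ : ℂ) (‖z - x₀‖ + 1)) := by
    refine Complex.differentiableOn_tsum_of_summable_norm
      (u := fun k => (|f x₀| + C) * ((b * (‖z - x₀‖ + 1)) ^ k / (k.factorial : ℝ)))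
      ((Real.summable_pow_div_factorial _).mul_left _) (fun k => ?_) Metric.isOpen_ball
      fun k w hw => ?_
    · fun_prop
    · refine norm_taylorTerm_le hb hC h x₀ w ?_ k
      rw [mem_ball_iff_norm] at hw
      exact hw.le
  refine (hd z ?_).differentiableAt (Metric.isOpen_ball.mem_nhds ?_) <;>
    simp [dist_eq_norm]

/-- The Taylor remainder is at most C (b(x - x₀))^{n+1}/n!, which tends to 0. The remainder bound
used is one-sided, hence x₀ ≤ x. -/
theorem taylorExtension_ofReal_of_le (hf : ContDiff ℝ ∞ f) (hb : 0 ≤ b) (hC : 0 ≤ C)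
    (h : ∀ k : ℕ, 1 ≤ k → ∀ x, |iteratedDeriv k f x| ≤ C * b ^ k) {x₀ x : ℝ} (hx : x₀ ≤ x) :
    taylorExtension f x₀ x = f x := by
  have h1 := (summable_taylorTerm hb hC h x₀ x).hasSum.tendsto_sum_nat
  -- The interval is prolonged to x + 1 so that it stays nondegenerate when x = x₀.
  refine tendsto_nhds_unique (l := Filter.atTop)
    (f := fun n : ℕ => ((taylorWithinEval f n (Set.Icc x₀ (x + 1)) x₀ x : ℝ) : ℂ)) ?_ ?_
  · refine (h1.comp (Filter.tendsto_add_atTop_nat 1)).congr fun n => ?_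
    rw [taylor_within_apply]
    simp only [Function.comp]
    push_cast
    refine Finset.sum_congr rfl fun k _ => ?_
    rw [iteratedDerivWithin_eq_iteratedDeriv (uniqueDiffOn_Icc (by linarith))
      (hf.contDiffAt.of_le (by exact_mod_cast le_top)) (Set.left_mem_Icc.2 (by linarith))]
    simp only [smul_eq_mul]
    push_cast
    ring
  · refine (Complex.continuous_ofReal.tendsto _).comp ?_
    rw [tendsto_iff_norm_sub_tendsto_zero]
    have h2 : Filter.Tendsto (fun n : ℕ => C * b * (x - x₀) * ((b * (x - x₀)) ^ n / n.factorial))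
        Filter.atTop (nhds (C * b * (x - x₀) * 0)) :=
      (FloorSemiring.tendsto_pow_div_factorial_atTop _).const_mul _
    rw [mul_zero] at h2
    refine squeeze_zero (fun _ => norm_nonneg _) (fun n => ?_) h2
    rw [norm_sub_rev]
    refine (taylor_mean_remainder_bound (C := C * b ^ (n + 1)) (by linarith)
      ((hf.of_le (by exact_mod_cast le_top)).contDiffOn) ⟨hx, by linarith⟩
        fun y hy => ?_).trans_eq ?_
    · rw [iteratedDerivWithin_eq_iteratedDeriv (uniqueDiffOn_Icc (by linarith))
        (hf.contDiffAt.of_le (by exact_mod_cast le_top)) hy]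
      exact h _ (by omega) y
    · rw [mul_pow]; ring

/-- To the right of max x₀ x₁ both series equal f, and the identity theorem does the rest.
Recentring removes the one-sidedness and makes estimates at x + iy uniform in x. -/
theorem taylorExtension_eq (hf : ContDiff ℝ ∞ f) (hb : 0 ≤ b) (hC : 0 ≤ C)
    (h : ∀ k : ℕ, 1 ≤ k → ∀ x, |iteratedDeriv k f x| ≤ C * b ^ k) (x₀ x₁ : ℝ) :
    taylorExtension f x₀ = taylorExtension f x₁ := by
  have ha (x) : AnalyticOnNhd ℂ (taylorExtension f x) Set.univ :=
    (differentiable_taylorExtension hb hC h x).differentiableOn.analyticOnNhd isOpen_univ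
  set M := max x₀ x₁
  refine (ha x₀).eq_of_frequently_eq (ha x₁) (z₀ := (M : ℂ)) ?_
  have ht : Filter.Tendsto (fun y : ℝ => (y : ℂ)) (nhdsWithin M (Set.Ioi M))
      (nhdsWithin (M : ℂ) {(M : ℂ)}ᶜ) := by
    refine tendsto_nhdsWithin_iff.2 ⟨(Complex.continuous_ofReal.tendsto _).mono_left
      nhdsWithin_le_nhds, ?_⟩
    filter_upwards [self_mem_nhdsWithin] with y hy
    simpa using (ne_of_gt hy)
  refine ht.frequently (Filter.Eventually.frequently ?_)
  filter_upwards [self_mem_nhdsWithin] with y hy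
  have hy' : M < y := hy
  rw [taylorExtension_ofReal_of_le hf hb hC h ((le_max_left _ _).trans hy'.le),
    taylorExtension_ofReal_of_le hf hb hC h ((le_max_right _ _).trans hy'.le)]

/-- A smooth function with geometrically bounded derivatives extends to an entire function of
exponential type. -/
theorem exists_entire_extension (hf : ContDiff ℝ ∞ f) (hb : 0 ≤ b) (hC : 0 ≤ C)
    (h : ∀ k : ℕ, 1 ≤ k → ∀ x, |iteratedDeriv k f x| ≤ C * b ^ k) :
    ∃ F : ℂ → ℂ, Differentiable ℂ F ∧ (∀ x : ℝ, F x = f x) ∧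
      ∀ x y : ℝ, ‖F (x + y * Complex.I) - f x‖ ≤ C * (Real.exp (b * |y|) - 1) := by
  refine ⟨taylorExtension f 0, differentiable_taylorExtension hb hC h 0, fun x => ?_,
    fun x y => ?_⟩
  · rw [taylorExtension_eq hf hb hC h 0 x]
    exact taylorExtension_ofReal_of_le hf hb hC h le_rfl
  -- Centred at x, the constant term is f x; the remaining terms are dominated by those of C
  -- (e^{b|y|} - 1).
  · rw [taylorExtension_eq hf hb hC h 0 x, taylorExtension,
      (summable_taylorTerm hb hC h x _).tsum_eq_zero_add]
    have he : HasSum (fun k : ℕ => (b * |y|) ^ k / (k.factorial : ℝ)) (Real.exp (b * |y|)) := by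
      rw [Real.exp_eq_exp_ℝ]
      exact NormedSpace.expSeries_div_hasSum_exp (b * |y|)
    have he' : HasSum (fun k : ℕ => C * ((b * |y|) ^ (k + 1) / ((k + 1).factorial : ℝ)))
        (C * (Real.exp (b * |y|) - 1)) := by
      refine HasSum.mul_left C ?_
      rw [hasSum_nat_add_iff (f := fun k : ℕ => (b * |y|) ^ k / (k.factorial : ℝ)) 1]
      simpa using he
    have : ∀ k : ℕ, ‖((iteratedDeriv (k + 1) f x / ((k + 1).factorial : ℝ) : ℝ) : ℂ) *
        ((x : ℂ) + y * Complex.I - x) ^ (k + 1)‖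
        ≤ C * ((b * |y|) ^ (k + 1) / ((k + 1).factorial : ℝ)) := fun k => by
      rw [norm_mul, norm_pow, Complex.norm_real, Real.norm_eq_abs, abs_div, Nat.abs_cast,
        add_sub_cancel_left, norm_mul, Complex.norm_I, mul_one, Complex.norm_real,
        Real.norm_eq_abs]
      calc _ ≤ C * b ^ (k + 1) / ((k + 1).factorial : ℝ) * |y| ^ (k + 1) := by
            gcongr
            exact h _ (by omega) x
        _ = _ := by rw [mul_pow]; ring
    have h3 := tsum_of_norm_bounded he' this
    simpa using h3

end TaylorExtension

/-! ### Contour shifts and Fourier decay -/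

/-- Shifting a horizontal contour for an entire function with Gaussian decay in a strip. -/
theorem integral_horizontal_shift {F : ℂ → ℂ} (hF : Differentiable ℂ F) {a K c τ : ℝ} (ha : 0 < a)
    (hK : ∀ x y : ℝ, |y| ≤ |τ| →
      ‖F (x + y * Complex.I)‖ ≤ K * Real.exp (-a * (x - c) ^ 2)) :
    ∫ x : ℝ, F x = ∫ x : ℝ, F (x + τ * Complex.I) := by
  have hg : MeasureTheory.Integrable fun x : ℝ => K * Real.exp (-a * (x - c) ^ 2) :=
    ((integrable_exp_neg_mul_sq ha).comp_sub_right c).const_mul K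
  have hi : ∀ y : ℝ, |y| ≤ |τ| →
      MeasureTheory.Integrable fun x : ℝ => F (x + y * Complex.I) := fun y hy =>
    hg.mono' ((hF.continuous.comp (by fun_prop)).aestronglyMeasurable)
      (Filter.Eventually.of_forall fun x => hK x y hy)
  have h0 : Filter.Tendsto (fun T : ℝ => ∫ x in (-T)..T, F x) Filter.atTop (nhds (∫ x : ℝ, F x)) :=
    MeasureTheory.intervalIntegral_tendsto_integral (by simpa using hi 0 (by simp))
      Filter.tendsto_neg_atTop_atBot Filter.tendsto_id
  have h1 : Filter.Tendsto (fun T : ℝ => ∫ x in (-T)..T, F (x + τ * Complex.I)) Filter.atTop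
      (nhds (∫ x : ℝ, F (x + τ * Complex.I))) :=
    MeasureTheory.intervalIntegral_tendsto_integral (hi τ le_rfl)
      Filter.tendsto_neg_atTop_atBot Filter.tendsto_id
  -- The vertical sides of the rectangle vanish as it widens; stated for a general filter to serve
  -- both ends.
  have hsq : ∀ l : Filter ℝ, ∀ u : ℝ → ℝ, Filter.Tendsto (fun T => |u T|) l Filter.atTop →
      Filter.Tendsto (fun T => ∫ y in (0 : ℝ)..τ, F ((u T : ℝ) + y * Complex.I)) l (nhds 0) := by
    intro l u hu
    have hlim : Filter.Tendsto (fun T => K * Real.exp (-a * (u T - c) ^ 2) * |τ - 0|) l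
        (nhds (K * 0 * |τ - 0|)) := by
      refine Filter.Tendsto.mul_const _ (Filter.Tendsto.const_mul _ ?_)
      refine Real.tendsto_exp_atBot.comp ?_
      simp only [neg_mul]
      refine Filter.tendsto_neg_atTop_atBot.comp (Filter.Tendsto.const_mul_atTop ha ?_)
      have h2 : Filter.Tendsto (fun T => |u T - c|) l Filter.atTop := by
        refine Filter.tendsto_atTop_mono (fun T => ?_)
          (Filter.tendsto_atTop_add_const_right l (-|c|) hu)
        linarith [abs_sub_abs_le_abs_sub (u T) c]
      refine ((Filter.tendsto_pow_atTop two_ne_zero).comp h2).congr fun T => ?_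
      simp [sq_abs]
    rw [mul_zero, zero_mul] at hlim
    refine squeeze_zero_norm (fun T => ?_) hlim
    refine intervalIntegral.norm_integral_le_of_norm_le_const fun y hy => hK _ y ?_
    rw [Set.mem_uIoc] at hy
    rcases hy with ⟨h, h'⟩ | ⟨h, h'⟩
    · rw [abs_of_pos h]; exact h'.trans (le_abs_self _)
    · rw [abs_of_nonpos h', abs_of_nonpos (h.le.trans h')]; linarith
  have hr := hsq Filter.atTop (fun T => T) Filter.tendsto_abs_atTop_atTop
  have hl := hsq Filter.atTop (fun T => -T) (by simpa using Filter.tendsto_abs_atTop_atTop)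
  have key : ∀ T : ℝ, (∫ x in (-T)..T, F x) - (∫ x in (-T)..T, F (x + τ * Complex.I)) =
      Complex.I • (∫ y in (0 : ℝ)..τ, F ((-T : ℝ) + y * Complex.I)) -
        Complex.I • (∫ y in (0 : ℝ)..τ, F (T + y * Complex.I)) := by
    intro T
    have := Complex.integral_boundary_rect_eq_zero_of_differentiableOn F (-T : ℝ)
      (T + τ * Complex.I) hF.differentiableOn
    simp only [Complex.ofReal_re, Complex.ofReal_im, Complex.add_re, Complex.add_im,
      Complex.mul_re, Complex.mul_im, Complex.I_re, Complex.I_im, mul_zero, mul_one, sub_zero,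
      add_zero, zero_add, Complex.ofReal_zero, zero_mul] at this
    linear_combination this
  have h2 := (hl.const_smul Complex.I).sub (hr.const_smul Complex.I)
  rw [smul_zero, sub_zero] at h2
  have h3 := (h0.sub h1)
  exact sub_eq_zero.1 (tendsto_nhds_unique (h3.congr key) h2)

/-- Exponential decay of the Fourier transform of a phase-modulated Gaussian whose phase extends to
an entire function of exponential type. -/
theorem norm_integral_phase_gaussian_le {Θ : ℝ → ℝ} {W : ℂ → ℂ} (hW : Differentiable ℂ W)
    (hWΘ : ∀ x : ℝ, W x = Θ x) {β : ℝ}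
    (hβ : ∀ x y : ℝ, ‖W (x + y * Complex.I) - Θ x‖ ≤ Real.exp (β * |y|) - 1) (hβ0 : 0 ≤ β)
    {a c : ℝ} (ha : 0 < a) (w : ℝ) {τ : ℝ} (hτ : 0 ≤ τ) :
    ‖∫ x : ℝ, Complex.exp (-Complex.I * Θ x) * Complex.exp (-a * (x - c) ^ 2) *
        Complex.exp (Complex.I * (w * x))‖ ≤
      Real.sqrt (Real.pi / a) * Real.exp (Real.exp (β * τ) - 1 + a * τ ^ 2 - |w| * τ) := by
  set F : ℂ → ℂ := fun z => Complex.exp (-Complex.I * W z) * Complex.exp (-a * (z - c) ^ 2) *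
        Complex.exp (Complex.I * (w * z)) with hFdef
  have hFd : Differentiable ℂ F := by fun_prop
  have hFn : ∀ x y : ℝ, ‖F (x + y * Complex.I)‖ ≤
      Real.exp (Real.exp (β * |y|) - 1 + a * y ^ 2 - w * y) * Real.exp (-a * (x - c) ^ 2) := by
    intro x y
    simp only [hFdef, norm_mul, Complex.norm_exp]
    rw [← Real.exp_add, ← Real.exp_add, ← Real.exp_add]
    refine Real.exp_le_exp.2 ?_
    -- Since Θ is real, Im W = Im (W - Θ), so only the deviation from the real axis contributes to
    -- the modulus.
    have h1 : (-Complex.I * W (x + y * Complex.I)).re ≤ Real.exp (β * |y|) - 1 := by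
      have : (-Complex.I * W (x + y * Complex.I)).re = (W (x + y * Complex.I) - Θ x).im := by simp
      rw [this]
      exact (Complex.im_le_norm _).trans (hβ x y)
    have h2 : (-(a : ℂ) * (x + y * Complex.I - c) ^ 2).re = a * y ^ 2 + -a * (x - c) ^ 2 := by
      simp [pow_two]; ring
    have h3 : (Complex.I * (w * (x + y * Complex.I))).re = -(w * y) := by simp
    rw [h2, h3]
    linarith
  -- The contour moves up or down according to the sign of w, so that e^{-wy} becomes e^{-|w|τ}.
  obtain ⟨ε, hε, hwε⟩ : ∃ ε : ℝ, |ε| = 1 ∧ w * ε = |w| := by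
    rcases le_total 0 w with h | h
    · exact ⟨1, by simp, by simp [abs_of_nonneg h]⟩
    · exact ⟨-1, by simp, by simp [abs_of_nonpos h]⟩
  have hετ : |ε * τ| = τ := by rw [abs_mul, hε, one_mul, abs_of_nonneg hτ]
  have hshift := integral_horizontal_shift hFd (τ := ε * τ) (a := a) (c := c)
    (K := Real.exp (Real.exp (β * τ) - 1 + a * τ ^ 2 + |w| * τ)) ha fun x y hy => by
      rw [hετ] at hy
      refine (hFn x y).trans ?_
      have h1 : -(w * y) ≤ |w| * τ :=
        (neg_le_abs _).trans (by rw [abs_mul]; gcongr)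
      have h2 : a * y ^ 2 ≤ a * τ ^ 2 := by rw [← sq_abs y]; gcongr
      have h3 : Real.exp (β * |y|) ≤ Real.exp (β * τ) := by gcongr
      gcongr Real.exp ?_ * _
      linarith
  have h0 : (∫ x : ℝ, Complex.exp (-Complex.I * Θ x) * Complex.exp (-a * (x - c) ^ 2) *
        Complex.exp (Complex.I * (w * x))) = ∫ x : ℝ, F x := by
    simp only [hFdef, hWΘ]
  rw [h0, hshift]
  have hg : MeasureTheory.Integrable fun x : ℝ =>
      Real.exp (Real.exp (β * τ) - 1 + a * τ ^ 2 - |w| * τ) * Real.exp (-a * (x - c) ^ 2) :=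
    ((integrable_exp_neg_mul_sq ha).comp_sub_right c).const_mul _
  refine (MeasureTheory.norm_integral_le_of_norm_le hg
    (Filter.Eventually.of_forall fun x => ?_)).trans_eq ?_
  · refine (hFn x (ε * τ)).trans_eq ?_
    rw [hετ, ← mul_assoc w, hwε, ← sq_abs (ε * τ), hετ]
  · rw [MeasureTheory.integral_const_mul,
      MeasureTheory.integral_sub_right_eq_self (fun x => Real.exp (-a * x ^ 2)) c,
      integral_gaussian, mul_comm]

/-! ### The comparison wave, the potential and its phase -/

/-- The comparison wave function `e^{-iΘ(s; y)} ψ_nor(k0; y - s)`. -/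
noncomputable def shiftedWave (d : ℕ) (σ n0 : ℝ) (V0 : ℝ → ℝ) (k0 s y : ℝ) : ℂ :=
  Complex.exp (-Complex.I * phase d V0 s y) * psiNor d σ n0 k0 (y - s)

/-- The logarithmic derivative of `shiftedWave` in its last argument. -/
noncomputable def shiftedWaveLogDeriv (d : ℕ) (σ n0 : ℝ) (V0 : ℝ → ℝ) (k0 s y : ℝ) : ℂ :=
  Complex.I * (2 * Real.pi * n0 / d) - Complex.I * (potential d V0 y - potential d V0 (y - s))
    - 2 * Real.pi / σ ^ 2 * (y - s - k0)

section Potential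

variable {d : ℕ} {V0 : ℝ → ℝ} {b : ℝ}

theorem iteratedDeriv_periodic {f : ℝ → ℝ} {T : ℝ} (hf : Function.Periodic f T) (n : ℕ) :
    Function.Periodic (iteratedDeriv n f) T := fun x => by
  have h := congrFun (iteratedDeriv_comp_add_const n f T) x
  rw [funext hf] at h
  exact h.symm

/-- The k-th root condition is turned into a geometric bound, and periodicity carries it from [0,
2π] to ℝ. The factor 1/2 matters: the phase is a difference of two primitives, whose constants then
add up to 1. -/
theorem abs_iteratedDeriv_le_of_rpow_le (hper : Function.Periodic V0 (2 * Real.pi))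
    (hb : ∀ k : ℕ, 1 ≤ k → ∀ x ∈ Set.Icc (0 : ℝ) (2 * Real.pi),
      (2 * |iteratedDeriv (k - 1) V0 x|) ^ (1 / (k : ℝ)) ≤ b) (k : ℕ) (x : ℝ) :
    |iteratedDeriv k V0 x| ≤ 1 / 2 * b ^ (k + 1) := by
  obtain ⟨y, hy, hxy⟩ := (iteratedDeriv_periodic hper k).exists_mem_Ico₀ Real.two_pi_pos x
  have h := hb (k + 1) (by omega) y ⟨hy.1, hy.2.le⟩
  have h0 : (0 : ℝ) ≤ 2 * |iteratedDeriv k V0 y| := by positivity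
  rw [Nat.add_sub_cancel] at h
  have h2 := pow_le_pow_left₀ (Real.rpow_nonneg h0 _) h (k + 1)
  rw [one_div, Real.rpow_inv_natCast_pow h0 (by omega)] at h2
  rw [hxy]
  linarith

theorem contDiff_primitive (hV0 : ContDiff ℝ ∞ V0) :
    ContDiff ℝ ∞ fun x : ℝ => ∫ y in (0 : ℝ)..x, V0 y := by
  rw [contDiff_infty_iff_deriv]
  have hd : ∀ x, HasDerivAt (fun x : ℝ => ∫ y in (0 : ℝ)..x, V0 y) (V0 x) x := fun x =>
    (hV0.continuous.integral_hasStrictDerivAt 0 x).hasDerivAt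
  refine ⟨fun x => (hd x).differentiableAt, ?_⟩
  rwa [funext fun x => (hd x).deriv]

theorem phase_eq (hd : 0 < d) (hV0 : ContDiff ℝ ∞ V0) (s x : ℝ) :
    phase d V0 s x = (∫ y in (0 : ℝ)..(2 * Real.pi / d * x), V0 y) -
      ∫ y in (0 : ℝ)..(2 * Real.pi / d * (x - s)), V0 y := by
  have hd' : (d : ℝ) ≠ 0 := by positivity
  have hi : ∀ a b : ℝ, IntervalIntegrable V0 MeasureTheory.volume a b :=
    fun a b => hV0.continuous.intervalIntegrable a b
  have hpi := Real.pi_ne_zero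
  rw [phase, intervalIntegral.integral_interval_sub_left (hi _ _) (hi _ _)]
  simp only [potential]
  have : ∀ y : ℝ, 2 * Real.pi / d * V0 (2 * Real.pi * y / d) =
      2 * Real.pi / d * V0 (2 * Real.pi / d * y) := fun y => by
    rw [mul_div_right_comm (2 * Real.pi) y]
  simp only [this]
  rw [intervalIntegral.integral_const_mul,
    intervalIntegral.integral_comp_mul_left _ (by positivity), smul_eq_mul,
    mul_inv_cancel_left₀ (by positivity)]

/-- The derivatives of positive order k of a primitive of V0 are V0^{(k-1)}, bounded by b^k/2; the
entire extension is applied at the two rescaled endpoints. -/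
theorem exists_entire_phase (hd : 0 < d) (hV0 : ContDiff ℝ ∞ V0) (hb : 0 ≤ b)
    (hV : ∀ (k : ℕ) (x : ℝ), |iteratedDeriv k V0 x| ≤ 1 / 2 * b ^ (k + 1)) (s : ℝ) :
    ∃ W : ℂ → ℂ, Differentiable ℂ W ∧ (∀ x : ℝ, W x = phase d V0 s x) ∧
      ∀ x y : ℝ, ‖W (x + y * Complex.I) - phase d V0 s x‖ ≤
        Real.exp (2 * Real.pi * b / d * |y|) - 1 := by
  obtain ⟨F, hF, hFx, hFb⟩ := exists_entire_extension (C := 1 / 2) (b := b)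
    (contDiff_primitive hV0) hb (by norm_num) (fun k hk x => by
      obtain ⟨k, rfl⟩ := Nat.exists_eq_add_of_le' hk
      rw [iteratedDeriv_succ', show deriv (fun x : ℝ => ∫ y in (0 : ℝ)..x, V0 y) = V0 from
        funext fun x => hV0.continuous.deriv_integral V0 0 x]
      exact hV k x)
  refine ⟨fun z => F (2 * Real.pi / d * z) - F (2 * Real.pi / d * (z - s)), ?_, fun x => ?_,
    fun x y => ?_⟩
  · exact (hF.comp (by fun_prop)).sub (hF.comp (by fun_prop))
  · rw [phase_eq hd hV0, Complex.ofReal_sub, ← hFx, ← hFx]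
    push_cast
    ring_nf
  · rw [phase_eq hd hV0]
    have h1 := hFb (2 * Real.pi / d * x) (2 * Real.pi / d * y)
    have h2 := hFb (2 * Real.pi / d * (x - s)) (2 * Real.pi / d * y)
    have h3 : b * |2 * Real.pi / d * y| = 2 * Real.pi * b / d * |y| := by
      rw [abs_mul, abs_of_nonneg (by positivity : 0 ≤ 2 * Real.pi / (d : ℝ))]; ring
    rw [h3] at h1 h2
    refine (le_trans (le_of_eq ?_) (norm_sub_le _ _)).trans ((add_le_add h1 h2).trans_eq (by ring))
    push_cast
    ring_nf

theorem abs_potential_le (hV : ∀ (k : ℕ) (x : ℝ), |iteratedDeriv k V0 x| ≤ 1 / 2 * b ^ (k + 1))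
    (x : ℝ) : |potential d V0 x| ≤ Real.pi * b / d := by
  have h := hV 0 (2 * Real.pi * x / d)
  rw [iteratedDeriv_zero, zero_add, pow_one] at h
  rw [potential, abs_mul, abs_of_nonneg (by positivity : 0 ≤ 2 * Real.pi / (d : ℝ))]
  calc _ ≤ 2 * Real.pi / d * (1 / 2 * b) := by gcongr
    _ = _ := by ring

theorem continuous_potential (hV0 : Continuous V0) : Continuous (potential d V0) := by
  unfold potential; fun_prop

theorem hasDerivAt_phase (hV0 : Continuous V0) (s y : ℝ) :
    HasDerivAt (fun y => phase d V0 s y) (potential d V0 y - potential d V0 (y - s)) y := by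
  have hc := continuous_potential (d := d) hV0
  have hi : ∀ a b : ℝ, IntervalIntegrable (potential d V0) MeasureTheory.volume a b :=
    fun a b => hc.intervalIntegrable a b
  have h1 : ∀ x, HasDerivAt (fun x : ℝ => ∫ y in (0 : ℝ)..x, potential d V0 y)
      (potential d V0 x) x := fun x => (hc.integral_hasStrictDerivAt 0 x).hasDerivAt
  refine ((h1 y).sub ((h1 (y - s)).comp_sub_const y s)).congr_of_eventuallyEq
    (Filter.Eventually.of_forall fun x => ?_)
  exact (intervalIntegral.integral_interval_sub_left (hi _ _) (hi _ _)).symm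

theorem hasDerivAt_phase_shift (hV0 : Continuous V0) (s y : ℝ) :
    HasDerivAt (fun s => phase d V0 s y) (potential d V0 (y - s)) s := by
  have hc := continuous_potential (d := d) hV0
  have hi : ∀ a b : ℝ, IntervalIntegrable (potential d V0) MeasureTheory.volume a b :=
    fun a b => hc.intervalIntegrable a b
  have h1 : ∀ x, HasDerivAt (fun x : ℝ => ∫ y in (0 : ℝ)..x, potential d V0 y)
      (potential d V0 x) x := fun x => (hc.integral_hasStrictDerivAt 0 x).hasDerivAt
  have h2 := ((h1 (y - s)).comp_const_sub y s).const_sub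
    (∫ z in (0 : ℝ)..y, potential d V0 z)
  rw [neg_neg] at h2
  refine h2.congr_of_eventuallyEq (Filter.Eventually.of_forall fun x => ?_)
  exact (intervalIntegral.integral_interval_sub_left (hi _ _) (hi _ _)).symm

end Potential

/-! ### Derivatives and Fourier transform of the comparison wave -/

section ShiftedWave

variable {d : ℕ} {σ n0 : ℝ} {V0 : ℝ → ℝ} {b k0 : ℝ}

theorem normConst_nonneg (d : ℕ) (σ k0 : ℝ) : 0 ≤ normConst d σ k0 := by
  unfold normConst; positivity

theorem norm_psiNor (d : ℕ) (σ n0 k0 x : ℝ) :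
    ‖psiNor d σ n0 k0 x‖ = normConst d σ k0 * Real.exp (-(Real.pi / σ ^ 2) * (x - k0) ^ 2) := by
  have h : Complex.I * (2 * Real.pi * n0 * (x - k0) / d) =
      ((2 * Real.pi * n0 * (x - k0) / d : ℝ) : ℂ) * Complex.I := by push_cast; ring
  rw [psiNor, norm_mul, norm_mul, h, Complex.norm_exp_ofReal_mul_I, mul_one, Complex.norm_real,
    Complex.norm_real, Real.norm_of_nonneg (normConst_nonneg d σ k0),
    Real.norm_of_nonneg (Real.exp_pos _).le]

theorem norm_shiftedWave (d : ℕ) (σ n0 : ℝ) (V0 : ℝ → ℝ) (k0 s y : ℝ) :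
    ‖shiftedWave d σ n0 V0 k0 s y‖ =
      normConst d σ k0 * Real.exp (-(Real.pi / σ ^ 2) * (y - s - k0) ^ 2) := by
  have h : -Complex.I * (phase d V0 s y : ℂ) = ((-phase d V0 s y : ℝ) : ℂ) * Complex.I := by
    push_cast; ring
  rw [shiftedWave, norm_mul, h, Complex.norm_exp_ofReal_mul_I, one_mul, norm_psiNor]

theorem hasDerivAt_psiNor (d : ℕ) (σ n0 k0 x : ℝ) :
    HasDerivAt (psiNor d σ n0 k0)
      ((Complex.I * (2 * Real.pi * n0 / d) - 2 * Real.pi / σ ^ 2 * (x - k0)) *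
        psiNor d σ n0 k0 x) x := by
  have h0 : HasDerivAt (fun x : ℝ => ((x : ℝ) : ℂ) - k0) 1 x :=
    (HasDerivAt.ofReal_comp (hasDerivAt_id x)).sub_const _
  have h1 : HasDerivAt (fun x : ℝ => Complex.exp (-(Real.pi / σ ^ 2) * ((x : ℂ) - k0) ^ 2))
      (Complex.exp (-(Real.pi / σ ^ 2) * ((x : ℂ) - k0) ^ 2) *
        (-(Real.pi / σ ^ 2) * (((2 : ℕ) : ℂ) * ((x : ℂ) - k0) ^ (2 - 1) * 1))) x :=
    ((h0.pow 2).const_mul (-(Real.pi / σ ^ 2 : ℂ))).cexp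
  have h2 : HasDerivAt (fun x : ℝ => Complex.exp (Complex.I * (2 * Real.pi * n0 * (x - k0) / d)))
      (Complex.exp (Complex.I * (2 * Real.pi * n0 * (x - k0) / d)) *
        (Complex.I * (2 * Real.pi * n0 * 1 / d))) x :=
    (((h0.const_mul (2 * Real.pi * n0 : ℂ)).div_const (d : ℂ)).const_mul Complex.I).cexp
  have h3 := (h1.const_mul (normConst d σ k0 : ℂ)).mul h2
  have he : psiNor d σ n0 k0 = fun x : ℝ =>
      (normConst d σ k0 : ℂ) * Complex.exp (-(Real.pi / σ ^ 2) * ((x : ℂ) - k0) ^ 2) *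
        Complex.exp (Complex.I * (2 * Real.pi * n0 * (x - k0) / d)) := by
    funext x; rw [psiNor]; push_cast; rfl
  rw [he]
  refine h3.congr_deriv ?_
  push_cast
  simp only [pow_one]
  ring

theorem hasDerivAt_shiftedWave (hV0 : Continuous V0) (s y : ℝ) :
    HasDerivAt (fun y => shiftedWave d σ n0 V0 k0 s y)
      (shiftedWaveLogDeriv d σ n0 V0 k0 s y * shiftedWave d σ n0 V0 k0 s y) y := by
  have h1 := ((hasDerivAt_phase (d := d) hV0 s y).ofReal_comp.const_mul (-Complex.I)).cexp
  have h2 := (hasDerivAt_psiNor d σ n0 k0 (y - s)).comp_sub_const y s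
  refine (h1.mul h2).congr_deriv ?_
  rw [shiftedWaveLogDeriv, shiftedWave]
  push_cast
  ring

/-- The transport equation ∂_s φ = -∂_y φ - i V_d φ. It dictates the phase: the potential at y - s
cancels between the two derivatives and only V_d(y) survives. -/
theorem hasDerivAt_shiftedWave_shift (hV0 : Continuous V0) (s y : ℝ) :
    HasDerivAt (fun s => shiftedWave d σ n0 V0 k0 s y)
      (-(shiftedWaveLogDeriv d σ n0 V0 k0 s y + Complex.I * potential d V0 y) *
        shiftedWave d σ n0 V0 k0 s y) s := by
  have h1 := ((hasDerivAt_phase_shift (d := d) hV0 s y).ofReal_comp.const_mul (-Complex.I)).cexp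
  have h2 := (hasDerivAt_psiNor d σ n0 k0 (y - s)).comp_const_sub y s
  refine (h1.mul h2).congr_deriv ?_
  rw [shiftedWaveLogDeriv, shiftedWave]
  push_cast
  ring

theorem norm_shiftedWaveLogDeriv_sub_le
    (hV : ∀ (k : ℕ) (x : ℝ), |iteratedDeriv k V0 x| ≤ 1 / 2 * b ^ (k + 1)) (s y : ℝ) :
    ‖shiftedWaveLogDeriv d σ n0 V0 k0 s y - Complex.I * (2 * Real.pi * n0 / d)‖ ≤
      2 * Real.pi * b / d + 2 * Real.pi / σ ^ 2 * |y - s - k0| := by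
  have h1 : shiftedWaveLogDeriv d σ n0 V0 k0 s y - Complex.I * (2 * Real.pi * n0 / d) =
      -(Complex.I * ((potential d V0 y - potential d V0 (y - s) : ℝ) : ℂ)) -
        ((2 * Real.pi / σ ^ 2 * (y - s - k0) : ℝ) : ℂ) := by
    rw [shiftedWaveLogDeriv]; push_cast; ring
  rw [h1]
  refine (norm_sub_le _ _).trans ?_
  rw [norm_neg, norm_mul, Complex.norm_I, one_mul, Complex.norm_real, Complex.norm_real,
    Real.norm_eq_abs, Real.norm_eq_abs, abs_mul,
    abs_of_nonneg (by positivity : 0 ≤ 2 * Real.pi / σ ^ 2)]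
  have h2 := abs_sub (potential d V0 y) (potential d V0 (y - s))
  have h3 := abs_potential_le (d := d) hV y
  have h4 := abs_potential_le (d := d) hV (y - s)
  have h5 : Real.pi * b / d + Real.pi * b / d = 2 * Real.pi * b / d := by ring
  linarith

/-- The contour shift, with the frequency dξ - n0 measured in level spacings. The depth is d h/(2π),
which turns the exponential type 2πb/d into b. -/
theorem norm_fourier_shiftedWave_le (hd : 0 < d) (hσ : 0 < σ) (hV0 : ContDiff ℝ ∞ V0)
    (hb : 0 ≤ b) (hV : ∀ (k : ℕ) (x : ℝ), |iteratedDeriv k V0 x| ≤ 1 / 2 * b ^ (k + 1))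
    (s ξ : ℝ) {h : ℝ} (hh : 0 ≤ h) :
    ‖∫ y : ℝ, Complex.exp (-Complex.I * (2 * Real.pi * ξ * y)) * shiftedWave d σ n0 V0 k0 s y‖ ≤
      normConst d σ k0 * σ * Real.exp (Real.exp (b * h) - 1 + (d / σ) ^ 2 * h ^ 2 / (4 * Real.pi)
        - |d * ξ - n0| * h) := by
  obtain ⟨W, hW, hWx, hWb⟩ := exists_entire_phase hd hV0 hb hV s
  have hd' : (0 : ℝ) < d := by exact_mod_cast hd
  have hpi := Real.pi_pos
  have key := norm_integral_phase_gaussian_le hW hWx hWb (by positivity) (a := Real.pi / σ ^ 2)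
    (c := s + k0) (by positivity) (2 * Real.pi * n0 / d - 2 * Real.pi * ξ)
    (τ := d * h / (2 * Real.pi)) (by positivity)
  have he : ∀ y : ℝ, Complex.exp (-Complex.I * (2 * Real.pi * ξ * y)) *
      shiftedWave d σ n0 V0 k0 s y =
      (normConst d σ k0 * Complex.exp (Complex.I * (-(2 * Real.pi * n0 * (s + k0) / d)))) *
      (Complex.exp (-Complex.I * phase d V0 s y) *
        Complex.exp (-(Real.pi / σ ^ 2 : ℝ) * ((y : ℂ) - (s + k0 : ℝ)) ^ 2) *
        Complex.exp (Complex.I * ((2 * Real.pi * n0 / d - 2 * Real.pi * ξ : ℝ) * y))) := by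
    intro y
    rw [shiftedWave, psiNor]
    have : Complex.I * (2 * Real.pi * n0 * (((y - s : ℝ) : ℂ) - k0) / d) =
      Complex.I * (-(2 * Real.pi * n0 * (s + k0) / d)) +
        (Complex.I * ((2 * Real.pi * n0 / d - 2 * Real.pi * ξ : ℝ) * y) -
        -Complex.I * (2 * Real.pi * ξ * y)) := by push_cast; ring
    rw [this, Complex.exp_add, Complex.exp_sub]
    have hne := Complex.exp_ne_zero (-Complex.I * (2 * Real.pi * ξ * y))
    push_cast
    rw [show (y : ℂ) - s - k0 = y - (s + k0) by ring]
    field_simp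
  simp only [he]
  rw [MeasureTheory.integral_const_mul, norm_mul]
  have h1 : ‖(normConst d σ k0 : ℂ) *
      Complex.exp (Complex.I * (-(2 * Real.pi * n0 * (s + k0) / d)))‖ = normConst d σ k0 := by
    have : Complex.I * (-(2 * Real.pi * n0 * (s + k0) / d)) =
      ((-(2 * Real.pi * n0 * (s + k0) / d) : ℝ) : ℂ) * Complex.I := by push_cast; ring
    rw [this, norm_mul, Complex.norm_exp_ofReal_mul_I, mul_one, Complex.norm_real,
      Real.norm_of_nonneg (normConst_nonneg d σ k0)]
  rw [h1, mul_assoc (normConst d σ k0)]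
  refine mul_le_mul_of_nonneg_left (key.trans_eq ?_) (normConst_nonneg d σ k0)
  have h2 : Real.pi / (Real.pi / σ ^ 2) = σ ^ 2 := by field_simp
  rw [h2, Real.sqrt_sq hσ.le]
  have h3 : 2 * Real.pi * b / d * (d * h / (2 * Real.pi)) = b * h := by field_simp
  have h4 : Real.pi / σ ^ 2 * (d * h / (2 * Real.pi)) ^ 2 =
      (d / σ) ^ 2 * h ^ 2 / (4 * Real.pi) := by
    field_simp; ring
  have h5 : |2 * Real.pi * n0 / d - 2 * Real.pi * ξ| * (d * h / (2 * Real.pi)) =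
      |d * ξ - n0| * h := by
    have : 2 * Real.pi * n0 / d - 2 * Real.pi * ξ = -(2 * Real.pi / d * (d * ξ - n0)) := by
      field_simp; ring
    rw [this, abs_neg, abs_mul, abs_of_pos (by positivity : 0 < 2 * Real.pi / (d : ℝ))]
    field_simp
  rw [h3, h4, h5]

end ShiftedWave

/-! ### Time states: periodicity and orthonormality modulo d -/

section TimeState

variable {d : ℕ}

theorem timeState_apply (d : ℕ) (k : ℤ) (n : Fin d) :
    timeState d k n = ((1 / Real.sqrt d : ℝ) : ℂ) *
      Complex.exp (-Complex.I * (2 * Real.pi * (n : ℕ) * k / d)) := by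
  simp [timeState, energyState, Pi.single_apply]

theorem norm_timeState_apply (d : ℕ) (k : ℤ) (n : Fin d) :
    ‖timeState d k n‖ = 1 / Real.sqrt d := by
  have h : -Complex.I * (2 * Real.pi * (n : ℕ) * k / d) =
      ((-(2 * Real.pi * (n : ℕ) * k / d) : ℝ) : ℂ) * Complex.I := by push_cast; ring
  rw [timeState_apply, norm_mul, h, Complex.norm_exp_ofReal_mul_I, mul_one, Complex.norm_real,
    Real.norm_of_nonneg (by positivity)]

theorem timeState_add_mul (hd : 0 < d) (k j : ℤ) :
    timeState d (k + d * j) = timeState d k := by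
  have hd' : (d : ℂ) ≠ 0 := by exact_mod_cast hd.ne'
  ext n
  rw [timeState_apply, timeState_apply]
  congr 1
  have : -Complex.I * (2 * Real.pi * (n : ℕ) * ((k + d * j : ℤ) : ℂ) / d) =
      -Complex.I * (2 * Real.pi * (n : ℕ) * k / d) +
        ((-((n : ℕ) * j) : ℤ) : ℂ) * (2 * Real.pi * Complex.I) := by
    push_cast; field_simp; ring
  rw [this, Complex.exp_add, Complex.exp_int_mul_two_pi_mul_I, mul_one]

theorem timeState_congr (hd : 0 < d) {k l : ℤ} (h : k ≡ l [ZMOD d]) :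
    timeState d k = timeState d l := by
  obtain ⟨j, hj⟩ := h.symm.dvd
  rw [← timeState_add_mul hd l j, ← hj, add_sub_cancel]

theorem inner_timeState_self (hd : 0 < d) (k : ℤ) :
    inner ℂ (timeState d k) (timeState d k) = (1 : ℂ) := by
  have hd' : (0 : ℝ) < d := by exact_mod_cast hd
  have h : ‖timeState d k‖ ^ 2 = 1 := by
    rw [EuclideanSpace.norm_sq_eq]
    simp only [norm_timeState_apply, div_pow, one_pow, Real.sq_sqrt hd'.le]
    rw [Finset.sum_const, Finset.card_univ, Fintype.card_fin, nsmul_eq_mul]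
    field_simp
  rw [inner_self_eq_norm_sq_to_K]
  exact (Complex.ofReal_pow _ _).symm.trans (congrArg Complex.ofReal h)

theorem norm_timeState (hd : 0 < d) (k : ℤ) : ‖timeState d k‖ = 1 := by
  have h := inner_timeState_self hd k
  rw [inner_self_eq_norm_sq_to_K] at h
  have h2 : ‖timeState d k‖ ^ 2 = 1 :=
    Complex.ofReal_injective ((Complex.ofReal_pow _ _).trans h)
  exact (pow_eq_one_iff_of_nonneg (norm_nonneg _) two_ne_zero).1 h2

/-- The inner product is a full geometric sum of a d-th root of unity ζ ≠ 1. -/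
theorem inner_timeState_of_not_modEq (hd : 0 < d) {k l : ℤ} (h : ¬ k ≡ l [ZMOD d]) :
    inner ℂ (timeState d k) (timeState d l) = (0 : ℂ) := by
  have hd' : (d : ℂ) ≠ 0 := by exact_mod_cast hd.ne'
  set ζ : ℂ := Complex.exp (2 * Real.pi * Complex.I / d * ((k - l : ℤ) : ℂ)) with hζ
  have hterm : ∀ n : Fin d, inner ℂ (timeState d k n) (timeState d l n) =
      ((1 / Real.sqrt d : ℝ) : ℂ) * ((1 / Real.sqrt d : ℝ) : ℂ) * ζ ^ (n : ℕ) := by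
    intro n
    rw [timeState_apply, timeState_apply, RCLike.inner_apply, map_mul, Complex.conj_ofReal,
      ← Complex.exp_conj, hζ, ← Complex.exp_nat_mul, mul_mul_mul_comm, ← Complex.exp_add]
    congr 2
    simp only [map_mul, map_neg, Complex.conj_I, map_div₀, Complex.conj_ofReal, map_natCast,
      map_intCast, map_ofNat]
    push_cast
    ring
  have hζd : ζ ^ d = 1 := by
    rw [hζ, ← Complex.exp_nat_mul,
      show (d : ℂ) * (2 * Real.pi * Complex.I / d * ((k - l : ℤ) : ℂ)) =
        ((k - l : ℤ) : ℂ) * (2 * Real.pi * Complex.I) by field_simp,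
      Complex.exp_int_mul_two_pi_mul_I]
  have hζ1 : ζ ≠ 1 := by
    intro h1
    obtain ⟨j, hj⟩ := Complex.exp_eq_one_iff.1 (hζ ▸ h1)
    refine h (Int.ModEq.symm (Int.modEq_iff_dvd.2 ⟨j, ?_⟩))
    have h2 : (2 * Real.pi * Complex.I : ℂ) ≠ 0 := Complex.two_pi_I_ne_zero
    have h3 : (((k - l : ℤ) : ℂ)) = d * j := by
      field_simp at hj
      exact mul_right_cancel₀ Complex.I_ne_zero (mul_right_cancel₀ h2 (by
        linear_combination (2 * Real.pi * Complex.I * Complex.I : ℂ) * hj))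
    exact_mod_cast h3
  rw [PiLp.inner_apply]
  simp only [hterm]
  rw [← Finset.mul_sum, Fin.sum_univ_eq_sum_range (fun n => ζ ^ n) d]
  have h4 := mul_geom_sum ζ d
  rw [hζd, sub_self] at h4
  rw [(mul_eq_zero.1 h4).resolve_left (sub_ne_zero.2 hζ1), mul_zero]

/-- The index map κ lets one statement serve both windows of integers and blocks of tail indices. -/
theorem inner_timeState_sum {ι : Type*} (hd : 0 < d) {S : Finset ι} {κ : ι → ℤ}
    (hS : ∀ i ∈ S, ∀ j ∈ S, κ i ≡ κ j [ZMOD d] → i = j) (c : ι → ℂ) {x : ι} (hx : x ∈ S) :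
    inner ℂ (timeState d (κ x)) (∑ i ∈ S, c i • timeState d (κ i)) = c x := by
  rw [inner_sum, Finset.sum_eq_single_of_mem x hx]
  · rw [inner_smul_right, inner_timeState_self hd, mul_one]
  · intro i hi hix
    rw [inner_smul_right, inner_timeState_of_not_modEq hd fun h => hix (hS x hx i hi h).symm,
      mul_zero]

theorem norm_sq_sum_timeState {ι : Type*} (hd : 0 < d) {S : Finset ι} {κ : ι → ℤ}
    (hS : ∀ i ∈ S, ∀ j ∈ S, κ i ≡ κ j [ZMOD d] → i = j) (c : ι → ℂ) :
    ‖∑ i ∈ S, c i • timeState d (κ i)‖ ^ 2 = ∑ i ∈ S, ‖c i‖ ^ 2 := by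
  have h : inner ℂ (∑ i ∈ S, c i • timeState d (κ i)) (∑ i ∈ S, c i • timeState d (κ i)) =
      ((∑ i ∈ S, ‖c i‖ ^ 2 : ℝ) : ℂ) := by
    rw [sum_inner]
    push_cast
    refine Finset.sum_congr rfl fun i hi => ?_
    rw [inner_smul_left, inner_timeState_sum hd hS c hi, ← Complex.conj_mul']
  rw [inner_self_eq_norm_sq_to_K] at h
  exact Complex.ofReal_injective ((Complex.ofReal_pow _ _).trans h)

theorem eq_of_modEq_of_mem_Ioc {m k l : ℤ} (hk : k ∈ Finset.Ioc (m - d) m)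
    (hl : l ∈ Finset.Ioc (m - d) m) (h : k ≡ l [ZMOD d]) : k = l := by
  rw [Finset.mem_Ioc] at hk hl
  have h1 := Int.eq_zero_of_abs_lt_dvd h.dvd (abs_lt.2 ⟨by omega, by omega⟩)
  omega

end TimeState

/-! ### The Hamiltonian on time states, and unitarity -/

section Hamiltonian

variable {d : ℕ} {T0 : ℝ} {V0 : ℝ → ℝ}

theorem clockHamiltonian_apply (v : ClockSpace d) (n : Fin d) :
    clockHamiltonian d T0 v n = (((n : ℕ) * (2 * Real.pi / T0) : ℝ) : ℂ) * v n := by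
  simp [clockHamiltonian, energyState, Pi.single_apply, EuclideanSpace.inner_single_left]

theorem potential_add_mul (hd : 0 < d) (hper : Function.Periodic V0 (2 * Real.pi)) (x : ℝ) (j : ℤ) :
    potential d V0 (x + d * j) = potential d V0 x := by
  have hd' : (d : ℝ) ≠ 0 := by exact_mod_cast hd.ne'
  rw [potential, potential,
    show 2 * Real.pi * (x + d * j) / d = 2 * Real.pi * x / d + j * (2 * Real.pi) by
      field_simp, hper.int_mul j]

/-- Both V_d and k ↦ |θ_k⟩ have period d, so the eigenvector relation for 0 ≤ k < d extends to all
integers. This frees the window to sit anywhere on ℤ. -/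
theorem interaction_timeState (hd : 0 < d) (hper : Function.Periodic V0 (2 * Real.pi)) (k : ℤ) :
    interaction d T0 V0 (timeState d k) =
      ((d / T0 : ℝ) : ℂ) • ((potential d V0 k : ℝ) : ℂ) • timeState d k := by
  have hdz : (d : ℤ) ≠ 0 := by exact_mod_cast hd.ne'
  have h0 := Int.emod_nonneg k hdz
  have h1 := Int.emod_lt_of_pos k (by exact_mod_cast hd : (0 : ℤ) < d)
  have hmem : (k % d).toNat ∈ Finset.range d := by rw [Finset.mem_range]; omega
  have hcast : (((k % d).toNat : ℕ) : ℤ) = k % d := Int.toNat_of_nonneg h0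
  have hmod : k ≡ (((k % d).toNat : ℕ) : ℤ) [ZMOD d] := by
    rw [hcast]; exact (Int.mod_modEq k d).symm
  simp only [interaction, smul_apply, sum_apply,
    InnerProductSpace.rankOne_apply]
  congr 1
  rw [Finset.sum_eq_single_of_mem _ hmem]
  · rw [timeState_congr hd hmod, inner_timeState_self hd, one_smul]
    have hk : (k : ℝ) = (((k % d).toNat : ℕ) : ℝ) + d * ((k / d : ℤ) : ℝ) := by
      have : k = (((k % d).toNat : ℕ) : ℤ) + d * (k / d) := by
        rw [hcast]; exact (Int.emod_add_mul_ediv k d).symm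
      exact_mod_cast this
    rw [← potential_add_mul hd hper _ (k / d), ← hk]
  · intro l hl hlk
    rw [inner_timeState_of_not_modEq hd, zero_smul, smul_zero]
    intro h
    have h2 := (h.trans hmod)
    rw [Finset.mem_range] at hl hmem
    have h3 := (Int.natCast_modEq_iff.1 h2)
    rw [Nat.ModEq, Nat.mod_eq_of_lt hl, Nat.mod_eq_of_lt hmem] at h3
    exact hlk h3

theorem isSelfAdjoint_rankOne_self (v : ClockSpace d) :
    IsSelfAdjoint (InnerProductSpace.rankOne ℂ v v) := by
  exact (ContinuousLinearMap.star_eq_adjoint _).trans (InnerProductSpace.adjoint_rankOne v v)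

theorem isSelfAdjoint_hamiltonian (d : ℕ) (T0 : ℝ) (V0 : ℝ → ℝ) :
    IsSelfAdjoint (clockHamiltonian d T0 + interaction d T0 V0) := by
  have hr : ∀ r : ℝ, IsSelfAdjoint ((r : ℝ) : ℂ) := fun r => Complex.conj_ofReal r
  refine IsSelfAdjoint.add (R := ClockSpace d →L[ℂ] ClockSpace d) ?_ ?_
  · exact isSelfAdjoint_sum Finset.univ fun n _ =>
      (hr _).smul (isSelfAdjoint_rankOne_self (energyState d n))
  · exact (hr _).smul (isSelfAdjoint_sum (Finset.range d) fun n _ =>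
      (hr _).smul (isSelfAdjoint_rankOne_self (timeState d n)))

/-- The total Hamiltonian in units in which the clock moves with unit speed. -/
noncomputable def scaledHamiltonian (d : ℕ) (T0 : ℝ) (V0 : ℝ → ℝ) :
    ClockSpace d →L[ℂ] ClockSpace d :=
  ((T0 / d : ℝ) : ℂ) • (clockHamiltonian d T0 + interaction d T0 V0)

theorem smul_hamiltonian_eq (hd : 0 < d) (hT0 : 0 < T0) (t : ℝ) :
    (-Complex.I * t) • (clockHamiltonian d T0 + interaction d T0 V0) =
      (((-(t * d / T0) : ℝ) : ℂ)) • (Complex.I • scaledHamiltonian d T0 V0) := by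
  have hd' : (d : ℂ) ≠ 0 := by exact_mod_cast hd.ne'
  have hT0' : (T0 : ℂ) ≠ 0 := by exact_mod_cast hT0.ne'
  rw [scaledHamiltonian, smul_smul, smul_smul]
  congr 1
  push_cast
  field_simp

theorem norm_exp_smul_I_smul_scaledHamiltonian (r : ℝ) (v : ClockSpace d) :
    ‖NormedSpace.exp ((r : ℂ) • (Complex.I • scaledHamiltonian d T0 V0)) v‖ = ‖v‖ := by
  have hr : ∀ r : ℝ, IsSelfAdjoint ((r : ℝ) : ℂ) := fun r => Complex.conj_ofReal r
  have hs : IsSelfAdjoint ((r : ℂ) • scaledHamiltonian d T0 V0) :=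
    (hr _).smul ((hr _).smul (isSelfAdjoint_hamiltonian d T0 V0))
  have h := (selfAdjoint.expUnitary
    (⟨_, hs⟩ : selfAdjoint (ClockSpace d →L[ℂ] ClockSpace d))).2
  rw [selfAdjoint.expUnitary_coe] at h
  rw [smul_comm]
  exact ContinuousLinearMap.norm_map_of_mem_unitary h v

end Hamiltonian

/-! ### Poisson summation with Gaussian decay -/

section Poisson

theorem isBigO_gaussian_cocompact {a : ℝ} (ha : 0 < a) (K c : ℝ) :
    (fun y : ℝ => K * Real.exp (-a * (y - c) ^ 2)) =O[Filter.cocompact ℝ]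
      fun y : ℝ => |y| ^ (-2 : ℝ) := by
  have h := (cexp_neg_quadratic_isLittleO_abs_rpow_cocompact (a := (-a : ℂ))
    (by simpa using ha) (2 * a * c) (-2)).isBigO
  refine Asymptotics.IsBigO.trans (Asymptotics.isBigO_of_le' (c := ‖K * Real.exp (-a * c ^ 2)‖) _
    fun y => le_of_eq ?_) h
  rw [Complex.norm_exp,
    ← Real.norm_of_nonneg (Real.exp_pos (-a * (y : ℂ) ^ 2 + 2 * a * c * y : ℂ).re).le,
    ← norm_mul, mul_assoc, ← Real.exp_add]
  congr 3
  simp [pow_two]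
  ring

theorem summable_int_gaussian {a : ℝ} (ha : 0 < a) (K c : ℝ) :
    Summable fun k : ℤ => K * Real.exp (-a * ((k : ℝ) - c) ^ 2) :=
  summable_of_isBigO (Real.summable_abs_int_rpow (b := 2) one_lt_two)
    ((isBigO_gaussian_cocompact ha K c).comp_tendsto Int.tendsto_coe_cofinite)

theorem integrable_gaussian {a : ℝ} (ha : 0 < a) (K c : ℝ) :
    MeasureTheory.Integrable fun y : ℝ => K * Real.exp (-a * (y - c) ^ 2) :=
  ((integrable_exp_neg_mul_sq ha).comp_sub_right c).const_mul K

/-- Half of the Gaussian rate is spent on the linear factor. It serves only summability and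
integrability, so the constant is immaterial. -/
theorem linear_mul_gaussian_le {a C₁ C₂ : ℝ} (ha : 0 < a) (hC₁ : 0 ≤ C₁) (hC₂ : 0 ≤ C₂) (u : ℝ) :
    (C₁ + C₂ * |u|) * Real.exp (-a * u ^ 2) ≤
      (C₁ + C₂ * (1 + 1 / a)) * Real.exp (-(a / 2) * u ^ 2) := by
  have h1 : a / 2 * u ^ 2 + 1 ≤ Real.exp (a / 2 * u ^ 2) := Real.add_one_le_exp _
  have h2 : |u| ≤ (1 + 1 / a) * (a / 2 * u ^ 2 + 1) := by
    have : (1 + 1 / a) * (a / 2 * u ^ 2 + 1) = a / 2 * u ^ 2 + 1 + 1 / a + u ^ 2 / 2 := by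
      field_simp
      ring
    rw [this]
    have h3 : 0 < 1 / a := by positivity
    have h4 : 0 ≤ a / 2 * u ^ 2 := by positivity
    nlinarith [sq_nonneg (|u| - 1), sq_abs u]
  have h5 : C₁ + C₂ * |u| ≤ (C₁ + C₂ * (1 + 1 / a)) * Real.exp (a / 2 * u ^ 2) := by
    have h6 : 1 ≤ Real.exp (a / 2 * u ^ 2) := Real.one_le_exp (by positivity)
    have h7 : |u| ≤ (1 + 1 / a) * Real.exp (a / 2 * u ^ 2) := h2.trans (by gcongr)
    nlinarith [mul_le_mul_of_nonneg_left h6 hC₁, mul_le_mul_of_nonneg_left h7 hC₂]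
  calc _ ≤ (C₁ + C₂ * (1 + 1 / a)) * Real.exp (a / 2 * u ^ 2) * Real.exp (-a * u ^ 2) := by gcongr
    _ = _ := by
      rw [mul_assoc, ← Real.exp_add]; ring_nf

/-- Poisson summation for a derivative: the zero mode drops out. -/
theorem norm_tsum_deriv_le {G G' : ℝ → ℂ} (hG : ∀ y, HasDerivAt G (G' y) y) (hG' : Continuous G')
    {a K c : ℝ} (ha : 0 < a) (hGb : ∀ y, ‖G y‖ ≤ K * Real.exp (-a * (y - c) ^ 2))
    (hGb' : ∀ y, ‖G' y‖ ≤ K * Real.exp (-a * (y - c) ^ 2)) {B : ℤ → ℝ} {S : ℝ}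
    (hB : ∀ m : ℤ, 2 * Real.pi * |(m : ℝ)| *
      ‖∫ y : ℝ, Complex.exp (-Complex.I * (2 * Real.pi * m * y)) * G y‖ ≤ B m)
    (hS : HasSum B S) : ‖∑' k : ℤ, G' k‖ ≤ S := by
  open scoped FourierTransform in
  have hGd : Differentiable ℝ G := fun y => (hG y).differentiableAt
  have hder : deriv G = G' := funext fun y => (hG y).deriv
  have hGi : MeasureTheory.Integrable G := (integrable_gaussian ha K c).mono'
    hGd.continuous.aestronglyMeasurable (Filter.Eventually.of_forall hGb)
  have hGi' : MeasureTheory.Integrable (deriv G) := by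
    rw [hder]
    exact (integrable_gaussian ha K c).mono' hG'.aestronglyMeasurable
      (Filter.Eventually.of_forall hGb')
  have hF : ∀ m : ℤ, ‖𝓕 G' (m : ℝ)‖ ≤ B m := by
    intro m
    rw [← hder, Real.fourier_deriv hGi hGd hGi', norm_smul]
    refine le_trans (le_of_eq ?_) (hB m)
    congr 1
    · simp [abs_of_pos Real.pi_pos]
    · rw [Real.fourier_real_eq_integral_exp_smul]
      congr 2 with y
      rw [smul_eq_mul]
      congr 2
      push_cast
      ring
  -- The transform of G' at m is 2πi m times that of G, so `hF` supplies the summability that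
  -- Poisson needs.
  have hP := Real.tsum_eq_tsum_fourier_of_rpow_decay_of_summable hG' one_lt_two
    ((Asymptotics.isBigO_of_le _ fun y => (hGb' y).trans (le_abs_self _)).trans
      (isBigO_gaussian_cocompact ha K c))
    (.of_norm_bounded hS.summable hF) 0
  simp only [zero_add] at hP
  rw [hP]
  refine tsum_of_norm_bounded hS fun m => ?_
  simpa using hF m

end Poisson

/-! ### The defect summed over all sites -/

section Residual

variable {d : ℕ} {σ n0 : ℝ} {V0 : ℝ → ℝ} {b k0 : ℝ}

/-- The contribution of the site `k` to the defect of the comparison state in the Schrödinger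
equation. -/
noncomputable def residual (d : ℕ) (σ n0 : ℝ) (V0 : ℝ → ℝ) (k0 s : ℝ) (k : ℤ) : ClockSpace d :=
  shiftedWave d σ n0 V0 k0 s k • Complex.I • clockHamiltonian d d (timeState d k) -
    (shiftedWaveLogDeriv d σ n0 V0 k0 s k * shiftedWave d σ n0 V0 k0 s k) • timeState d k

/-- Read as a function of a real variable in place of k, the right side is a multiple of the
derivative of φ_s(y) e^{-2πi n y/d}: the form to which Poisson summation applies. -/
theorem residual_apply (s : ℝ) (k : ℤ) (n : Fin d) :
    residual d σ n0 V0 k0 s k n = -((1 / Real.sqrt d : ℝ) : ℂ) *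
      ((shiftedWaveLogDeriv d σ n0 V0 k0 s k - Complex.I * (2 * Real.pi * (n : ℕ) / d)) *
        (shiftedWave d σ n0 V0 k0 s k *
          Complex.exp (-Complex.I * (2 * Real.pi * (n : ℕ) * k / d)))) := by
  rw [residual, PiLp.sub_apply, PiLp.smul_apply, PiLp.smul_apply, PiLp.smul_apply,
    clockHamiltonian_apply, timeState_apply]
  simp only [smul_eq_mul]
  push_cast
  ring

theorem continuous_shiftedWave (hV0 : Continuous V0) (s : ℝ) :
    Continuous fun y => shiftedWave d σ n0 V0 k0 s y :=
  continuous_iff_continuousAt.2 fun y => (hasDerivAt_shiftedWave hV0 s y).continuousAt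

theorem continuous_shiftedWaveLogDeriv (hV0 : Continuous V0) (s : ℝ) :
    Continuous fun y => shiftedWaveLogDeriv d σ n0 V0 k0 s y := by
  have h := continuous_potential (d := d) hV0
  unfold shiftedWaveLogDeriv
  fun_prop

theorem norm_shiftedWaveLogDeriv_sub_mul_le (hσ : 0 < σ) (hb : 0 ≤ b)
    (hV : ∀ (k : ℕ) (x : ℝ), |iteratedDeriv k V0 x| ≤ 1 / 2 * b ^ (k + 1)) (s : ℝ) (z : ℂ) :
    ∃ K : ℝ, ∀ y : ℝ, ‖shiftedWave d σ n0 V0 k0 s y‖ ≤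
        K * Real.exp (-(Real.pi / σ ^ 2 / 2) * (y - (s + k0)) ^ 2) ∧
      ‖shiftedWaveLogDeriv d σ n0 V0 k0 s y - z‖ * ‖shiftedWave d σ n0 V0 k0 s y‖ ≤
        K * Real.exp (-(Real.pi / σ ^ 2 / 2) * (y - (s + k0)) ^ 2) := by
  have hpi := Real.pi_pos
  have hA := normConst_nonneg d σ k0
  -- The summand 1 lets the same constant bound the wave itself.
  set C₁ : ℝ := 1 + 2 * Real.pi * b / d + ‖Complex.I * (2 * Real.pi * n0 / d) - z‖
  set C₂ : ℝ := 2 * Real.pi / σ ^ 2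
  have hC₁ : 1 ≤ C₁ := by
    have : 0 ≤ 2 * Real.pi * b / d + ‖Complex.I * (2 * Real.pi * n0 / d) - z‖ := by positivity
    linarith
  have hC₂ : 0 ≤ C₂ := by positivity
  refine ⟨normConst d σ k0 * (C₁ + C₂ * (1 + 1 / (Real.pi / σ ^ 2))), fun y => ?_⟩
  have h1 := linear_mul_gaussian_le (a := Real.pi / σ ^ 2) (by positivity)
    (zero_le_one.trans hC₁) hC₂ (y - (s + k0))
  have h2 : ‖shiftedWaveLogDeriv d σ n0 V0 k0 s y - z‖ ≤ C₁ + C₂ * |y - (s + k0)| := by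
    have h3 := norm_sub_le_norm_sub_add_norm_sub (shiftedWaveLogDeriv d σ n0 V0 k0 s y)
      (Complex.I * (2 * Real.pi * n0 / d)) z
    have h4 := norm_shiftedWaveLogDeriv_sub_le (d := d) (σ := σ) (n0 := n0) (k0 := k0) hV s y
    rw [sub_sub] at h4
    simp only [C₁, C₂]
    linarith
  rw [norm_shiftedWave, sub_sub]
  constructor
  · rw [mul_assoc]
    refine mul_le_mul_of_nonneg_left (le_trans ?_ h1) hA
    refine le_mul_of_one_le_left (Real.exp_pos _).le ?_
    have : 0 ≤ C₂ * |y - (s + k0)| := by positivity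
    linarith
  · calc _ ≤ (C₁ + C₂ * |y - (s + k0)|) *
          (normConst d σ k0 * Real.exp (-(Real.pi / σ ^ 2) * (y - (s + k0)) ^ 2)) := by gcongr
      _ = normConst d σ k0 * ((C₁ + C₂ * |y - (s + k0)|) *
            Real.exp (-(Real.pi / σ ^ 2) * (y - (s + k0)) ^ 2)) := by ring
      _ ≤ _ := by
        rw [mul_assoc]
        exact mul_le_mul_of_nonneg_left h1 hA

theorem summable_residual (hσ : 0 < σ) (hb : 0 ≤ b)
    (hV : ∀ (k : ℕ) (x : ℝ), |iteratedDeriv k V0 x| ≤ 1 / 2 * b ^ (k + 1)) (s : ℝ) :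
    Summable (residual d σ n0 V0 k0 s) := by
  have hpi := Real.pi_pos
  rcases Nat.eq_zero_or_pos d with rfl | hd
  · exact (summable_congr fun k => Subsingleton.elim _ (0 : ClockSpace 0)).2 summable_zero
  obtain ⟨K, hK⟩ := norm_shiftedWaveLogDeriv_sub_mul_le (d := d) (n0 := n0) (k0 := k0) hσ hb hV s 0
  refine .of_norm_bounded (summable_int_gaussian (a := Real.pi / σ ^ 2 / 2) (by positivity)
    (K * ‖clockHamiltonian d d‖ + K) (s + k0)) fun k => ?_
  obtain ⟨h1, h2⟩ := hK k
  have hK0 := (norm_nonneg _).trans h1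
  rw [sub_zero] at h2
  refine (norm_sub_le _ _).trans ?_
  rw [norm_smul, norm_smul, norm_smul, norm_mul, norm_timeState hd, Complex.norm_I,
      one_mul, mul_one]
  have h3 : ‖clockHamiltonian d d (timeState d k)‖ ≤ ‖clockHamiltonian d d‖ := by
    simpa [norm_timeState hd] using (clockHamiltonian d d).le_opNorm (timeState d k)
  calc _ ≤ K * Real.exp (-(Real.pi / σ ^ 2 / 2) * ((k : ℝ) - (s + k0)) ^ 2) *
        ‖clockHamiltonian d d‖ +
          K * Real.exp (-(Real.pi / σ ^ 2 / 2) * ((k : ℝ) - (s + k0)) ^ 2) := by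
        gcongr
    _ = _ := by ring

/-- There are d coordinates, each at most S/√d, so the ℓ² norm loses no power of d. -/
theorem norm_tsum_residual_le_of_coord (hd : 0 < d) (hσ : 0 < σ) (hb : 0 ≤ b)
    (hV : ∀ (k : ℕ) (x : ℝ), |iteratedDeriv k V0 x| ≤ 1 / 2 * b ^ (k + 1)) (s : ℝ) {S : ℝ}
    (hS : ∀ n : Fin d, ‖∑' k : ℤ, (shiftedWaveLogDeriv d σ n0 V0 k0 s k -
      Complex.I * (2 * Real.pi * (n : ℕ) / d)) * (shiftedWave d σ n0 V0 k0 s k *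
          Complex.exp (-Complex.I * (2 * Real.pi * (n : ℕ) * k / d)))‖ ≤ S) :
    ‖∑' k : ℤ, residual d σ n0 V0 k0 s k‖ ≤ S := by
  have hd' : (0 : ℝ) < d := by exact_mod_cast hd
  have hS0 : 0 ≤ S := (norm_nonneg _).trans (hS ⟨0, hd⟩)
  have hcoord : ∀ n : Fin d, ‖(∑' k : ℤ, residual d σ n0 V0 k0 s k) n‖ ≤ 1 / Real.sqrt d * S := by
    intro n
    have h := (EuclideanSpace.proj n : ClockSpace d →L[ℂ] ℂ).map_tsum
      (summable_residual (d := d) (n0 := n0) (k0 := k0) hσ hb hV s)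
    change _ = ∑' k : ℤ, residual d σ n0 V0 k0 s k n at h
    refine (congrArg norm h).trans_le ?_
    simp only [residual_apply]
    rw [tsum_mul_left, norm_mul, norm_neg, Complex.norm_real, Real.norm_of_nonneg (by positivity)]
    exact mul_le_mul_of_nonneg_left (hS n) (by positivity)
  refine le_of_sq_le_sq ?_ hS0
  rw [EuclideanSpace.norm_sq_eq]
  calc _ ≤ ∑ _n : Fin d, (1 / Real.sqrt d * S) ^ 2 := by
        gcongr with n _
        exact hcoord n
    _ = S ^ 2 := by
        rw [Finset.sum_const, Finset.card_univ, Fintype.card_fin, nsmul_eq_mul, mul_pow, div_pow,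
          one_pow, Real.sq_sqrt hd'.le]
        field_simp

/-- As |q| ≤ D, the number D m + q never has the sign opposite to that of m ≠ 0. The absolute values
open and each half is a copy of Σ n rⁿ = r/(1 - r)²; the weight |m| removes m = 0. -/
theorem hasSum_abs_mul_exp_neg_abs {D q : ℝ} (hD : 0 < D) (hq : |q| ≤ D) {h : ℝ} (hh : 0 < h) :
    HasSum (fun m : ℤ => |(m : ℝ)| * Real.exp (-|D * m + q| * h))
      ((Real.exp (-(D + q) * h) + Real.exp (-(D - q) * h)) / (1 - Real.exp (-D * h)) ^ 2) := by
  set r := Real.exp (-D * h) with hr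
  have hr1 : r < 1 := by rw [hr, Real.exp_lt_one_iff]; nlinarith
  have hr0 : 0 < r := Real.exp_pos _
  obtain ⟨hq1, hq2⟩ := abs_le.1 hq
  have hg : HasSum (fun n : ℕ => (n : ℝ) * r ^ n) (r / (1 - r) ^ 2) :=
    hasSum_coe_mul_geometric_of_norm_lt_one (by rwa [Real.norm_of_nonneg hr0.le])
  have hg' : HasSum (fun n : ℕ => ((n + 1 : ℕ) : ℝ) * r ^ (n + 1)) (r / (1 - r) ^ 2) := by
    rw [hasSum_nat_add_iff (f := fun n : ℕ => (n : ℝ) * r ^ n) 1]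
    simpa using hg
  have hpos : HasSum (fun n : ℕ => |((n : ℤ) : ℝ)| * Real.exp (-|D * ((n : ℤ) : ℝ) + q| * h))
      (Real.exp (-q * h) * (r / (1 - r) ^ 2)) := by
    refine Eq.mp (congrArg (fun F : ℕ → ℝ => HasSum F _) (funext fun n => ?_))
      (hg.mul_left (Real.exp (-q * h)))
    rcases Nat.eq_zero_or_pos n with rfl | hn
    · simp
    have hn' : (1 : ℝ) ≤ n := by exact_mod_cast hn
    rw [Int.cast_natCast, Nat.abs_cast, abs_of_nonneg (by nlinarith : 0 ≤ D * (n : ℝ) + q), hr,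
      ← Real.exp_nat_mul, mul_left_comm, ← Real.exp_add]
    congr 2
    ring
  have hneg : HasSum (fun n : ℕ => |((-((n : ℤ) + 1) : ℤ) : ℝ)| *
        Real.exp (-|D * ((-((n : ℤ) + 1) : ℤ) : ℝ) + q| * h))
      (Real.exp (q * h) * (r / (1 - r) ^ 2)) := by
    refine Eq.mp (congrArg (fun F : ℕ → ℝ => HasSum F _) (funext fun n => ?_))
      (hg'.mul_left (Real.exp (q * h)))
    have hn' : (0 : ℝ) ≤ n := n.cast_nonneg
    push_cast
    rw [abs_neg, abs_of_nonneg (by positivity : 0 ≤ (n : ℝ) + 1),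
      abs_of_nonpos (by nlinarith : D * (-((n : ℝ) + 1)) + q ≤ 0), hr,
      ← Real.exp_nat_mul, mul_left_comm, ← Real.exp_add]
    congr 2
    push_cast
    ring
  have hval : (Real.exp (-(D + q) * h) + Real.exp (-(D - q) * h)) / (1 - r) ^ 2 =
      Real.exp (-q * h) * (r / (1 - r) ^ 2) + Real.exp (q * h) * (r / (1 - r) ^ 2) := by
    rw [← mul_div_assoc, ← mul_div_assoc, ← add_div, hr, ← Real.exp_add, ← Real.exp_add]
    ring_nf
  rw [hval]
  exact (HasSum.of_nat_of_neg_add_one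
    (f := fun m : ℤ => |(m : ℝ)| * Real.exp (-|D * m + q| * h)) hpos hneg)

/-- The comparison state, summed over all sites, almost solves the Schrödinger equation. -/
theorem norm_tsum_residual_le (hd : 0 < d) (hσ : 0 < σ) (hV0 : ContDiff ℝ ∞ V0)
    (hb : 0 ≤ b) (hV : ∀ (k : ℕ) (x : ℝ), |iteratedDeriv k V0 x| ≤ 1 / 2 * b ^ (k + 1))
    {Q : ℝ} (hQ1 : Q + 1 / 2 ≤ n0 + 1) (hQ2 : Q + 1 / 2 ≤ d - n0) (hn0 : 0 ≤ n0) (hn0d : n0 ≤ d - 1)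
    (s : ℝ) {h : ℝ} (hh : 0 < h) :
    ‖∑' k : ℤ, residual d σ n0 V0 k0 s k‖ ≤ 2 * Real.pi * normConst d σ k0 * σ *
      Real.exp (Real.exp (b * h) - 1 + (d / σ) ^ 2 * h ^ 2 / (4 * Real.pi) - Q * h) *
      ((1 + Real.exp (-(d * h))) / (1 - Real.exp (-(d * h))) ^ 2) := by
  have hd' : (0 : ℝ) < d := by exact_mod_cast hd
  have hpi := Real.pi_pos
  have hA := normConst_nonneg d σ k0
  refine norm_tsum_residual_le_of_coord hd hσ hb hV s fun n => ?_
  have hn1 : ((n : ℕ) : ℝ) + 1 ≤ d := by exact_mod_cast n.2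
  have hn2 : (0 : ℝ) ≤ (n : ℕ) := Nat.cast_nonneg _
  set E : ℝ := Real.exp (Real.exp (b * h) - 1 + (d / σ) ^ 2 * h ^ 2 / (4 * Real.pi)) with hE
  have hsum := (hasSum_abs_mul_exp_neg_abs (q := (n : ℕ) - n0) hd'
    (abs_le.2 ⟨by linarith, by linarith⟩) hh).mul_left (2 * Real.pi * normConst d σ k0 * σ * E)
  obtain ⟨K, hK⟩ := norm_shiftedWaveLogDeriv_sub_mul_le (d := d) (n0 := n0) (k0 := k0) hσ hb hV s
    (Complex.I * (2 * Real.pi * (n : ℕ) / d))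
  have hexp1 : ∀ y : ℝ, ‖Complex.exp (-Complex.I * (2 * Real.pi * (n : ℕ) * y / d))‖ = 1 := by
    intro y
    have : -Complex.I * (2 * Real.pi * (n : ℕ) * y / d) =
      ((-(2 * Real.pi * (n : ℕ) * y / d) : ℝ) : ℂ) * Complex.I := by push_cast; ring
    rw [this, Complex.norm_exp_ofReal_mul_I]
  have key := norm_tsum_deriv_le (a := Real.pi / σ ^ 2 / 2) (K := K) (c := s + k0)
    (G := fun y : ℝ => shiftedWave d σ n0 V0 k0 s y *
      Complex.exp (-Complex.I * (2 * Real.pi * (n : ℕ) * y / d)))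
    (G' := fun y : ℝ => (shiftedWaveLogDeriv d σ n0 V0 k0 s y -
      Complex.I * (2 * Real.pi * (n : ℕ) / d)) * (shiftedWave d σ n0 V0 k0 s y *
          Complex.exp (-Complex.I * (2 * Real.pi * (n : ℕ) * y / d))))
    (fun y => ?_) ?_ (by positivity) (fun y => ?_) (fun y => ?_) (fun m => ?_) hsum
  · refine key.trans ?_
    rw [mul_assoc (2 * Real.pi * normConst d σ k0 * σ) E,
      mul_assoc (2 * Real.pi * normConst d σ k0 * σ)]
    refine mul_le_mul_of_nonneg_left ?_ (by positivity)
    rw [sub_eq_add_neg _ (Q * h), Real.exp_add _ (-(Q * h)), ← hE, mul_assoc E]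
    refine mul_le_mul_of_nonneg_left ?_ (Real.exp_pos _).le
    rw [← mul_div_assoc, neg_mul (d : ℝ) h]
    refine div_le_div_of_nonneg_right ?_ (sq_nonneg _)
    -- With u = e^{-(n+1/2)h} and v = e^{-(d-n-1/2)h}, both at most 1, (1 - u)(1 - v) ≥ 0 gives u +
    -- v ≤ 1 + uv = 1 + e^{-dh}, a bound free of n.
    have e1 : Real.exp (-(d + ((n : ℕ) - n0)) * h) ≤
        Real.exp (-(Q * h)) * Real.exp (-(((n : ℕ) : ℝ) + 1 / 2) * h) := by
      rw [← Real.exp_add]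
      exact Real.exp_le_exp.2 (by nlinarith)
    have e2 : Real.exp (-(d - ((n : ℕ) - n0)) * h) ≤
        Real.exp (-(Q * h)) * Real.exp (-((d : ℝ) - (n : ℕ) - 1 / 2) * h) := by
      rw [← Real.exp_add]
      exact Real.exp_le_exp.2 (by nlinarith)
    have e3 : Real.exp (-(d * h)) = Real.exp (-(((n : ℕ) : ℝ) + 1 / 2) * h) *
        Real.exp (-((d : ℝ) - (n : ℕ) - 1 / 2) * h) := by
      rw [← Real.exp_add]; ring_nf
    have e4 : Real.exp (-(((n : ℕ) : ℝ) + 1 / 2) * h) ≤ 1 := by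
      rw [Real.exp_le_one_iff]; nlinarith
    have e5 : Real.exp (-((d : ℝ) - (n : ℕ) - 1 / 2) * h) ≤ 1 := by
      rw [Real.exp_le_one_iff]; nlinarith
    have e6 := Real.exp_pos (-(Q * h))
    rw [e3]
    nlinarith [mul_nonneg e6.le (mul_nonneg (sub_nonneg.2 e4) (sub_nonneg.2 e5))]
  · have h1 : HasDerivAt (fun y : ℝ => Complex.exp (-Complex.I * (2 * Real.pi * (n : ℕ) * y / d)))
        (Complex.exp (-Complex.I * (2 * Real.pi * (n : ℕ) * y / d)) *
          (-Complex.I * (2 * Real.pi * (n : ℕ) * 1 / d))) y :=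
      ((((hasDerivAt_id y).ofReal_comp.const_mul (2 * Real.pi * (n : ℕ) : ℂ)).div_const
        (d : ℂ)).const_mul (-Complex.I)).cexp
    refine ((hasDerivAt_shiftedWave hV0.continuous s y).mul h1).congr_deriv ?_
    ring
  · have h1 := continuous_shiftedWave (d := d) (σ := σ) (n0 := n0) (k0 := k0) hV0.continuous s
    have h2 := continuous_shiftedWaveLogDeriv (d := d) (σ := σ) (n0 := n0) (k0 := k0)
      hV0.continuous s
    fun_prop
  · rw [norm_mul, hexp1, mul_one]
    exact (hK y).1
  · rw [norm_mul, norm_mul, hexp1, mul_one]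
    exact (hK y).2
  -- The factor e^{-2πi n y/d} moves the frequency from m to m + n/d.
  · have h1 := norm_fourier_shiftedWave_le (k0 := k0) (n0 := n0) hd hσ hV0 hb hV s
      (m + (n : ℕ) / d) hh.le
    have h2 : (fun y : ℝ => Complex.exp (-Complex.I * (2 * Real.pi * m * y)) *
        (shiftedWave d σ n0 V0 k0 s y *
          Complex.exp (-Complex.I * (2 * Real.pi * (n : ℕ) * y / d)))) =
        fun y : ℝ => Complex.exp (-Complex.I * (2 * Real.pi * ((m + (n : ℕ) / d : ℝ) : ℂ) * y)) *
          shiftedWave d σ n0 V0 k0 s y := by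
      funext y
      rw [mul_left_comm, ← Complex.exp_add, mul_comm]
      congr 2
      push_cast
      ring
    rw [h2]
    have h3 : (d : ℝ) * (m + (n : ℕ) / d) - n0 = d * m + ((n : ℕ) - n0) := by
      field_simp
      ring
    rw [h3, sub_eq_add_neg _ (|_| * h), Real.exp_add _ (-(|_| * h)), ← hE, ← neg_mul] at h1
    calc _ ≤ 2 * Real.pi * |(m : ℝ)| * (normConst d σ k0 * σ *
          (E * Real.exp (-|d * m + ((n : ℕ) - n0)| * h))) := by gcongr
      _ = _ := by ring

end Residual

/-! ### Sums of Gaussian tails -/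

section GaussianTails

variable {a δ r₀ : ℝ}

theorem gaussian_tail_term_le (ha : 0 < a) (hδ : 0 < δ) (hr : δ / 2 ≤ r₀) (i : ℕ) :
    Real.exp (-a * (r₀ + i) ^ 2) ≤
      Real.exp (-a * (δ ^ 2 / 4)) * Real.exp (-(a * δ) * i) := by
  rw [← Real.exp_add]
  refine Real.exp_le_exp.2 ?_
  have hi : (0 : ℝ) ≤ i := i.cast_nonneg
  have : δ ^ 2 / 4 + δ * i ≤ (r₀ + i) ^ 2 := by nlinarith [mul_nonneg hδ.le hi]
  nlinarith

theorem sum_gaussian_tail_le (ha : 0 < a) (hδ : 0 < δ) (hr : δ / 2 ≤ r₀) (N : ℕ) :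
    ∑ i ∈ Finset.range N, Real.exp (-a * (r₀ + i) ^ 2) ≤
      Real.exp (-a * (δ ^ 2 / 4)) * (1 / (1 - Real.exp (-(a * δ)))) := by
  have hq : Real.exp (-(a * δ)) < 1 := by
    rw [Real.exp_lt_one_iff, neg_lt_zero]; positivity
  refine (Finset.sum_le_sum fun i _ => gaussian_tail_term_le ha hδ hr i).trans ?_
  rw [← Finset.mul_sum]
  refine mul_le_mul_of_nonneg_left ?_ (Real.exp_pos _).le
  have h := (summable_geometric_of_lt_one (Real.exp_pos _).le hq).sum_le_tsum (Finset.range N)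
    (fun i _ => by positivity)
  rw [tsum_geometric_of_lt_one (Real.exp_pos _).le hq] at h
  rw [one_div]
  refine le_trans (le_of_eq (Finset.sum_congr rfl fun i _ => ?_)) h
  rw [← Real.exp_nat_mul, mul_comm]

/-- Telescoping: e^{a(2t-1)} - 1 ≥ a(2t - 1), and 2t ≤ (4/3)(2t - 1) once t ≥ 2, so 2at e^{-at²} ≤
(4/3)(e^{-a(t-1)²} - e^{-at²}). The first term is kept apart; `haδ` absorbs the 4/3. -/
theorem sum_linear_gaussian_tail_le (ha : 0 < a) (hδ : 2 ≤ δ) (hr : δ / 2 ≤ r₀)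
    (hr' : r₀ ≤ δ / 2 + 1) (haδ : 4 / 3 ≤ a * δ ^ 2) (N : ℕ) :
    ∑ i ∈ Finset.range N, 2 * a * (r₀ + i) * Real.exp (-a * (r₀ + i) ^ 2) ≤
      Real.exp (-a * (δ ^ 2 / 4)) * (2 * a * δ + a * δ ^ 2) := by
  have h0 : Real.exp (-a * r₀ ^ 2) ≤ Real.exp (-a * (δ ^ 2 / 4)) := by
    simpa using gaussian_tail_term_le ha (by linarith) hr 0
  have hstep : ∀ N : ℕ,
      ∑ i ∈ Finset.range (N + 1), 2 * a * (r₀ + i) * Real.exp (-a * (r₀ + i) ^ 2) ≤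
        2 * a * r₀ * Real.exp (-a * r₀ ^ 2) +
          4 / 3 * (Real.exp (-a * r₀ ^ 2) - Real.exp (-a * (r₀ + N) ^ 2)) := by
    intro N
    induction N with
    | zero => simp
    | succ N ih =>
      rw [Finset.sum_range_succ]
      set t : ℝ := r₀ + (N + 1 : ℕ) with ht
      have hN : (0 : ℝ) ≤ N := N.cast_nonneg
      have ht2 : 2 ≤ t := by rw [ht]; push_cast; linarith
      have h1 : Real.exp (-a * (r₀ + N) ^ 2) =
          Real.exp (-a * t ^ 2) * Real.exp (a * (2 * t - 1)) := by
        rw [← Real.exp_add, ht]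
        push_cast
        ring_nf
      have h2 : a * (2 * t - 1) + 1 ≤ Real.exp (a * (2 * t - 1)) := Real.add_one_le_exp _
      have h3 := Real.exp_pos (-a * t ^ 2)
      have h4 : 2 * a * t * Real.exp (-a * t ^ 2) ≤
          4 / 3 * (Real.exp (-a * (r₀ + N) ^ 2) - Real.exp (-a * t ^ 2)) := by
        rw [h1]
        have h5 : 2 * a * t ≤ 4 / 3 * (Real.exp (a * (2 * t - 1)) - 1) := by nlinarith
        nlinarith [mul_le_mul_of_nonneg_right h5 h3.le]
      linarith
  have hpos : ∀ i : ℕ, 0 ≤ 2 * a * (r₀ + i) * Real.exp (-a * (r₀ + i) ^ 2) := fun i => by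
    have : 0 ≤ r₀ := by linarith
    positivity
  calc _ ≤ ∑ i ∈ Finset.range (N + 1), 2 * a * (r₀ + i) * Real.exp (-a * (r₀ + i) ^ 2) :=
        Finset.sum_le_sum_of_subset_of_nonneg (Finset.range_subset_range.2 (Nat.le_succ N))
          fun i _ _ => hpos i
    _ ≤ (2 * a * r₀ + 4 / 3) * Real.exp (-a * r₀ ^ 2) := by
        have := hstep N
        have := Real.exp_pos (-a * (r₀ + N) ^ 2)
        linarith
    _ ≤ (2 * a * δ + a * δ ^ 2) * Real.exp (-a * (δ ^ 2 / 4)) := by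
        have : 0 ≤ r₀ := by linarith
        gcongr
        linarith
    _ = _ := mul_comm _ _

theorem sum_affine_gaussian_tail_le (ha : 0 < a) (hδ : 2 ≤ δ) (hr : δ / 2 ≤ r₀)
    (hr' : r₀ ≤ δ / 2 + 1) (haδ : 4 / 3 ≤ a * δ ^ 2) {C : ℝ} (hC : 0 ≤ C) (N : ℕ) :
    ∑ i ∈ Finset.range N, (C + 2 * a * (r₀ + i)) * Real.exp (-a * (r₀ + i) ^ 2) ≤
      Real.exp (-a * (δ ^ 2 / 4)) *
        (C * (1 / (1 - Real.exp (-(a * δ)))) + (2 * a * δ + a * δ ^ 2)) := by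
  have h1 := mul_le_mul_of_nonneg_left (sum_gaussian_tail_le ha (by linarith) hr N) hC
  have h2 := sum_linear_gaussian_tail_le ha hδ hr hr' haδ N
  simp only [add_mul]
  rw [Finset.sum_add_distrib, ← Finset.mul_sum]
  linarith

end GaussianTails

/-! ### Tails of superpositions of time states -/

section TimeStateTails

variable {d : ℕ}

/-- An `ℓ²` estimate for a geometrically decaying superposition of time states: blocks of `d`
consecutive states are orthonormal. -/
theorem norm_tsum_timeState_le (hd : 0 < d) {κ : ℕ → ℤ}
    (hκ : ∀ i j : ℕ, κ i ≡ κ j [ZMOD d] → i ≡ j [MOD d]) {c : ℕ → ℂ} {C y : ℝ} (hy : 0 < y)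
    (hC : 0 ≤ C) (hc : ∀ i : ℕ, ‖c i‖ ≤ C * Real.exp (-y * i)) :
    ‖∑' i : ℕ, c i • timeState d (κ i)‖ ≤
      C * (1 / (Real.sqrt (1 - Real.exp (-(2 * y))) * (1 - Real.exp (-(y * d))))) := by
  have hd' : (0 : ℝ) < d := by exact_mod_cast hd
  have hexp : ∀ (z : ℝ) (i : ℕ), Real.exp (-z * i) = Real.exp (-z) ^ i := fun z i => by
    rw [← Real.exp_nat_mul, mul_comm]
  have hq : ∀ z : ℝ, 0 < z → Real.exp (-z) < 1 := fun z hz => by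
    rw [Real.exp_lt_one_iff]; linarith
  have hgeo : ∀ z : ℝ, 0 < z → ∀ N : ℕ,
      ∑ i ∈ Finset.range N, Real.exp (-z * i) ≤ 1 / (1 - Real.exp (-z)) := fun z hz N => by
    simp only [hexp]
    have h := (summable_geometric_of_lt_one (Real.exp_pos (-z)).le (hq z hz)).sum_le_tsum
      (Finset.range N) (fun i _ => by positivity)
    rwa [tsum_geometric_of_lt_one (Real.exp_pos _).le (hq z hz), ← one_div] at h
  have hs2 : 0 < 1 - Real.exp (-(2 * y)) := sub_pos.2 (hq _ (by positivity))
  have hsum : Summable fun i : ℕ => c i • timeState d (κ i) := by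
    refine .of_norm_bounded ((summable_geometric_of_lt_one (Real.exp_pos (-y)).le
      (hq y hy)).mul_left C) fun i => ?_
    rw [norm_smul, norm_timeState hd, mul_one, ← hexp]
    exact hc i
  -- Pythagoras inside a block gives 1/√(1 - e^{-2y}) where the triangle inequality would give 1/(1
  -- - e^{-y}); only the blocks themselves are added by the triangle inequality, with ratio e^{-yd}.
  have hblock : ∀ N : ℕ, ‖∑ r ∈ Finset.range d, c (N * d + r) • timeState d (κ (N * d + r))‖ ≤
      C * (1 / Real.sqrt (1 - Real.exp (-(2 * y)))) * Real.exp (-(y * d) * N) := by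
    intro N
    refine le_of_sq_le_sq ?_ (by positivity)
    rw [norm_sq_sum_timeState hd (S := Finset.range d) (κ := fun r => κ (N * d + r))
      (fun i hi j hj h => ?_)]
    · calc _ ≤ ∑ r ∈ Finset.range d,
            (C * Real.exp (-(y * d) * N)) ^ 2 * Real.exp (-(2 * y) * r) := by
            refine Finset.sum_le_sum fun r _ => ?_
            refine (pow_le_pow_left₀ (norm_nonneg _) (hc _) 2).trans_eq ?_
            rw [mul_pow, mul_pow, mul_assoc, ← Real.exp_nat_mul, ← Real.exp_nat_mul, ← Real.exp_add]
            push_cast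
            ring_nf
        _ ≤ (C * Real.exp (-(y * d) * N)) ^ 2 * (1 / (1 - Real.exp (-(2 * y)))) := by
            rw [← Finset.mul_sum]
            exact mul_le_mul_of_nonneg_left (hgeo _ (by positivity) d) (sq_nonneg _)
        _ = _ := by
            rw [mul_pow, mul_pow, mul_pow, div_pow, Real.sq_sqrt hs2.le]
            ring
    · have h2 := hκ _ _ h
      rw [Finset.mem_range] at hi hj
      rw [Nat.ModEq, Nat.mul_add_mod', Nat.mul_add_mod', Nat.mod_eq_of_lt hi,
        Nat.mod_eq_of_lt hj] at h2
      exact h2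
  have hpart : ∀ N : ℕ, ‖∑ i ∈ Finset.range (N * d), c i • timeState d (κ i)‖ ≤
      ∑ j ∈ Finset.range N, C * (1 / Real.sqrt (1 - Real.exp (-(2 * y)))) *
        Real.exp (-(y * d) * j) := by
    intro N
    induction N with
    | zero => simp
    | succ N ih =>
      rw [Nat.succ_mul, Finset.sum_range_add, Finset.sum_range_succ]
      exact (norm_add_le _ _).trans (add_le_add ih (hblock N))
  have hlim : Filter.Tendsto
      (fun N : ℕ => ‖∑ i ∈ Finset.range (N * d), c i • timeState d (κ i)‖) Filter.atTop
      (nhds ‖∑' i : ℕ, c i • timeState d (κ i)‖) :=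
    (hsum.hasSum.tendsto_sum_nat.comp (Filter.tendsto_id.atTop_mul_const' hd)).norm
  refine le_of_tendsto' hlim fun N => (hpart N).trans ?_
  rw [← Finset.mul_sum]
  refine (mul_le_mul_of_nonneg_left (hgeo _ (by positivity) N) (by positivity)).trans_eq ?_
  rw [mul_assoc, div_mul_div_comm, one_mul]

/-- All coordinates satisfy |n - n0| ≤ d - 1. Keeping d - 1 instead of d leaves the room into which
the potential tail fits when b ≤ 1. -/
theorem norm_clockHamiltonian_timeState_sub_le {n0 : ℝ} (hd : 0 < d) (hn0 : 0 ≤ n0)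
    (hn0d : n0 ≤ d - 1) (k : ℤ) :
    ‖clockHamiltonian d d (timeState d k) - ((2 * Real.pi * n0 / d : ℝ) : ℂ) • timeState d k‖ ≤
      2 * Real.pi * (d - 1) / d := by
  have hd' : (0 : ℝ) < d := by exact_mod_cast hd
  have hd1 : (1 : ℝ) ≤ d := by exact_mod_cast hd
  have hpi := Real.pi_pos
  have h0 : 0 ≤ 2 * Real.pi * (d - 1) / (d : ℝ) :=
    div_nonneg (mul_nonneg (by positivity) (by linarith)) hd'.le
  refine le_of_sq_le_sq ?_ h0
  rw [EuclideanSpace.norm_sq_eq]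
  calc _ ≤ ∑ _n : Fin d, (2 * Real.pi * (d - 1) / d * (1 / Real.sqrt d)) ^ 2 := by
        refine Finset.sum_le_sum fun n _ => pow_le_pow_left₀ (norm_nonneg _) ?_ 2
        have hn1 : ((n : ℕ) : ℝ) + 1 ≤ d := by exact_mod_cast n.2
        have hn2 : (0 : ℝ) ≤ (n : ℕ) := Nat.cast_nonneg _
        rw [PiLp.sub_apply, PiLp.smul_apply, clockHamiltonian_apply, smul_eq_mul, ← sub_mul,
          ← Complex.ofReal_sub, norm_mul, norm_timeState_apply, Complex.norm_real,
          Real.norm_eq_abs]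
        refine mul_le_mul_of_nonneg_right ?_ (by positivity)
        rw [show ((n : ℕ) : ℝ) * (2 * Real.pi / d) - 2 * Real.pi * n0 / d =
          2 * Real.pi / d * ((n : ℕ) - n0) by ring, abs_mul,
          abs_of_pos (by positivity : 0 < 2 * Real.pi / (d : ℝ)),
          mul_div_right_comm (2 * Real.pi) ((d : ℝ) - 1)]
        exact mul_le_mul_of_nonneg_left (abs_le.2 ⟨by linarith, by linarith⟩) (by positivity)
    _ = _ := by
        rw [Finset.sum_const, Finset.card_univ, Fintype.card_fin, nsmul_eq_mul, mul_pow _ (1 / _),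
          div_pow 1, one_pow, Real.sq_sqrt hd'.le]
        field_simp

end TimeStateTails

/-! ### Splitting a sum over ℤ into a window and two tails -/

section Window

theorem tsum_int_eq_window {E : Type*} [NormedAddCommGroup E] [CompleteSpace E] {f : ℤ → E}
    (hf : Summable f) (d : ℕ) (m : ℤ) :
    ∑' k, f k = ∑ k ∈ Finset.Ioc (m - d) m, f k + ∑' i : ℕ, f (m + 1 + i) +
      ∑' i : ℕ, f (m - d - i) := by
  have hg : Summable fun j : ℤ => f (m + 1 + j) := (Equiv.addLeft (m + 1)).summable_iff.2 hf
  have h0 : ∑' k, f k = ∑' j : ℤ, f (m + 1 + j) := ((Equiv.addLeft (m + 1)).tsum_eq f).symm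
  have h1 : Summable fun i : ℕ => f (m + 1 + i) :=
    hg.comp_injective (i := fun i : ℕ => (i : ℤ)) Nat.cast_injective
  have h2 : Summable fun i : ℕ => f (m + 1 + -((i : ℤ) + 1)) :=
    hg.comp_injective (i := fun i : ℕ => -((i : ℤ) + 1)) fun i j h => by
      simpa using h
  rw [h0, tsum_of_nat_of_neg_add_one (f := fun j : ℤ => f (m + 1 + j)) h1 h2,
    ← h2.sum_add_tsum_nat_add d]
  -- Seen from m + 1, the negative indices read downwards give first the d sites of the window, then
  -- the left tail.
  have h3 : ∑ i ∈ Finset.range d, f (m + 1 + -((i : ℤ) + 1)) = ∑ k ∈ Finset.Ioc (m - d) m, f k := by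
    refine Finset.sum_nbij' (fun i : ℕ => m - i) (fun k => (m - k).toNat) ?_ ?_ ?_ ?_ ?_
    · intro i hi
      rw [Finset.mem_range] at hi
      rw [Finset.mem_Ioc]
      omega
    · intro k hk
      rw [Finset.mem_Ioc] at hk
      rw [Finset.mem_range]
      omega
    · intro i _; simp
    · intro k hk
      rw [Finset.mem_Ioc] at hk
      omega
    · intro i _
      congr 1
      ring
  have h4 : ∀ i : ℕ, m + 1 + -(((i + d : ℕ) : ℤ) + 1) = m - d - i := fun i => by push_cast; ring
  simp only [h3, h4]
  abel

end Window

/-! ### Residuals outside the window -/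

section ResidualTails

variable {d : ℕ} {σ n0 : ℝ} {V0 : ℝ → ℝ} {b k0 : ℝ}

/-- The potential difference is split off, because its tail is later bounded in two ways: termwise,
or through orthonormality. -/
theorem norm_residual_add_le (hd : 0 < d) (hn0 : 0 ≤ n0) (hn0d : n0 ≤ d - 1) (s : ℝ) (k : ℤ) :
    ‖residual d σ n0 V0 k0 s k -
        (Complex.I * ((potential d V0 k - potential d V0 (k - s) : ℝ) : ℂ) *
          shiftedWave d σ n0 V0 k0 s k) • timeState d k‖ ≤
      normConst d σ k0 * ((2 * Real.pi * (d - 1) / d + 2 * (Real.pi / σ ^ 2) * |(k : ℝ) - s - k0|) *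
        Real.exp (-(Real.pi / σ ^ 2) * ((k : ℝ) - s - k0) ^ 2)) := by
  have hpi := Real.pi_pos
  have h : residual d σ n0 V0 k0 s k -
        (Complex.I * ((potential d V0 k - potential d V0 (k - s) : ℝ) : ℂ) *
          shiftedWave d σ n0 V0 k0 s k) • timeState d k =
      shiftedWave d σ n0 V0 k0 s k • (Complex.I • (clockHamiltonian d d (timeState d k) -
        ((2 * Real.pi * n0 / d : ℝ) : ℂ) • timeState d k) +
        ((2 * (Real.pi / σ ^ 2) * ((k : ℝ) - s - k0) : ℝ) : ℂ) • timeState d k) := by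
    rw [residual, shiftedWaveLogDeriv]
    push_cast
    module
  rw [h, norm_smul, norm_shiftedWave, mul_assoc]
  refine mul_le_mul_of_nonneg_left ?_ (normConst_nonneg d σ k0)
  rw [mul_comm]
  refine mul_le_mul_of_nonneg_right ((norm_add_le _ _).trans ?_) (Real.exp_pos _).le
  rw [norm_smul, norm_smul, Complex.norm_I, one_mul, norm_timeState hd, mul_one,
    Complex.norm_real, Real.norm_eq_abs, abs_mul,
    abs_of_nonneg (by positivity : 0 ≤ 2 * (Real.pi / σ ^ 2))]
  gcongr
  exact norm_clockHamiltonian_timeState_sub_le hd hn0 hn0d k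

theorem norm_potential_sub_mul_shiftedWave_le
    (hV : ∀ (k : ℕ) (x : ℝ), |iteratedDeriv k V0 x| ≤ 1 / 2 * b ^ (k + 1)) (s y : ℝ) :
    ‖Complex.I * ((potential d V0 y - potential d V0 (y - s) : ℝ) : ℂ) *
          shiftedWave d σ n0 V0 k0 s y‖ ≤
      normConst d σ k0 * (2 * Real.pi * b / d *
        Real.exp (-(Real.pi / σ ^ 2) * (y - s - k0) ^ 2)) := by
  rw [norm_mul, norm_mul, Complex.norm_I, one_mul, norm_shiftedWave, Complex.norm_real,
    Real.norm_eq_abs, mul_left_comm]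
  refine mul_le_mul_of_nonneg_left
    (mul_le_mul_of_nonneg_right ?_ (Real.exp_pos _).le) (normConst_nonneg d σ k0)
  have h2 := abs_sub (potential d V0 y) (potential d V0 (y - s))
  have h3 := abs_potential_le (d := d) hV y
  have h4 := abs_potential_le (d := d) hV (y - s)
  have h5 : Real.pi * b / d + Real.pi * b / d = 2 * Real.pi * b / d := by ring
  linarith

theorem norm_tsum_le_of_sum_range {E : Type*} [NormedAddCommGroup E] {f : ℕ → E}
    (hf : Summable f) {g : ℕ → ℝ} (hfg : ∀ i, ‖f i‖ ≤ g i) {S : ℝ}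
    (hS : ∀ N, ∑ i ∈ Finset.range N, g i ≤ S) : ‖∑' i, f i‖ ≤ S :=
  le_of_tendsto' hf.hasSum.tendsto_sum_nat.norm fun N =>
    (norm_sum_le _ _).trans ((Finset.sum_le_sum fun i _ => hfg i).trans (hS N))

variable {s r₀ : ℝ} {κ : ℕ → ℤ}

theorem norm_tsum_residual_tail_le (hd : 2 ≤ d) (hσ : 0 < σ) (hσd : σ < d) (hb : 0 ≤ b)
    (hn0 : 0 ≤ n0) (hn0d : n0 ≤ d - 1)
    (hV : ∀ (k : ℕ) (x : ℝ), |iteratedDeriv k V0 x| ≤ 1 / 2 * b ^ (k + 1))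
    (hκ : ∀ i : ℕ, |(κ i : ℝ) - s - k0| = r₀ + i) (hr : (d : ℝ) / 2 ≤ r₀)
    (hr' : r₀ ≤ (d : ℝ) / 2 + 1) (hsum : Summable fun i => residual d σ n0 V0 k0 s (κ i)) :
    ‖∑' i : ℕ, residual d σ n0 V0 k0 s (κ i)‖ ≤
      normConst d σ k0 * (Real.exp (-(Real.pi / σ ^ 2) * ((d : ℝ) ^ 2 / 4)) *
        ((2 * Real.pi * (d - 1) / d + 2 * Real.pi * b / d) *
            (1 / (1 - Real.exp (-(Real.pi / σ ^ 2 * d)))) +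
          (2 * (Real.pi / σ ^ 2) * d + Real.pi / σ ^ 2 * d ^ 2))) := by
  have hpi := Real.pi_pos
  have hpi3 := Real.pi_gt_three
  have hd2 : (2 : ℝ) ≤ d := by exact_mod_cast hd
  have had : 4 / 3 ≤ Real.pi / σ ^ 2 * (d : ℝ) ^ 2 := by
    have : 1 ≤ (d : ℝ) ^ 2 / σ ^ 2 := by
      rw [le_div_iff₀ (by positivity)]; nlinarith
    calc (4 / 3 : ℝ) ≤ Real.pi * ((d : ℝ) ^ 2 / σ ^ 2) := by nlinarith
      _ = _ := by ring
  have hC : 0 ≤ 2 * Real.pi * (d - 1) / (d : ℝ) + 2 * Real.pi * b / d :=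
    add_nonneg (div_nonneg (mul_nonneg (by positivity) (by linarith)) (by linarith))
      (by positivity)
  refine norm_tsum_le_of_sum_range hsum
    (g := fun i : ℕ => normConst d σ k0 * ((2 * Real.pi * (d - 1) / (d : ℝ) + 2 * Real.pi * b / d
      + 2 * (Real.pi / σ ^ 2) * (r₀ + i)) * Real.exp (-(Real.pi / σ ^ 2) * (r₀ + i) ^ 2)))
    (fun i => ?_) fun N => ?_
  · have h1 := norm_residual_add_le (σ := σ) (V0 := V0) (k0 := k0) (by omega : 0 < d) hn0 hn0d
      s (κ i)
    have h2 := norm_potential_sub_mul_shiftedWave_le (d := d) (σ := σ) (n0 := n0) (k0 := k0) hV s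
      (κ i)
    have h3 := norm_le_norm_sub_add (residual d σ n0 V0 k0 s (κ i))
      ((Complex.I * ((potential d V0 (κ i) - potential d V0 (κ i - s) : ℝ) : ℂ) *
          shiftedWave d σ n0 V0 k0 s (κ i)) • timeState d (κ i))
    rw [norm_smul, norm_timeState (by omega), mul_one] at h3
    rw [← sq_abs ((κ i : ℝ) - s - k0), hκ i] at h1 h2
    refine (h3.trans (add_le_add h1 h2)).trans_eq ?_
    ring
  · rw [← Finset.mul_sum]
    exact mul_le_mul_of_nonneg_left
      (sum_affine_gaussian_tail_le (by positivity) hd2 hr hr' had hC N) (normConst_nonneg d σ k0)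

/-- Here the potential part goes through `norm_tsum_timeState_le`; the rest is treated termwise as
in `norm_tsum_residual_tail_le`. -/
theorem norm_tsum_residual_tail_le' (hd : 2 ≤ d) (hσ : 0 < σ) (hσd : σ < d) (hb : 0 ≤ b)
    (hn0 : 0 ≤ n0) (hn0d : n0 ≤ d - 1)
    (hV : ∀ (k : ℕ) (x : ℝ), |iteratedDeriv k V0 x| ≤ 1 / 2 * b ^ (k + 1))
    (hκ : ∀ i : ℕ, |(κ i : ℝ) - s - k0| = r₀ + i) (hr : (d : ℝ) / 2 ≤ r₀)
    (hr' : r₀ ≤ (d : ℝ) / 2 + 1) (hsum : Summable fun i => residual d σ n0 V0 k0 s (κ i))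
    (hκd : ∀ i j : ℕ, κ i ≡ κ j [ZMOD d] → i ≡ j [MOD d]) :
    ‖∑' i : ℕ, residual d σ n0 V0 k0 s (κ i)‖ ≤
      normConst d σ k0 * (Real.exp (-(Real.pi / σ ^ 2) * ((d : ℝ) ^ 2 / 4)) *
        ((2 * Real.pi * (d - 1) / d) *
            (1 / (1 - Real.exp (-(Real.pi / σ ^ 2 * d)))) +
          (2 * (Real.pi / σ ^ 2) * d + Real.pi / σ ^ 2 * d ^ 2) +
          2 * Real.pi * b / d * (1 / (Real.sqrt (1 - Real.exp (-(2 * (Real.pi / σ ^ 2 * d)))) *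
            (1 - Real.exp (-(Real.pi / σ ^ 2 * d * d))))))) := by
  have hpi := Real.pi_pos
  have hpi3 := Real.pi_gt_three
  have hd0 : 0 < d := by omega
  have hd2 : (2 : ℝ) ≤ d := by exact_mod_cast hd
  have hA := normConst_nonneg d σ k0
  have had : 4 / 3 ≤ Real.pi / σ ^ 2 * (d : ℝ) ^ 2 := by
    have : 1 ≤ (d : ℝ) ^ 2 / σ ^ 2 := by
      rw [le_div_iff₀ (by positivity)]; nlinarith
    calc (4 / 3 : ℝ) ≤ Real.pi * ((d : ℝ) ^ 2 / σ ^ 2) := by nlinarith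
      _ = _ := by ring
  have hC : 0 ≤ 2 * Real.pi * (d - 1) / (d : ℝ) :=
    div_nonneg (mul_nonneg (by positivity) (by linarith)) (by linarith)
  set c : ℕ → ℂ := fun i =>
    Complex.I * ((potential d V0 (κ i) - potential d V0 (κ i - s) : ℝ) : ℂ) *
          shiftedWave d σ n0 V0 k0 s (κ i) with hc
  have hcb : ∀ i : ℕ, ‖c i‖ ≤ normConst d σ k0 * (2 * Real.pi * b / d *
      Real.exp (-(Real.pi / σ ^ 2) * ((d : ℝ) ^ 2 / 4))) *
      Real.exp (-(Real.pi / σ ^ 2 * d) * i) := by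
    intro i
    have h2 := norm_potential_sub_mul_shiftedWave_le (d := d) (σ := σ) (n0 := n0) (k0 := k0) hV s
      (κ i)
    rw [← sq_abs ((κ i : ℝ) - s - k0), hκ i] at h2
    refine h2.trans ?_
    rw [mul_assoc (normConst d σ k0), mul_assoc (2 * Real.pi * b / (d : ℝ))]
    refine mul_le_mul_of_nonneg_left (mul_le_mul_of_nonneg_left ?_ (by positivity)) hA
    exact gaussian_tail_term_le (by positivity) (by linarith) hr i
  have hq : Real.exp (-(Real.pi / σ ^ 2 * d)) < 1 := by
    rw [Real.exp_lt_one_iff, neg_lt_zero]; positivity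
  have hcs : Summable fun i => c i • timeState d (κ i) := by
    refine .of_norm_bounded ((summable_geometric_of_lt_one (Real.exp_pos _).le hq).mul_left
      (normConst d σ k0 * (2 * Real.pi * b / d *
        Real.exp (-(Real.pi / σ ^ 2) * ((d : ℝ) ^ 2 / 4))))) fun i => ?_
    rw [norm_smul, norm_timeState hd0, mul_one, ← Real.exp_nat_mul, mul_comm (i : ℝ)]
    exact hcb i
  have h1 : ‖∑' i : ℕ, (residual d σ n0 V0 k0 s (κ i) - c i • timeState d (κ i))‖ ≤
      normConst d σ k0 * (Real.exp (-(Real.pi / σ ^ 2) * ((d : ℝ) ^ 2 / 4)) *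
        ((2 * Real.pi * (d - 1) / d) *
            (1 / (1 - Real.exp (-(Real.pi / σ ^ 2 * d)))) +
          (2 * (Real.pi / σ ^ 2) * d + Real.pi / σ ^ 2 * d ^ 2))) := by
    refine norm_tsum_le_of_sum_range (hsum.sub hcs)
      (g := fun i : ℕ => normConst d σ k0 * ((2 * Real.pi * (d - 1) / (d : ℝ)
        + 2 * (Real.pi / σ ^ 2) * (r₀ + i)) * Real.exp (-(Real.pi / σ ^ 2) * (r₀ + i) ^ 2)))
      (fun i => ?_) fun N => ?_
    · have h1 := norm_residual_add_le (σ := σ) (V0 := V0) (k0 := k0) hd0 hn0 hn0d s (κ i)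
      rwa [← sq_abs ((κ i : ℝ) - s - k0), hκ i] at h1
    · rw [← Finset.mul_sum]
      exact mul_le_mul_of_nonneg_left
        (sum_affine_gaussian_tail_le (by positivity) hd2 hr hr' had hC N) hA
  have h2 := norm_tsum_timeState_le hd0 hκd (by positivity) (by positivity) hcb
  rw [hsum.tsum_sub hcs] at h1
  refine (norm_le_norm_sub_add _ (∑' i, c i • timeState d (κ i))).trans
    ((add_le_add h1 h2).trans_eq ?_)
  ring

end ResidualTails

/-! ### The defect on a window -/

section WindowResidual

variable {d : ℕ} {σ n0 : ℝ} {V0 : ℝ → ℝ} {b k0 s : ℝ} {m : ℤ}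

theorem abs_right_tail (hm' : s + k0 + d / 2 ≤ m + 1) (i : ℕ) :
    |((m + 1 + i : ℤ) : ℝ) - s - k0| = m + 1 - s - k0 + i := by
  have hi : (0 : ℝ) ≤ i := i.cast_nonneg
  have hd : (0 : ℝ) ≤ d := d.cast_nonneg
  push_cast
  rw [abs_of_nonneg (by linarith)]
  ring

theorem abs_left_tail (hm : (m : ℝ) ≤ s + k0 + d / 2) (i : ℕ) :
    |((m - d - i : ℤ) : ℝ) - s - k0| = s + k0 + d - m + i := by
  have hi : (0 : ℝ) ≤ i := i.cast_nonneg
  have hd : (0 : ℝ) ≤ d := d.cast_nonneg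
  push_cast
  rw [abs_of_nonpos (by linarith)]
  ring

theorem norm_window_residual_le_add (hσ : 0 < σ) (hb : 0 ≤ b)
    (hV : ∀ (k : ℕ) (x : ℝ), |iteratedDeriv k V0 x| ≤ 1 / 2 * b ^ (k + 1)) {X T : ℝ}
    (hX : ‖∑' k : ℤ, residual d σ n0 V0 k0 s k‖ ≤ X)
    (hR : ‖∑' i : ℕ, residual d σ n0 V0 k0 s (m + 1 + i)‖ ≤ T)
    (hL : ‖∑' i : ℕ, residual d σ n0 V0 k0 s (m - d - i)‖ ≤ T) :
    ‖∑ k ∈ Finset.Ioc (m - d) m, residual d σ n0 V0 k0 s k‖ ≤ X + 2 * T := by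
  have h := tsum_int_eq_window (summable_residual (d := d) (n0 := n0) (k0 := k0) hσ hb hV s) d m
  rw [add_assoc, ← sub_eq_iff_eq_add] at h
  rw [← h]
  have h1 := norm_sub_le (∑' k : ℤ, residual d σ n0 V0 k0 s k)
    (∑' i : ℕ, residual d σ n0 V0 k0 s (m + 1 + i) + ∑' i : ℕ, residual d σ n0 V0 k0 s (m - d - i))
  have h2 := norm_add_le (∑' i : ℕ, residual d σ n0 V0 k0 s (m + 1 + i))
    (∑' i : ℕ, residual d σ n0 V0 k0 s (m - d - i))
  linarith

theorem summable_residual_tails (hσ : 0 < σ) (hb : 0 ≤ b)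
    (hV : ∀ (k : ℕ) (x : ℝ), |iteratedDeriv k V0 x| ≤ 1 / 2 * b ^ (k + 1)) :
    (Summable fun i : ℕ => residual d σ n0 V0 k0 s (m + 1 + i)) ∧
      Summable fun i : ℕ => residual d σ n0 V0 k0 s (m - d - i) := by
  have h := summable_residual (d := d) (n0 := n0) (k0 := k0) hσ hb hV s
  exact ⟨h.comp_injective (i := fun i : ℕ => m + 1 + (i : ℤ)) fun i j hij => by simpa using hij,
    h.comp_injective (i := fun i : ℕ => m - d - (i : ℤ)) fun i j hij => by simpa using hij⟩

/-- The conditions on m put the first site of either tail at a distance between d/2 and d/2 + 1 from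
the centre s + k0. -/
theorem norm_window_residual_le (hd : 2 ≤ d) (hσ : 0 < σ) (hσd : σ < d) (hb : 0 ≤ b)
    (hn0 : 0 ≤ n0) (hn0d : n0 ≤ d - 1)
    (hV : ∀ (k : ℕ) (x : ℝ), |iteratedDeriv k V0 x| ≤ 1 / 2 * b ^ (k + 1))
    (hm : (m : ℝ) ≤ s + k0 + d / 2) (hm' : s + k0 + d / 2 ≤ m + 1) {X : ℝ}
    (hX : ‖∑' k : ℤ, residual d σ n0 V0 k0 s k‖ ≤ X) :
    ‖∑ k ∈ Finset.Ioc (m - d) m, residual d σ n0 V0 k0 s k‖ ≤ X + 2 *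
      (normConst d σ k0 * (Real.exp (-(Real.pi / σ ^ 2) * ((d : ℝ) ^ 2 / 4)) *
        ((2 * Real.pi * (d - 1) / d + 2 * Real.pi * b / d) *
            (1 / (1 - Real.exp (-(Real.pi / σ ^ 2 * d)))) +
          (2 * (Real.pi / σ ^ 2) * d + Real.pi / σ ^ 2 * d ^ 2)))) := by
  obtain ⟨h1, h2⟩ := summable_residual_tails (d := d) (n0 := n0) (k0 := k0) (s := s) (m := m)
    hσ hb hV
  refine norm_window_residual_le_add hσ hb hV hX ?_ ?_
  · exact norm_tsum_residual_tail_le (κ := fun i : ℕ => m + 1 + i) hd hσ hσd hb hn0 hn0d hV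
      (fun i => abs_right_tail hm' i) (by linarith) (by linarith) h1
  · exact norm_tsum_residual_tail_le (κ := fun i : ℕ => m - d - i) hd hσ hσd hb hn0 hn0d hV
      (fun i => abs_left_tail hm i) (by linarith) (by linarith) h2

theorem norm_window_residual_le' (hd : 2 ≤ d) (hσ : 0 < σ) (hσd : σ < d) (hb : 0 ≤ b)
    (hn0 : 0 ≤ n0) (hn0d : n0 ≤ d - 1)
    (hV : ∀ (k : ℕ) (x : ℝ), |iteratedDeriv k V0 x| ≤ 1 / 2 * b ^ (k + 1))
    (hm : (m : ℝ) ≤ s + k0 + d / 2) (hm' : s + k0 + d / 2 ≤ m + 1) {X : ℝ}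
    (hX : ‖∑' k : ℤ, residual d σ n0 V0 k0 s k‖ ≤ X) :
    ‖∑ k ∈ Finset.Ioc (m - d) m, residual d σ n0 V0 k0 s k‖ ≤ X + 2 *
      (normConst d σ k0 * (Real.exp (-(Real.pi / σ ^ 2) * ((d : ℝ) ^ 2 / 4)) *
        ((2 * Real.pi * (d - 1) / d) *
            (1 / (1 - Real.exp (-(Real.pi / σ ^ 2 * d)))) +
          (2 * (Real.pi / σ ^ 2) * d + Real.pi / σ ^ 2 * d ^ 2) +
          2 * Real.pi * b / d * (1 / (Real.sqrt (1 - Real.exp (-(2 * (Real.pi / σ ^ 2 * d)))) *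
            (1 - Real.exp (-(Real.pi / σ ^ 2 * d * d)))))))) := by
  obtain ⟨h1, h2⟩ := summable_residual_tails (d := d) (n0 := n0) (k0 := k0) (s := s) (m := m)
    hσ hb hV
  refine norm_window_residual_le_add hσ hb hV hX ?_ ?_
  · refine norm_tsum_residual_tail_le' (κ := fun i : ℕ => m + 1 + i) hd hσ hσd hb hn0 hn0d hV
      (fun i => abs_right_tail hm' i) (by linarith) (by linarith) h1 fun i j hij => ?_
    exact Int.natCast_modEq_iff.1 (Int.ModEq.add_left_cancel' _ hij)
  · refine norm_tsum_residual_tail_le' (κ := fun i : ℕ => m - d - i) hd hσ hσd hb hn0 hn0d hV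
      (fun i => abs_left_tail hm i) (by linarith) (by linarith) h2 fun i j hij => ?_
    refine Int.natCast_modEq_iff.1 ?_
    have := (Int.ModEq.refl (m - d : ℤ)).sub hij
    simpa using this

end WindowResidual

/-! ### One-parameter groups of operators -/

section ExpSmul

variable {E : Type*} [NormedAddCommGroup E] [NormedSpace ℂ E]

theorem exp_zero_smul_apply (X : E →L[ℂ] E) (v : E) : NormedSpace.exp ((0 : ℂ) • X) v = v := by
  rw [zero_smul, NormedSpace.exp_zero]; rfl

theorem exp_neg_smul_apply_exp_smul_apply [CompleteSpace E] (X : E →L[ℂ] E) (z : ℂ) (v : E) :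
    NormedSpace.exp ((-z) • X) (NormedSpace.exp (z • X) v) = v := by
  let +nondep : NormedAlgebra ℚ (E →L[ℂ] E) := .restrictScalars ℚ ℂ (E →L[ℂ] E)
  have h := NormedSpace.exp_add_of_commute (((Commute.refl X).smul_left (-z)).smul_right z)
  rw [← add_smul, neg_add_cancel, zero_smul, NormedSpace.exp_zero] at h
  exact (congrArg (fun Y : E →L[ℂ] E => Y v) h).symm

theorem hasDerivAt_exp_smul_apply [CompleteSpace E] (X : E →L[ℂ] E) (v : E) (s : ℝ) :
    HasDerivAt (fun s : ℝ => NormedSpace.exp ((s : ℂ) • X) v)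
      (NormedSpace.exp ((s : ℂ) • X) (X v)) s := by
  have h1 := (hasDerivAt_exp_smul_const (𝕂 := ℂ) X (s : ℂ)).clm_apply (hasDerivAt_const (s : ℂ) v)
  refine (h1.scomp s (hasDerivAt_id s).ofReal_comp).congr_deriv ?_
  rw [map_zero, add_zero, Complex.ofReal_one, one_smul]
  rfl

end ExpSmul

/-! ### Duhamel estimate along the sliding window -/

section Duhamel

variable {d : ℕ} {T0 σ n0 : ℝ} {V0 : ℝ → ℝ} {k0 : ℝ}

/-- The comparison state supported on the sites `m - d < k ≤ m`. -/
noncomputable def comparisonState (d : ℕ) (σ n0 : ℝ) (V0 : ℝ → ℝ) (k0 : ℝ) (m : ℤ) (s : ℝ) :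
    ClockSpace d :=
  ∑ k ∈ Finset.Ioc (m - d) m, shiftedWave d σ n0 V0 k0 s k • timeState d k

/-- The comparison state in the interaction picture. -/
noncomputable def pulledBackState (d : ℕ) (T0 σ n0 : ℝ) (V0 : ℝ → ℝ) (k0 : ℝ) (m : ℤ) (s : ℝ) :
    ClockSpace d :=
  NormedSpace.exp ((s : ℂ) • (Complex.I • scaledHamiltonian d T0 V0))
    (comparisonState d σ n0 V0 k0 m s)

theorem scaledHamiltonian_timeState (hd : 0 < d) (hT0 : 0 < T0)
    (hper : Function.Periodic V0 (2 * Real.pi)) (k : ℤ) :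
    scaledHamiltonian d T0 V0 (timeState d k) = clockHamiltonian d d (timeState d k) +
      ((potential d V0 k : ℝ) : ℂ) • timeState d k := by
  have hd' : (d : ℂ) ≠ 0 := by exact_mod_cast hd.ne'
  have hT0' : (T0 : ℂ) ≠ 0 := by exact_mod_cast hT0.ne'
  ext n
  simp only [scaledHamiltonian, smul_apply, add_apply, interaction_timeState hd hper,
    PiLp.smul_apply, PiLp.add_apply, clockHamiltonian_apply, smul_eq_mul]
  push_cast
  field_simp

/-- The term -i V_d φ of the transport equation cancels against the interaction eigenvalue, leaving
precisely the residual. -/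
theorem hasDerivAt_pulledBackState (hd : 0 < d) (hT0 : 0 < T0) (hV0 : Continuous V0)
    (hper : Function.Periodic V0 (2 * Real.pi)) (m : ℤ) (s : ℝ) :
    HasDerivAt (pulledBackState d T0 σ n0 V0 k0 m)
      (NormedSpace.exp ((s : ℂ) • (Complex.I • scaledHamiltonian d T0 V0))
        (∑ k ∈ Finset.Ioc (m - d) m, residual d σ n0 V0 k0 s k)) s := by
  set X := Complex.I • scaledHamiltonian d T0 V0 with hX
  have h1 : pulledBackState d T0 σ n0 V0 k0 m = fun s : ℝ => ∑ k ∈ Finset.Ioc (m - d) m,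
      shiftedWave d σ n0 V0 k0 s k • NormedSpace.exp ((s : ℂ) • X) (timeState d k) := by
    funext s
    rw [pulledBackState, comparisonState, map_sum]
    simp only [map_smul, hX]
  rw [h1, map_sum]
  refine HasDerivAt.fun_sum fun k _ => ?_
  refine ((hasDerivAt_shiftedWave_shift hV0 s k).smul
    (hasDerivAt_exp_smul_apply X (timeState d k) s)).congr_deriv ?_
  rw [← map_smul, ← map_smul, ← map_smul, ← map_add]
  congr 1
  rw [map_smul, hX, smul_apply, scaledHamiltonian_timeState hd hT0 hper, residual]
  module

theorem norm_pulledBackState_sub (m : ℤ) (m' : ℤ) (s : ℝ) :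
    ‖pulledBackState d T0 σ n0 V0 k0 m s - pulledBackState d T0 σ n0 V0 k0 m' s‖ =
      ‖comparisonState d σ n0 V0 k0 m s - comparisonState d σ n0 V0 k0 m' s‖ := by
  rw [pulledBackState, pulledBackState, ← map_sub, norm_exp_smul_I_smul_scaledHamiltonian]

theorem comparisonState_succ_sub (hd : 0 < d) (m : ℤ) (s : ℝ) :
    comparisonState d σ n0 V0 k0 (m + 1) s - comparisonState d σ n0 V0 k0 m s =
      shiftedWave d σ n0 V0 k0 s (m + 1 : ℤ) • timeState d (m + 1) -
        shiftedWave d σ n0 V0 k0 s (m + 1 - d : ℤ) • timeState d (m + 1 - d) := by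
  have hd' : (0 : ℤ) < d := by exact_mod_cast hd
  have h1 : Finset.Ioc (m + 1 - d) (m + 1) = insert (m + 1) (Finset.Ioc (m + 1 - d) m) := by
    ext k; simp only [Finset.mem_Ioc, Finset.mem_insert]; omega
  have h2 : Finset.Ioc (m - d) m = insert (m + 1 - d) (Finset.Ioc (m + 1 - d) m) := by
    ext k; simp only [Finset.mem_Ioc, Finset.mem_insert]; omega
  rw [comparisonState, comparisonState, h1, h2, Finset.sum_insert (by simp),
    Finset.sum_insert (by simp)]
  abel

/-- At a jump, site m + 1 replaces m + 1 - d. Both lie at distance d/2 from the centre, so each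
amplitude is A e^{-πd²/(4σ²)}. -/
theorem norm_pulledBackState_jump_le (hd : 0 < d) {m : ℤ} {s : ℝ}
    (hs : s + k0 + d / 2 = m + 1) :
    ‖pulledBackState d T0 σ n0 V0 k0 (m + 1) s - pulledBackState d T0 σ n0 V0 k0 m s‖ ≤
      epsStep d σ k0 := by
  rw [norm_pulledBackState_sub, comparisonState_succ_sub hd]
  refine (norm_sub_le _ _).trans (le_of_eq ?_)
  rw [norm_smul, norm_smul, norm_timeState hd, norm_timeState hd, mul_one, mul_one,
    norm_shiftedWave, norm_shiftedWave, epsStep]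
  have e1 : (((m + 1 : ℤ) : ℝ) - s - k0) = d / 2 := by push_cast; linarith
  have e2 : (((m + 1 - d : ℤ) : ℝ) - s - k0) = -(d / 2) := by push_cast; linarith
  rw [e1, e2]
  have e3 : -(Real.pi / σ ^ 2) * ((d : ℝ) / 2) ^ 2 = -(Real.pi * d ^ 2 / (4 * σ ^ 2)) := by
    ring
  rw [neg_sq, e3]
  ring

/-- Induction on the number n of jumps: the mean value inequality while the window is constant, and
one `epsStep` per jump. -/
theorem norm_pulledBackState_sub_le_add (hd : 0 < d) (hT0 : 0 < T0) (hV0 : Continuous V0)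
    (hper : Function.Periodic V0 (2 * Real.pi)) {E : ℝ}
    (hE : ∀ (m : ℤ) (s : ℝ), (m : ℝ) ≤ s + k0 + d / 2 → s + k0 + d / 2 ≤ m + 1 →
      ‖∑ k ∈ Finset.Ioc (m - d) m, residual d σ n0 V0 k0 s k‖ ≤ E) (n : ℕ) :
    ∀ s₁ s₂ : ℝ, s₁ ≤ s₂ → ⌊s₂ + k0 + d / 2⌋ = ⌊s₁ + k0 + d / 2⌋ + n →
      ‖pulledBackState d T0 σ n0 V0 k0 ⌊s₂ + k0 + d / 2⌋ s₂ -
        pulledBackState d T0 σ n0 V0 k0 ⌊s₁ + k0 + d / 2⌋ s₁‖ ≤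
      E * (s₂ - s₁) + n * epsStep d σ k0 := by
  have hseg : ∀ (m : ℤ) (s₁ s₂ : ℝ), s₁ ≤ s₂ → (m : ℝ) ≤ s₁ + k0 + d / 2 →
      s₂ + k0 + d / 2 ≤ m + 1 →
      ‖pulledBackState d T0 σ n0 V0 k0 m s₂ - pulledBackState d T0 σ n0 V0 k0 m s₁‖ ≤
        E * (s₂ - s₁) := by
    intro m s₁ s₂ h h1 h2
    refine norm_image_sub_le_of_norm_deriv_le_segment'
      (fun s _ => (hasDerivAt_pulledBackState hd hT0 hV0 hper m s).hasDerivWithinAt)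
      (fun s hs => ?_) s₂ (Set.right_mem_Icc.2 h)
    rw [norm_exp_smul_I_smul_scaledHamiltonian]
    exact hE m s (by linarith [hs.1]) (by linarith [hs.2])
  induction n with
  | zero =>
    intro s₁ s₂ h hn
    rw [Nat.cast_zero, add_zero] at hn
    rw [hn, Nat.cast_zero, zero_mul, add_zero]
    refine hseg _ _ _ h (Int.floor_le _) ?_
    rw [← hn]
    exact (Int.lt_floor_add_one _).le
  | succ n ih =>
    intro s₁ s₂ h hn
    set m := ⌊s₁ + k0 + d / 2⌋ with hm
    -- The first jump after s₁.
    set s₀ : ℝ := m + 1 - k0 - d / 2 with hs₀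
    have h0 : s₀ + k0 + d / 2 = m + 1 := by rw [hs₀]; ring
    have h1 : s₁ ≤ s₀ := by
      have := (Int.lt_floor_add_one (s₁ + k0 + d / 2)).le
      linarith
    have h2 : s₀ ≤ s₂ := by
      have h3 := Int.floor_le (s₂ + k0 + d / 2)
      rw [hn] at h3
      push_cast at h3
      have : (0 : ℝ) ≤ n := n.cast_nonneg
      linarith
    have h3 : ⌊s₀ + k0 + d / 2⌋ = m + 1 := by
      rw [h0]; exact_mod_cast Int.floor_intCast (m + 1)
    have h4 := ih s₀ s₂ h2 (by rw [hn, h3]; push_cast; ring)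
    rw [h3] at h4
    have h5 := hseg m s₁ s₀ h1 (Int.floor_le _) h0.le
    have h6 := norm_pulledBackState_jump_le (T0 := T0) (σ := σ) (n0 := n0) (V0 := V0) hd h0
    have h7 := norm_sub_le_norm_sub_add_norm_sub
      (pulledBackState d T0 σ n0 V0 k0 ⌊s₂ + k0 + d / 2⌋ s₂)
      (pulledBackState d T0 σ n0 V0 k0 (m + 1) s₀) (pulledBackState d T0 σ n0 V0 k0 m s₁)
    have h8 := norm_sub_le_norm_sub_add_norm_sub
      (pulledBackState d T0 σ n0 V0 k0 (m + 1) s₀)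
      (pulledBackState d T0 σ n0 V0 k0 m s₀) (pulledBackState d T0 σ n0 V0 k0 m s₁)
    push_cast
    linarith

theorem normConst_pos (hd : 0 < d) (σ k0 : ℝ) : 0 < normConst d σ k0 := by
  have h : 0 < gaussSum d σ k0 := by
    refine Finset.sum_pos (fun k _ => Real.exp_pos _) ?_
    refine ⟨⌊k0 + d / 2⌋, ?_⟩
    have hd' : (1 : ℝ) ≤ d := by exact_mod_cast hd
    rw [closestInts, Finset.mem_Ioc]
    refine ⟨?_, le_rfl⟩
    have : ⌊k0 + d / 2 - 1⌋ < ⌊k0 + d / 2⌋ := by rw [Int.floor_sub_one]; omega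
    exact lt_of_le_of_lt (Int.floor_le_floor (by linarith)) this
  unfold normConst
  positivity

theorem epsStep_pos (hd : 0 < d) (σ k0 : ℝ) : 0 < epsStep d σ k0 := by
  have := normConst_pos hd σ k0
  unfold epsStep
  positivity

/-- An interval of length L contains fewer than L + 1 jumps; with `epsStep_pos` this is the source
of strictness. The estimate is symmetric in s₁ and s₂, which covers negative times. -/
theorem norm_pulledBackState_sub_lt (hd : 0 < d) (hT0 : 0 < T0) (hV0 : Continuous V0)
    (hper : Function.Periodic V0 (2 * Real.pi)) {E : ℝ}
    (hE : ∀ (m : ℤ) (s : ℝ), (m : ℝ) ≤ s + k0 + d / 2 → s + k0 + d / 2 ≤ m + 1 →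
      ‖∑ k ∈ Finset.Ioc (m - d) m, residual d σ n0 V0 k0 s k‖ ≤ E) (s₁ s₂ : ℝ) :
    ‖pulledBackState d T0 σ n0 V0 k0 ⌊s₂ + k0 + d / 2⌋ s₂ -
        pulledBackState d T0 σ n0 V0 k0 ⌊s₁ + k0 + d / 2⌋ s₁‖ <
      E * |s₂ - s₁| + (|s₂ - s₁| + 1) * epsStep d σ k0 := by
  wlog h : s₁ ≤ s₂ generalizing s₁ s₂
  · rw [norm_sub_rev, abs_sub_comm]
    exact this s₂ s₁ (le_of_not_ge h)
  obtain ⟨n, hn⟩ := Int.le.dest (Int.floor_le_floor (by linarith :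
    s₁ + k0 + (d : ℝ) / 2 ≤ s₂ + k0 + d / 2))
  have h1 := norm_pulledBackState_sub_le_add (T0 := T0) hd hT0 hV0 hper hE n s₁ s₂ h hn.symm
  rw [abs_of_nonneg (sub_nonneg.2 h)]
  refine h1.trans_lt (add_lt_add_right ?_ _)
  refine mul_lt_mul_of_pos_right ?_ (epsStep_pos hd σ k0)
  have h2 := Int.floor_le (s₂ + k0 + (d : ℝ) / 2)
  have h3 := Int.lt_floor_add_one (s₁ + k0 + (d : ℝ) / 2)
  rw [← hn] at h2
  push_cast at h2
  linarith

theorem closestInts_eq_Ioc (d : ℕ) (c : ℝ) :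
    closestInts d c = Finset.Ioc (⌊c + d / 2⌋ - d) ⌊c + d / 2⌋ := by
  rw [closestInts, show c - (d : ℝ) / 2 = c + d / 2 - (d : ℕ) by ring, Int.floor_sub_natCast]

theorem gaussianState_eq_comparisonState (d : ℕ) (σ n0 : ℝ) (V0 : ℝ → ℝ) (k0 : ℝ) :
    gaussianState d σ n0 k0 = comparisonState d σ n0 V0 k0 ⌊0 + k0 + d / 2⌋ 0 := by
  rw [gaussianState, comparisonState, zero_add, closestInts_eq_Ioc]
  refine Finset.sum_congr rfl fun k _ => ?_
  rw [shiftedWave, phase, sub_zero, intervalIntegral.integral_same]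
  simp

theorem waveFunction_zero (hd : 0 < d) {x : ℤ} (hx : x ∈ closestInts d k0) :
    waveFunction d T0 σ n0 V0 k0 x 0 = psiNor d σ n0 k0 x := by
  rw [waveFunction]
  rw [Complex.ofReal_zero, mul_zero, exp_zero_smul_apply]
  rw [closestInts_eq_Ioc] at hx
  rw [gaussianState, closestInts_eq_Ioc]
  exact inner_timeState_sum (κ := id) hd (fun k hk l hl h => eq_of_modEq_of_mem_Ioc hk hl h)
    (fun k : ℤ => psiNor d σ n0 k0 k) hx

/-- The evolution of the wave function is controlled by a uniform bound on the defect of the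
comparison state. -/
theorem norm_waveFunction_sub_lt (hd : 0 < d) (hT0 : 0 < T0) (hV0 : Continuous V0)
    (hper : Function.Periodic V0 (2 * Real.pi)) {E : ℝ}
    (hE : ∀ (m : ℤ) (s : ℝ), (m : ℝ) ≤ s + k0 + d / 2 → s + k0 + d / 2 ≤ m + 1 →
      ‖∑ k ∈ Finset.Ioc (m - d) m, residual d σ n0 V0 k0 s k‖ ≤ E) (t : ℝ) {x : ℤ}
    (hx : x ∈ closestInts d (k0 + t * d / T0)) :
    ‖waveFunction d T0 σ n0 V0 k0 x t -
      Complex.exp (-Complex.I * phase d V0 (t * d / T0) x) * psiNor d σ n0 k0 (x - t * d / T0)‖ <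
      |t| * (d / T0) * E + (|t| * (d / T0) + 1) * epsStep d σ k0 := by
  set s : ℝ := t * d / T0 with hs
  set X := Complex.I • scaledHamiltonian d T0 V0 with hX
  have habs : |s| = |t| * (d / T0) := by
    rw [hs, mul_div_assoc, abs_mul, abs_of_nonneg (by positivity : 0 ≤ (d : ℝ) / T0)]
  have h1 := norm_pulledBackState_sub_lt (T0 := T0) (σ := σ) (n0 := n0) (k0 := k0) hd hT0 hV0 hper
    hE s 0
  rw [zero_sub, abs_neg, habs] at h1
  refine lt_of_le_of_lt ?_ (h1.trans_eq (by ring))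
  -- The error is the inner product of the unit vector θ_x with a unitary image of the difference of
  -- pulled-back states at 0 and s.
  have h2 : waveFunction d T0 σ n0 V0 k0 x t -
      Complex.exp (-Complex.I * phase d V0 s x) * psiNor d σ n0 k0 (x - s) =
      inner ℂ (timeState d x) (NormedSpace.exp (((-s : ℝ) : ℂ) • X)
        (pulledBackState d T0 σ n0 V0 k0 ⌊0 + k0 + d / 2⌋ 0 -
          pulledBackState d T0 σ n0 V0 k0 ⌊s + k0 + d / 2⌋ s)) := by
    rw [map_sub, inner_sub_right, waveFunction, smul_hamiltonian_eq hd hT0]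
    congr 1
    · rw [gaussianState_eq_comparisonState d σ n0 V0 k0, pulledBackState, Complex.ofReal_zero,
        exp_zero_smul_apply]
    · have h3 : NormedSpace.exp (((-s : ℝ) : ℂ) • X)
          (pulledBackState d T0 σ n0 V0 k0 ⌊s + k0 + d / 2⌋ s) =
          comparisonState d σ n0 V0 k0 ⌊s + k0 + d / 2⌋ s := by
        rw [pulledBackState, ← hX, Complex.ofReal_neg, exp_neg_smul_apply_exp_smul_apply]
      rw [h3, comparisonState]
      rw [closestInts_eq_Ioc, add_comm k0 s] at hx
      exact (inner_timeState_sum (κ := id) hd (fun k hk l hl h => eq_of_modEq_of_mem_Ioc hk hl h)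
        (fun k : ℤ => shiftedWave d σ n0 V0 k0 s k) hx).symm
  rw [h2]
  refine (norm_inner_le_norm _ _).trans_eq ?_
  rw [norm_timeState hd, one_mul, hX, norm_exp_smul_I_smul_scaledHamiltonian]

end Duhamel

/-! ### Numerical estimates and the choice of contour shift -/

section ScalarEstimates

theorem log_three_le : Real.log 3 ≤ 1.1 := by
  rw [Real.log_le_iff_le_exp (by norm_num)]
  refine le_of_pow_le_pow_left₀ (n := 10) (by norm_num) (Real.exp_pos _).le ?_
  rw [← Real.exp_nat_mul, show ((10 : ℕ) : ℝ) * 1.1 = ((11 : ℕ) : ℝ) * 1 by norm_num,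
    Real.exp_nat_mul]
  calc (3 : ℝ) ^ 10 ≤ 2.7182818283 ^ 11 := by norm_num
    _ ≤ Real.exp 1 ^ 11 := by gcongr; exact Real.exp_one_gt_d9.le

theorem log_eleven_le : Real.log 11 ≤ 2.4 := by
  rw [Real.log_le_iff_le_exp (by norm_num)]
  refine le_of_pow_le_pow_left₀ (n := 5) (by norm_num) (Real.exp_pos _).le ?_
  rw [← Real.exp_nat_mul, show ((5 : ℕ) : ℝ) * 2.4 = ((12 : ℕ) : ℝ) * 1 by norm_num,
    Real.exp_nat_mul]
  calc (11 : ℝ) ^ 5 ≤ 2.7182818283 ^ 12 := by norm_num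
    _ ≤ Real.exp 1 ^ 12 := by gcongr; exact Real.exp_one_gt_d9.le

/-- The numbers 3.12 here and 17.9 below are rational lower bounds for the constants in the second
branch of `epsTwo`. -/
theorem kappa_mul_sqrt_div_log_ge : 3.12 ≤ kappa * Real.sqrt (6 * Real.pi) / Real.log 3 := by
  have h1 : (4.341 : ℝ) ≤ Real.sqrt (6 * Real.pi) :=
    Real.le_sqrt_of_sq_le (by nlinarith [Real.pi_gt_d4])
  have h2 : 0 < Real.log 3 := Real.log_pos (by norm_num)
  rw [le_div_iff₀ h2, kappa]
  nlinarith [log_three_le]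

theorem cubic_prefactor_ge :
    17.9 ≤ 3 ^ (7 / 4 : ℝ) / (Real.sqrt (2 * Real.pi) * Real.exp 1) * (8 + Real.pi ^ 2) := by
  have h1 : (6.838 : ℝ) ≤ 3 ^ (7 / 4 : ℝ) := by
    refine le_of_pow_le_pow_left₀ (n := 4) (by norm_num) (by positivity) ?_
    rw [← Real.rpow_mul_natCast (by norm_num)]
    norm_num
  have h2 : Real.sqrt (2 * Real.pi) ≤ 2.50663 :=
    Real.sqrt_le_iff.2 ⟨by norm_num, by nlinarith [Real.pi_lt_d4, Real.pi_lt_d6]⟩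
  have h3 := Real.exp_one_lt_d9
  have h4 : (9.869 : ℝ) ≤ Real.pi ^ 2 := by nlinarith [Real.pi_gt_d4]
  have h5 : Real.sqrt (2 * Real.pi) * Real.exp 1 ≤ 2.50663 * 2.7182818286 := by gcongr
  have h6 : (1.0035 : ℝ) ≤ 3 ^ (7 / 4 : ℝ) / (Real.sqrt (2 * Real.pi) * Real.exp 1) := by
    have : 0 < Real.sqrt (2 * Real.pi) * Real.exp 1 := by have := Real.pi_pos; positivity
    rw [le_div_iff₀ this]
    linarith
  nlinarith

theorem exp_exp_one_sub_one_le : Real.exp (Real.exp 1 - 1) ≤ 5.6 := by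
  have h1 := Real.exp_one_lt_d9
  have h2 : Real.exp (Real.exp 1 - 1) ≤ Real.exp (1 + 0.7183) :=
    Real.exp_le_exp.2 (by linarith)
  have h3 := Real.exp_bound' (x := 0.7183) (by norm_num) (by norm_num) (n := 5) (by norm_num)
  norm_num [Finset.sum_range_succ, Nat.factorial] at h3
  rw [Real.exp_add] at h2
  have h4 : (0 : ℝ) < Real.exp 0.7183 := Real.exp_pos _
  norm_num at h2 h4
  nlinarith

theorem cube_mul_exp_neg_le (x : ℝ) (hx : 0 ≤ x) : x ^ 3 * Real.exp (-x) ≤ 1.345 := by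
  have h1 : x / 3 ≤ Real.exp (x / 3 - 1) := by linarith [Real.add_one_le_exp (x / 3 - 1)]
  have h2 : (x / 3) ^ 3 ≤ Real.exp (x - 3) := by
    refine (pow_le_pow_left₀ (by positivity) h1 3).trans_eq ?_
    rw [← Real.exp_nat_mul]
    push_cast
    ring_nf
  have h3 : x ^ 3 * Real.exp (-x) ≤ 27 * Real.exp (-3) := by
    have h4 : Real.exp (x - 3) * Real.exp (-x) = Real.exp (-3) := by
      rw [← Real.exp_add]; ring_nf
    nlinarith [Real.exp_pos (-x)]
  have h5 : (20.08 : ℝ) ≤ Real.exp 3 := by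
    rw [show (3 : ℝ) = ((3 : ℕ) : ℝ) * 1 by norm_num, Real.exp_nat_mul]
    calc (20.08 : ℝ) ≤ 2.7182 ^ 3 := by norm_num
      _ ≤ _ := by gcongr; linarith [Real.exp_one_gt_d9]
  have h6 : Real.exp (-3) * Real.exp 3 = 1 := by rw [← Real.exp_add]; norm_num
  nlinarith [Real.exp_pos (-3)]

/-- The product with e^{-x} is cosh x/(2 sinh² x). For x ≤ 1.6, x³ beats the double pole at 0
through sinh x ≥ x + x³/6; beyond, the fraction is nearly 1 and x³e^{-x} ≤ 27e^{-3} suffices. -/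
theorem cube_mul_exp_neg_mul_le {x : ℝ} (hx : 0 < x) :
    x ^ 3 * (Real.exp (-x) *
      ((1 + Real.exp (-(2 * x))) / (1 - Real.exp (-(2 * x))) ^ 2)) ≤ 1.53 := by
  have hq1 : Real.exp (-(2 * x)) < 1 := by rw [Real.exp_lt_one_iff]; linarith
  have hpos : 0 < 1 - Real.exp (-(2 * x)) := sub_pos.2 hq1
  rcases le_total x 1.6 with h | h
  · have hc : Real.cosh x ≤ 3 := by
      have h1 : Real.exp x ≤ 5 := by
        refine (Real.exp_le_exp.2 h).trans ?_
        refine le_of_pow_le_pow_left₀ (n := 5) (by norm_num) (by norm_num) ?_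
        rw [← Real.exp_nat_mul, show ((5 : ℕ) : ℝ) * 1.6 = ((8 : ℕ) : ℝ) * 1 by norm_num,
          Real.exp_nat_mul]
        calc Real.exp 1 ^ 8 ≤ 2.7182818286 ^ 8 := by gcongr; exact Real.exp_one_lt_d9.le
          _ ≤ _ := by norm_num
      have h2 : Real.exp (-x) ≤ 1 := Real.exp_le_one_iff.2 (by linarith)
      rw [Real.cosh_eq]
      linarith
    have hs : x + x ^ 3 / 6 ≤ Real.sinh x := by
      have h1 := sum_le_hasSum (Finset.range 2) (fun n _ => by positivity) (Real.hasSum_sinh x)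
      norm_num [Finset.sum_range_succ, Nat.factorial] at h1
      exact h1
    have he : Real.exp (-x) * ((1 + Real.exp (-(2 * x))) / (1 - Real.exp (-(2 * x))) ^ 2) =
        Real.cosh x / (2 * Real.sinh x ^ 2) := by
      have h1 : Real.exp (-(2 * x)) = Real.exp (-x) * Real.exp (-x) := by
        rw [← Real.exp_add]; ring_nf
      have h2 : Real.exp x * Real.exp (-x) = 1 := by rw [← Real.exp_add]; simp
      have h3 : 1 - Real.exp (-(2 * x)) = 2 * Real.exp (-x) * Real.sinh x := by
        rw [Real.sinh_eq, h1]; linear_combination -h2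
      have h4 : 1 + Real.exp (-(2 * x)) = 2 * Real.exp (-x) * Real.cosh x := by
        rw [Real.cosh_eq, h1]; linear_combination -h2
      have h5 := Real.sinh_pos_iff.2 hx
      have h6 := Real.exp_pos (-x)
      rw [h3, h4]
      field_simp
    have hx3 : 0 < x ^ 3 := by positivity
    have hs0 : 0 < Real.sinh x := Real.sinh_pos_iff.2 hx
    rw [he, ← mul_div_assoc, div_le_iff₀ (by positivity)]
    have h1 : (x + x ^ 3 / 6) ^ 2 ≤ Real.sinh x ^ 2 := by gcongr
    have h2 : x ^ 3 * Real.cosh x ≤ x ^ 3 * 3 := by gcongr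
    have h3 : x ^ 3 * 3 ≤ 3.06 * (x + x ^ 3 / 6) ^ 2 := by
      have h4 : 3 * x ≤ 3.06 * (1 + x ^ 2 / 3) := by nlinarith [sq_nonneg (x - 1.4)]
      have h5 : x ^ 2 * (3 * x) ≤ x ^ 2 * (3.06 * (1 + x ^ 2 / 3)) := by gcongr
      nlinarith [pow_pos hx 6]
    linarith
  · have h1 : Real.exp (-(2 * x)) ≤ 0.0411 := by
      have h2 : Real.exp (-(2 * x)) ≤ Real.exp (-3.2) := Real.exp_le_exp.2 (by linarith)
      have h3 : (24.4 : ℝ) ≤ Real.exp 3.2 := by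
        refine le_of_pow_le_pow_left₀ (n := 5) (by norm_num) (Real.exp_pos _).le ?_
        rw [← Real.exp_nat_mul, show ((5 : ℕ) : ℝ) * 3.2 = ((16 : ℕ) : ℝ) * 1 by norm_num,
          Real.exp_nat_mul]
        calc (24.4 : ℝ) ^ 5 ≤ 2.7182818283 ^ 16 := by norm_num
          _ ≤ Real.exp 1 ^ 16 := by gcongr; exact Real.exp_one_gt_d9.le
      have h4 : Real.exp (-3.2) * Real.exp 3.2 = 1 := by rw [← Real.exp_add]; norm_num
      nlinarith [Real.exp_pos (-3.2)]
    have h2 : (1 + Real.exp (-(2 * x))) / (1 - Real.exp (-(2 * x))) ^ 2 ≤ 1.135 := by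
      rw [div_le_iff₀ (by positivity)]
      nlinarith
    have h3 := cube_mul_exp_neg_le x hx.le
    have h4 : 0 ≤ x ^ 3 * Real.exp (-x) := by positivity
    calc _ = x ^ 3 * Real.exp (-x) *
          ((1 + Real.exp (-(2 * x))) / (1 - Real.exp (-(2 * x))) ^ 2) := by
          ring
      _ ≤ 1.345 * 1.135 := by gcongr
      _ ≤ 1.53 := by norm_num

theorem geometric_factor_antitone {y z : ℝ} (hy : 0 < y) (hyz : y ≤ z) :
    (1 + Real.exp (-z)) / (1 - Real.exp (-z)) ^ 2 ≤
      (1 + Real.exp (-y)) / (1 - Real.exp (-y)) ^ 2 := by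
  have h1 : Real.exp (-z) ≤ Real.exp (-y) := Real.exp_le_exp.2 (by linarith)
  have h2 : Real.exp (-y) < 1 := Real.exp_lt_one_iff.2 (by linarith)
  have h3 : 0 < 1 - Real.exp (-y) := sub_pos.2 h2
  gcongr

/-- A shift for which the contour estimate decays like the cube of `S / Q`, where
`S = 3.12 b + u`. -/
theorem exists_shift_cubic {b u Q d : ℝ} (hb : 0 ≤ b) (hu : 0 < u) (hQ : 0 < Q) (hd : 2 * Q ≤ d) :
    ∃ h, 0 < h ∧ Real.exp (Real.exp (b * h) - 1 + u ^ 2 * h ^ 2 / (4 * Real.pi) - Q * h) *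
      ((1 + Real.exp (-(d * h))) / (1 - Real.exp (-(d * h))) ^ 2) ≤
        8.568 * ((3.12 * b + u) / (3.12 * Q)) ^ 3 := by
  set S := 3.12 * b + u with hS
  have hS0 : 0 < S := by positivity
  -- With f = b h ∈ [0, 1] this choice gives u h = 3.12 (1 - f). Convexity bounds e^f - 1 by f(e -
  -- 1), and 3.12² < 4π bounds the Gaussian term by 1 - f, so together they stay below e - 1.
  refine ⟨3.12 / S, by positivity, ?_⟩
  set f := 3.12 * b / S with hf
  have hf0 : 0 ≤ f := by positivity
  have hf1 : f ≤ 1 := by rw [hf, div_le_one hS0]; linarith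
  have hbh : b * (3.12 / S) = f := by rw [hf]; ring
  have huh : u ^ 2 * (3.12 / S) ^ 2 = (3.12 * (1 - f)) ^ 2 := by
    have : u * (3.12 / S) = 3.12 * (1 - f) := by
      rw [hf]; field_simp; rw [hS]; ring
    rw [← mul_pow, this]
  set x := Q * (3.12 / S) with hx
  have hx0 : 0 < x := by positivity
  have hconv : Real.exp f ≤ 1 + f * (Real.exp 1 - 1) := by
    have := convexOn_exp.2 (Set.mem_univ 0) (Set.mem_univ 1) (sub_nonneg.2 hf1) hf0 (by ring)
    simp only [smul_eq_mul, mul_zero, mul_one, zero_add, Real.exp_zero] at this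
    linarith
  have he := Real.exp_one_gt_d9
  have hpi := Real.pi_gt_d4
  have hgauss : (3.12 * (1 - f)) ^ 2 / (4 * Real.pi) ≤ 1 - f := by
    rw [div_le_iff₀ (by positivity)]
    nlinarith [mul_nonneg (sub_nonneg.2 hf1) hf0,
      mul_nonneg (sub_nonneg.2 hf1) (by linarith : 0 ≤ Real.pi - 3.1415)]
  have hexp : Real.exp f - 1 + (3.12 * (1 - f)) ^ 2 / (4 * Real.pi) - x ≤
      Real.exp 1 - 1 + -x := by nlinarith
  rw [hbh, huh]
  have hgeo := geometric_factor_antitone (y := 2 * x) (z := d * (3.12 / S)) (by positivity)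
    (by rw [hx, ← mul_assoc]; gcongr)
  have hpos : 0 ≤ (1 + Real.exp (-(2 * x))) / (1 - Real.exp (-(2 * x))) ^ 2 := by positivity
  have hcube := cube_mul_exp_neg_mul_le hx0
  have hSx : (S / (3.12 * Q)) ^ 3 = 1 / x ^ 3 := by
    rw [hx]; field_simp
  rw [hSx, mul_one_div, le_div_iff₀ (by positivity)]
  calc _ ≤ Real.exp (Real.exp 1 - 1 + -x) *
        ((1 + Real.exp (-(2 * x))) / (1 - Real.exp (-(2 * x))) ^ 2) * x ^ 3 := by gcongr
    _ = Real.exp (Real.exp 1 - 1) * (x ^ 3 * (Real.exp (-x) *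
        ((1 + Real.exp (-(2 * x))) / (1 - Real.exp (-(2 * x))) ^ 2))) := by
      rw [Real.exp_add]; ring
    _ ≤ 5.6 * 1.53 := by
      gcongr
      exact exp_exp_one_sub_one_le
    _ ≤ 8.568 := by norm_num

/-- The choice of the scale `θ` of the contour shift in the exponentially small regime. -/
theorem exists_scale_exponential {M v : ℝ} (hv : 0 ≤ v) (hM : 16 * (1 + v) ^ 2 ≤ M) :
    ∃ θ, 0 < θ ∧ 5 ≤ M * θ ∧
      Real.exp (v * Real.log M * θ / kappa) - 1 + M * θ ^ 2 / 4 - M * θ / 2 ≤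
        1.4 - M / (4 * (1 + v) ^ 2) := by
  have hv1 : 0 < 1 + v := by linarith
  have hM0 : 0 < M := lt_of_lt_of_le (by positivity) hM
  set m := Real.sqrt M with hm
  have hm2 : m ^ 2 = M := Real.sq_sqrt hM0.le
  have hm0 : 0 < m := Real.sqrt_pos.2 hM0
  have hm4 : 4 * (1 + v) ≤ m := Real.le_sqrt_of_sq_le (by linarith [mul_pow 4 (1 + v) 2])
  have hlogM : Real.exp (Real.log M / 2) = m := by
    rw [← Real.log_sqrt hM0.le, Real.exp_log hm0]
  -- For v ≤ 0.655, p = v/(1 + v) ≤ κ/2, so θ = 1/(1 + v) makes the inner exponential M^{l/2} with l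
  -- = 2p/κ ≤ 1, and convexity applies.
  rcases le_total v 0.655 with h | h
  · set p := v / (1 + v) with hp
    have hp0 : 0 ≤ p := by positivity
    have hpk : p ≤ 0.396 := by rw [hp, div_le_iff₀ hv1]; linarith
    have hθ : 1 / (1 + v) = 1 - p := by rw [hp]; field_simp; ring
    refine ⟨1 / (1 + v), by positivity, ?_, ?_⟩
    · rw [mul_one_div, le_div_iff₀ hv1]; nlinarith
    · set l := 2 * p / kappa with hl
      have hl0 : 0 ≤ l := by rw [hl, kappa]; positivity
      have hl1 : l ≤ 1 := by rw [hl, kappa, div_le_one (by norm_num)]; linarith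
      have hexp : Real.exp (v * Real.log M * (1 / (1 + v)) / kappa) ≤ 1 + l * (m - 1) := by
        have h1 := convexOn_exp.2 (Set.mem_univ 0) (Set.mem_univ (Real.log M / 2))
          (sub_nonneg.2 hl1) hl0 (by ring)
        simp only [smul_eq_mul, mul_zero, zero_add, Real.exp_zero, hlogM] at h1
        have h2 : v * Real.log M * (1 / (1 + v)) / kappa = l * (Real.log M / 2) := by
          rw [hl, hp]; ring
        rw [h2]
        linarith
      have hquad : M * (1 / (1 + v)) ^ 2 / 4 - M * (1 / (1 + v)) / 2 + M / (4 * (1 + v) ^ 2) =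
          -(m ^ 2 * ((1 - p) * p / 2)) := by
        have : M / (4 * (1 + v) ^ 2) = M * (1 / (1 + v)) ^ 2 / 4 := by field_simp
        rw [this, hθ, hm2]; ring
      have hlp : p = 0.396 * l := by rw [hl, kappa]; ring
      have h3 : l * (0.1195 * m ^ 2) ≤ m ^ 2 * ((1 - p) * p / 2) := by
        have : 0.1195 * l ≤ (1 - p) * p / 2 := by nlinarith
        nlinarith [sq_nonneg m]
      have h4 : m - 1 - 0.1195 * m ^ 2 ≤ 1.4 := by nlinarith [sq_nonneg (m - 4.184)]
      have h5 : l * (m - 1 - 0.1195 * m ^ 2) ≤ 1.4 := by nlinarith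
      linarith
  · have hv0 : 0 < v := by linarith
    -- This θ makes the inner exponential exactly M^{1/4} = √m. The tangent at m = 9 bounds it by (m
    -- + 9)/6, and the gain M K/4 ≥ m/6 removes the linear part.
    refine ⟨kappa / (4 * v), by rw [kappa]; positivity, ?_, ?_⟩
    · rw [← mul_div_assoc, le_div_iff₀ (by positivity), kappa]
      nlinarith
    · have hexp : v * Real.log M * (kappa / (4 * v)) / kappa = Real.log M / 4 := by
        rw [kappa]; field_simp
      have hsqrt : Real.exp (Real.log M / 4) = Real.sqrt m := by
        rw [eq_comm, Real.sqrt_eq_iff_mul_self_eq hm0.le (Real.exp_pos _).le, ← Real.exp_add,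
          ← hlogM]
        ring_nf
      have hs1 : Real.sqrt m ≤ (m + 9) / 6 := by
        nlinarith [sq_nonneg (Real.sqrt m - 3), Real.sq_sqrt hm0.le]
      rw [hexp, hsqrt]
      set K := 2 * (kappa / (4 * v)) - (kappa / (4 * v)) ^ 2 - 1 / (1 + v) ^ 2 with hK
      have hquad : M * (kappa / (4 * v)) ^ 2 / 4 - M * (kappa / (4 * v)) / 2 +
          M / (4 * (1 + v) ^ 2) = -(M * K / 4) := by
        rw [hK]; field_simp; ring
      have hK1 : 1 / 6 ≤ (1 + v) * K := by
        rw [hK, kappa]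
        have : (1 + v) * (2 * (0.792 / (4 * v)) - (0.792 / (4 * v)) ^ 2 - 1 / (1 + v) ^ 2) -
            1 / 6 = (0.792 / 2 * v * (1 + v) ^ 2 - 0.792 ^ 2 / 16 * (1 + v) ^ 2 - v ^ 2 -
              v ^ 2 * (1 + v) / 6) / (v ^ 2 * (1 + v)) := by
          field_simp; ring
        rw [← sub_nonneg, this]
        apply div_nonneg _ (by positivity)
        nlinarith [mul_nonneg (sub_nonneg.2 h) (sq_nonneg (v - 0.6)),
          mul_nonneg (sub_nonneg.2 h) (sq_nonneg v)]
      have hK0 : 0 < K := by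
        by_contra! hcon
        nlinarith
      have h6 : m / 6 ≤ M * K / 4 := by
        have h7 : m * (1 / 6) ≤ m * ((1 + v) * K) := by gcongr
        have h8 : m * K * (4 * (1 + v)) ≤ m * K * m := by gcongr
        rw [← hm2]
        linarith
      linarith

end ScalarEstimates

/-! ### Comparison of the contour estimates with `epsTwo` -/

section ErrorBounds

variable {d : ℕ} {σ n0 b k0 : ℝ}

theorem alphaZero_pos (hn0 : 0 < n0) (hn0d : n0 < (d : ℝ) - 1) : 0 < alphaZero d n0 :=
  mul_pos (div_pos two_pos (by linarith)) (lt_min hn0 (by linarith))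

theorem alphaZero_le_one (hn0 : 0 < n0) (hn0d : n0 < (d : ℝ) - 1) : alphaZero d n0 ≤ 1 := by
  have h1 : (0 : ℝ) < d - 1 := by linarith
  have h2 := min_le_left n0 ((d : ℝ) - 1 - n0)
  have h3 := min_le_right n0 ((d : ℝ) - 1 - n0)
  rw [alphaZero, div_mul_eq_mul_div, div_le_one h1]
  linarith

/-- The normalisation by d - 1 costs α₀/2 ≤ 1/2, exactly the half that `norm_tsum_residual_le`
allows in Q = α₀ d/2. -/
theorem alphaZero_mul_le (hn0 : 0 < n0) (hn0d : n0 < (d : ℝ) - 1) :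
    alphaZero d n0 * d / 2 ≤ min n0 ((d : ℝ) - 1 - n0) + 1 / 2 := by
  have h1 : (0 : ℝ) < d - 1 := by linarith
  have h2 := alphaZero_le_one hn0 hn0d
  have h3 : alphaZero d n0 * (d - 1) / 2 = min n0 ((d : ℝ) - 1 - n0) := by
    rw [alphaZero]; field_simp
  linarith

/-- The contour-shift factor in the bound on the full sum of residuals. -/
noncomputable def shiftFactor (d : ℕ) (σ n0 b h : ℝ) : ℝ :=
  Real.exp (Real.exp (b * h) - 1 + (d / σ) ^ 2 * h ^ 2 / (4 * Real.pi) -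
    alphaZero d n0 * d / 2 * h) * ((1 + Real.exp (-(d * h))) / (1 - Real.exp (-(d * h))) ^ 2)

/-- The exponential regime depends only on v = ῡσ²/d and M = πα₀²σ², because ῡ + d/σ² = (d/σ²)(1 +
v). -/
theorem eight_le_decayNumber_iff (hd : 0 < d) (hσ : 0 < σ) {v : ℝ}
    (hv : v = rateParam d σ n0 b * σ ^ 2 / d) :
    8 ≤ decayNumber d σ n0 b ↔
      8 ≤ Real.pi * alphaZero d n0 ^ 2 * σ ^ 2 / (2 * (1 + v) ^ 2) := by
  have hd' : (0 : ℝ) < d := by exact_mod_cast hd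
  rw [decayNumber, Nat.le_floor_iff' (by norm_num)]
  have h1 : rateParam d σ n0 b + d / σ ^ 2 = d / σ ^ 2 * (1 + v) := by
    rw [hv]; field_simp; ring
  have h2 : Real.pi * alphaZero d n0 ^ 2 / (2 * (d / σ ^ 2 * (1 + v)) ^ 2) * (d / σ) ^ 2 =
      Real.pi * alphaZero d n0 ^ 2 * σ ^ 2 / (2 * (1 + v) ^ 2) := by
    rcases eq_or_ne (1 + v) 0 with h | h
    · simp [h]
    · field_simp
  rw [h1, h2]
  norm_num

theorem sixteen_mul_sq_le (hd : 0 < d) (hσ : 0 < σ) {v : ℝ}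
    (hv : v = rateParam d σ n0 b * σ ^ 2 / d) (hv0 : 0 ≤ v) (h8 : 8 ≤ decayNumber d σ n0 b) :
    16 * (1 + v) ^ 2 ≤ Real.pi * alphaZero d n0 ^ 2 * σ ^ 2 := by
  have h1 := (eight_le_decayNumber_iff hd hσ hv).1 h8
  rw [le_div_iff₀ (by positivity)] at h1
  linarith

theorem rateParam_mul_log (hd : 0 < d) {v : ℝ} (hv : v = rateParam d σ n0 b * σ ^ 2 / d)
    (hv0 : 0 ≤ v) (hM : 16 * (1 + v) ^ 2 ≤ Real.pi * alphaZero d n0 ^ 2 * σ ^ 2) :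
    v * Real.log (Real.pi * alphaZero d n0 ^ 2 * σ ^ 2) * d =
      kappa * b * (Real.pi * alphaZero d n0 * σ ^ 2) := by
  have hd' : (0 : ℝ) < d := by exact_mod_cast hd
  have hL : Real.log (Real.pi * alphaZero d n0 ^ 2 * σ ^ 2) ≠ 0 :=
    (Real.log_pos (by nlinarith)).ne'
  rw [hv, rateParam]
  field_simp

theorem exp_seven_fifths_le : Real.exp 1.4 ≤ 4.06 := by
  refine le_of_pow_le_pow_left₀ (n := 5) (by norm_num) (by norm_num) ?_
  rw [← Real.exp_nat_mul, show ((5 : ℕ) : ℝ) * 1.4 = ((7 : ℕ) : ℝ) * 1 by norm_num,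
    Real.exp_nat_mul]
  calc Real.exp 1 ^ 7 ≤ 2.7182818286 ^ 7 := by gcongr; exact Real.exp_one_lt_d9.le
    _ ≤ _ := by norm_num

theorem exponential_prefactor_ge {α v : ℝ} (hσ : 0 < σ) (hα : 0 < α) (hv0 : 0 ≤ v)
    (hM : 16 * (1 + v) ^ 2 ≤ Real.pi * α ^ 2 * σ ^ 2) :
    4.186 * (2 * Real.pi * σ) ≤ (2 * Real.pi) ^ (5 / 4 : ℝ) * σ ^ (3 / 2 : ℝ) *
      (1 + Real.pi ^ 2 / 8) * Real.sqrt (Real.exp 1 / 2 * (α / (1 + v))) := by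
  have hpi := Real.pi_pos
  have hp1 : 2 * Real.pi * 1.5 ≤ (2 * Real.pi) ^ (5 / 4 : ℝ) := by
    rw [show (5 / 4 : ℝ) = 1 + 1 / 4 by norm_num, Real.rpow_add (by positivity), Real.rpow_one]
    gcongr
    refine le_of_pow_le_pow_left₀ (n := 4) (by norm_num) (by positivity) ?_
    rw [← Real.rpow_mul_natCast (by positivity)]
    norm_num
    linarith [Real.pi_gt_d4]
  have hp2 : (2.2 : ℝ) ≤ 1 + Real.pi ^ 2 / 8 := by nlinarith [Real.pi_gt_d4]
  have hp3 : σ * 1.74 ≤ σ ^ (3 / 2 : ℝ) * Real.sqrt (Real.exp 1 / 2 * (α / (1 + v))) := by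
    have h1 : σ ^ (3 / 2 : ℝ) = σ * Real.sqrt σ := by
      rw [show (3 / 2 : ℝ) = 1 + 1 / 2 by norm_num, Real.rpow_add hσ, Real.rpow_one,
        Real.sqrt_eq_rpow]
    rw [h1, mul_assoc, ← Real.sqrt_mul hσ.le]
    gcongr
    apply Real.le_sqrt_of_sq_le
    have hR : 2.25 ≤ α * σ / (1 + v) := by
      rw [le_div_iff₀ (by positivity)]
      refine le_of_pow_le_pow_left₀ (n := 2) (by norm_num) (by positivity) ?_
      nlinarith [Real.pi_lt_d2, sq_nonneg (α * σ), sq_nonneg (1 + v)]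
    have : σ * (Real.exp 1 / 2 * (α / (1 + v))) = Real.exp 1 / 2 * (α * σ / (1 + v)) := by ring
    rw [this]
    nlinarith [Real.exp_one_gt_d9]
  calc _ ≤ (2 * Real.pi * 1.5) * (σ * 1.74) * 2.2 := by
        have : 0 ≤ Real.pi * σ := by positivity
        linarith
    _ ≤ (2 * Real.pi) ^ (5 / 4 : ℝ) *
        (σ ^ (3 / 2 : ℝ) * Real.sqrt (Real.exp 1 / 2 * (α / (1 + v)))) *
        (1 + Real.pi ^ 2 / 8) := by gcongr
    _ = _ := by ring

theorem exists_shift_le_epsTwo_of_exponential (hd : 0 < d) (hσ : 0 < σ) (hα : 0 < alphaZero d n0)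
    (hα1 : alphaZero d n0 ≤ 1)
    (h8 : 8 ≤ decayNumber d σ n0 b) (hr : 0 ≤ rateParam d σ n0 b) :
    ∃ h, 0 < h ∧
      2 * Real.pi * normConst d σ k0 * σ * shiftFactor d σ n0 b h ≤ epsTwo d σ n0 b k0 := by
  have hd' : (0 : ℝ) < d := by exact_mod_cast hd
  have hpi := Real.pi_pos
  have hA := (normConst_pos hd σ k0).le
  obtain ⟨v, hv⟩ : ∃ v, v = rateParam d σ n0 b * σ ^ 2 / d := ⟨_, rfl⟩
  have hv0 : 0 ≤ v := by rw [hv]; positivity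
  have hM := sixteen_mul_sq_le hd hσ hv hv0 h8
  have hlog := rateParam_mul_log hd hv hv0 hM
  obtain ⟨θ, hθ, hθ5, hθe⟩ := exists_scale_exponential hv0 hM
  set α := alphaZero d n0
  set M := Real.pi * α ^ 2 * σ ^ 2 with hMdef
  -- At θ = 1 this h minimises the Gaussian and linear terms of the exponent; θ leaves room for the
  -- growth of the phase.
  refine ⟨Real.pi * α * σ ^ 2 / d * θ, by positivity, ?_⟩
  have hbh : b * (Real.pi * α * σ ^ 2 / d * θ) = v * Real.log M * θ / kappa := by
    have hk : (kappa : ℝ) ≠ 0 := by norm_num [kappa]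
    field_simp
    linear_combination -hlog
  have hfac : shiftFactor d σ n0 b (Real.pi * α * σ ^ 2 / d * θ) ≤
      Real.exp (1.4 - M / (4 * (1 + v) ^ 2)) * 1.03 := by
    rw [shiftFactor, hbh]
    have h1 : (d / σ : ℝ) ^ 2 * (Real.pi * α * σ ^ 2 / d * θ) ^ 2 / (4 * Real.pi) =
        M * θ ^ 2 / 4 := by rw [hMdef]; field_simp
    have h2 : alphaZero d n0 * d / 2 * (Real.pi * α * σ ^ 2 / d * θ) = M * θ / 2 := by
      change α * d / 2 * _ = _
      rw [hMdef]; field_simp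
    rw [h1, h2]
    have h3 : 5 ≤ d * (Real.pi * α * σ ^ 2 / d * θ) := by
      have : d * (Real.pi * α * σ ^ 2 / d * θ) = Real.pi * α * σ ^ 2 * θ := by field_simp
      rw [this]
      refine hθ5.trans ?_
      have : M ≤ Real.pi * α * σ ^ 2 := by
        rw [hMdef, sq]
        have : 0 ≤ Real.pi * α * σ ^ 2 := by positivity
        nlinarith
      gcongr
    have h4 : Real.exp (-5) ≤ 1 / 128 := by
      rw [Real.exp_neg, ← one_div]
      apply one_div_le_one_div_of_le (by norm_num)
      rw [show (5 : ℝ) = ((5 : ℕ) : ℝ) * 1 by norm_num, Real.exp_nat_mul]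
      calc (128 : ℝ) ≤ 2.7 ^ 5 := by norm_num
        _ ≤ _ := by gcongr; linarith [Real.exp_one_gt_d9]
    have h5 : (1 + Real.exp (-5)) / (1 - Real.exp (-5)) ^ 2 ≤ 1.03 := by
      have : (127 / 128 : ℝ) ≤ 1 - Real.exp (-5) := by linarith
      rw [div_le_iff₀ (by positivity)]
      nlinarith
    gcongr
    exact (geometric_factor_antitone (by norm_num) h3).trans h5
  rw [epsTwo, if_pos ⟨h8, hr⟩]
  have he : -(Real.pi / 4) * (α ^ 2 / (d / σ ^ 2 + rateParam d σ n0 b) ^ 2) * (d / σ) ^ 2 =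
      -(M / (4 * (1 + v) ^ 2)) := by
    have h1 : d / σ ^ 2 + rateParam d σ n0 b = d / σ ^ 2 * (1 + v) := by
      rw [hv]; field_simp
    rw [h1, hMdef]; field_simp
  have hv' : rateParam d σ n0 b * σ ^ 2 / d + 1 = 1 + v := by rw [hv]; ring
  rw [he, hv']
  have hpre := exponential_prefactor_ge hσ hα hv0 hM
  set W := Real.exp (-(M / (4 * (1 + v) ^ 2))) with hW
  have hW0 : 0 < W := Real.exp_pos _
  rw [sub_eq_add_neg, Real.exp_add, ← hW] at hfac
  have hfac' : shiftFactor d σ n0 b (Real.pi * α * σ ^ 2 / d * θ) ≤ 4.06 * W * 1.03 := by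
    refine hfac.trans ?_
    have := mul_le_mul_of_nonneg_right exp_seven_fifths_le hW0.le
    linarith
  have hAσ : 0 ≤ 2 * Real.pi * normConst d σ k0 * σ := by positivity
  calc _ ≤ 2 * Real.pi * normConst d σ k0 * σ * (4.06 * W * 1.03) :=
        mul_le_mul_of_nonneg_left hfac' hAσ
    _ ≤ 4.186 * (2 * Real.pi * σ) * (normConst d σ k0 * W) := by
        have : 0 ≤ Real.pi * normConst d σ k0 * σ * W := by positivity
        linarith
    _ ≤ _ := mul_le_mul_of_nonneg_right hpre (mul_nonneg hA hW0.le)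
    _ = _ := by ring

theorem epsTwo_ge_of_not_exponential (hd : 0 < d) (hσ : 0 < σ) (hα : 0 < alphaZero d n0)
    (hb : 0 ≤ b) (hc : ¬ (8 ≤ decayNumber d σ n0 b ∧ 0 ≤ rateParam d σ n0 b)) :
    17.9 * (normConst d σ k0 / alphaZero d n0 ^ 3) * (3.12 * b + d / σ) ^ 3 * (σ / d ^ 3) ≤
      epsTwo d σ n0 b k0 := by
  have hA := (normConst_pos hd σ k0).le
  have hc2 := cubic_prefactor_ge
  have hc3 := kappa_mul_sqrt_div_log_ge
  rw [epsTwo, if_neg hc]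
  calc _ ≤ 3 ^ (7 / 4 : ℝ) / (Real.sqrt (2 * Real.pi) * Real.exp 1) * (8 + Real.pi ^ 2) *
        (normConst d σ k0 / alphaZero d n0 ^ 3) *
        (kappa * Real.sqrt (6 * Real.pi) / Real.log 3 * b + d / σ) ^ 3 * (σ / d ^ 3) := by gcongr
    _ = _ := by ring

/-- Numerically 2π · 8.568 · 8/3.12³ < 0.8 · 17.9. The spare fifth of `epsTwo` pays for the
potential tail when d ≤ 9. -/
theorem exists_shift_le_epsTwo_of_not_exponential (hd : 0 < d) (hσ : 0 < σ)
    (hα : 0 < alphaZero d n0) (hα1 : alphaZero d n0 ≤ 1) (hb : 0 ≤ b)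
    (hc : ¬ (8 ≤ decayNumber d σ n0 b ∧ 0 ≤ rateParam d σ n0 b)) :
    ∃ h, 0 < h ∧
      2 * Real.pi * normConst d σ k0 * σ * shiftFactor d σ n0 b h ≤ 0.8 * epsTwo d σ n0 b k0 := by
  have hd' : (0 : ℝ) < d := by exact_mod_cast hd
  have hA := (normConst_pos hd σ k0).le
  obtain ⟨h, h0, hle⟩ := exists_shift_cubic (u := d / σ) (Q := alphaZero d n0 * d / 2) (d := d) hb
    (by positivity) (by positivity) (by nlinarith)
  refine ⟨h, h0, ?_⟩
  have heps := epsTwo_ge_of_not_exponential (k0 := k0) hd hσ hα hb hc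
  have hpi := Real.pi_lt_d4
  calc _ ≤ 2 * Real.pi * normConst d σ k0 * σ *
        (8.568 * ((3.12 * b + d / σ) / (3.12 * (alphaZero d n0 * d / 2))) ^ 3) := by
        gcongr
        exact hle
    _ = (2 * Real.pi * 8.568 * 8 / 3.12 ^ 3) *
        ((normConst d σ k0 / alphaZero d n0 ^ 3) * (3.12 * b + d / σ) ^ 3 * (σ / d ^ 3)) := by
        field_simp
        norm_num [mul_comm]
    _ ≤ (0.8 * 17.9) *
        ((normConst d σ k0 / alphaZero d n0 ^ 3) * (3.12 * b + d / σ) ^ 3 * (σ / d ^ 3)) := by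
        gcongr
        rw [div_le_iff₀ (by norm_num)]
        linarith
    _ ≤ _ := by linarith

/-- With m = √M, b > 1 forces κM ≤ v d log M, while v ≤ m/4 - 1 and log M ≤ 2(1.4 + m/11), by the
tangent to log at 11. For d ≤ 9 these are incompatible. -/
theorem ten_le_of_exponential (hd : 0 < d) (hσ : 0 < σ) (hα : 0 < alphaZero d n0)
    (hα1 : alphaZero d n0 ≤ 1) (hb : 1 < b)
    (h8 : 8 ≤ decayNumber d σ n0 b) (hr : 0 ≤ rateParam d σ n0 b) : 10 ≤ d := by
  by_contra! hd9
  have hd9' : (d : ℝ) ≤ 9 := by exact_mod_cast Nat.lt_succ_iff.1 hd9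
  have hd' : (0 : ℝ) < d := by exact_mod_cast hd
  have hpi := Real.pi_pos
  obtain ⟨v, hv⟩ : ∃ v, v = rateParam d σ n0 b * σ ^ 2 / d := ⟨_, rfl⟩
  have hv0 : 0 ≤ v := by rw [hv]; positivity
  have hM := sixteen_mul_sq_le hd hσ hv hv0 h8
  have hlog := rateParam_mul_log hd hv hv0 hM
  set α := alphaZero d n0
  set M := Real.pi * α ^ 2 * σ ^ 2 with hMdef
  have hM0 : 0 < M := by positivity
  set m := Real.sqrt M with hm
  have hm2 : m ^ 2 = M := Real.sq_sqrt hM0.le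
  have hm0 : 0 < m := Real.sqrt_pos.2 hM0
  have hm4 : 4 * (1 + v) ≤ m := Real.le_sqrt_of_sq_le (by linarith [mul_pow 4 (1 + v) 2])
  have hMle : kappa * M ≤ kappa * b * (Real.pi * α * σ ^ 2) := by
    have h0 : 0 ≤ Real.pi * α * σ ^ 2 := by positivity
    have h1 : M ≤ Real.pi * α * σ ^ 2 := by rw [hMdef, sq]; nlinarith
    have h2 : Real.pi * α * σ ^ 2 ≤ b * (Real.pi * α * σ ^ 2) := by nlinarith
    rw [mul_assoc, kappa]
    linarith
  have hlogm : Real.log M ≤ 2 * (1.4 + m / 11) := by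
    have h1 : Real.log M = 2 * Real.log m := by rw [← hm2, Real.log_pow]; norm_num
    have h2 := Real.log_le_sub_one_of_pos (show 0 < m / 11 by positivity)
    rw [Real.log_div hm0.ne' (by norm_num)] at h2
    linarith [log_eleven_le]
  have hvd : v * Real.log M * d ≤ (m / 4 - 1) * (2 * (1.4 + m / 11)) * 9 := by
    have h0 : 0 ≤ Real.log M := Real.log_nonneg (by nlinarith)
    have : v ≤ m / 4 - 1 := by linarith
    have : 0 ≤ m / 4 - 1 := hv0.trans this
    gcongr
  rw [hlog] at hvd
  rw [kappa] at hMle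
  rw [kappa] at hvd
  nlinarith [sq_nonneg (m - 6.09)]

end ErrorBounds

/-! ### The potential tail and the uniform bound on the defect -/

section Tail

variable {d : ℕ} {σ n0 b k0 : ℝ}

/-- Meant for z = 2π/d, which is at most 0.63 once d ≥ 10: the root in the orthonormal-block bound
is then at least 2π/d and cancels the prefactor of b. -/
theorem sq_le_one_sub_exp_neg {z w : ℝ} (hz0 : 0 ≤ z) (hz : z ≤ 0.63) (hw : z ≤ w) :
    z ^ 2 ≤ 1 - Real.exp (-w) := by
  have h1 : Real.exp (-w) ≤ Real.exp (-z) := Real.exp_le_exp.2 (by linarith)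
  have h2 := Real.quadratic_le_exp_of_nonneg hz0
  have h3 : Real.exp (-z) * Real.exp z = 1 := by rw [← Real.exp_add]; simp
  have h4 : Real.exp (-z) * (1 + z + z ^ 2 / 2) ≤ 1 :=
    (mul_le_mul_of_nonneg_left h2 (Real.exp_pos _).le).trans_eq h3
  have h5 : 1 ≤ (1 - z ^ 2) * (1 + z + z ^ 2 / 2) := by
    have h6 : 0 ≤ 1 - z / 2 - z ^ 2 - z ^ 3 / 2 := by
      nlinarith [pow_le_pow_left₀ hz0 hz 2, pow_le_pow_left₀ hz0 hz 3]
    nlinarith [mul_nonneg hz0 h6]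
  have h7 : Real.exp (-z) ≤ 1 - z ^ 2 :=
    le_of_mul_le_mul_right (h4.trans h5) (by positivity)
  linarith

theorem mul_exp_neg_le_half {u : ℝ} (hu : 1 ≤ u) :
    u * Real.exp (-(Real.pi / 4 * u ^ 2)) ≤ 1 / 2 := by
  have hpi := Real.pi_gt_d2
  have h2 := Real.quadratic_le_exp_of_nonneg (x := Real.pi / 4 * u ^ 2) (by positivity)
  rw [Real.exp_neg, ← div_eq_mul_inv, div_le_iff₀ (Real.exp_pos _)]
  have h3 : 0.785 * u ^ 2 ≤ Real.pi / 4 * u ^ 2 := by gcongr; linarith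
  have h4 : (0.785 * u ^ 2) ^ 2 ≤ (Real.pi / 4 * u ^ 2) ^ 2 := by gcongr
  nlinarith [sq_nonneg (u - 1), sq_nonneg (u ^ 2 - 1)]

theorem one_div_one_sub_exp_neg_le {y : ℝ} (hy : 0 < y) : 1 / (1 - Real.exp (-y)) ≤ 1 + 1 / y := by
  have h1 : Real.exp (-y) < 1 := Real.exp_lt_one_iff.2 (by linarith)
  have h2 := Real.add_one_le_exp y
  have h3 : Real.exp (-y) * Real.exp y = 1 := by rw [← Real.exp_add]; simp
  rw [div_le_iff₀ (by linarith)]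
  have h4 : Real.exp (-y) * (y + 1) ≤ 1 :=
    (mul_le_mul_of_nonneg_left h2 (Real.exp_pos _).le).trans_eq h3
  have h5 : (1 + 1 / y) * (1 - Real.exp (-y)) = (1 + y - Real.exp (-y) * (y + 1)) / y := by
    field_simp; ring
  rw [h5, le_div_iff₀ hy]
  linarith

/-- For few levels the boundary contribution of the potential is absorbed in the cubic bound. -/
theorem potential_tail_le (hd : 0 < d) (hd9 : d ≤ 9) (hσ : 0 < σ) (hσd : σ < d) (hb : 1 ≤ b) :
    2 * (Real.exp (-(Real.pi / σ ^ 2) * ((d : ℝ) ^ 2 / 4)) *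
      (2 * Real.pi * b / d * (1 / (1 - Real.exp (-(Real.pi / σ ^ 2 * d)))))) ≤
      0.2 * 17.9 * ((3.12 * b + d / σ) ^ 3 * (σ / d ^ 3)) := by
  have hd' : (0 : ℝ) < d := by exact_mod_cast hd
  have hd9' : (d : ℝ) ≤ 9 := by exact_mod_cast hd9
  have hpi := Real.pi_pos
  have hpi' := Real.pi_lt_d2
  set u := d / σ with hu
  have hu1 : 1 ≤ u := by rw [hu, one_le_div hσ]; exact hσd.le
  have hG : -(Real.pi / σ ^ 2) * ((d : ℝ) ^ 2 / 4) = -(Real.pi / 4 * u ^ 2) := by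
    rw [hu]; field_simp
  have hy : Real.pi / σ ^ 2 * d = Real.pi * u ^ 2 / d := by rw [hu]; field_simp
  have hσu : σ / d ^ 3 = 1 / (u * d ^ 2) := by rw [hu]; field_simp
  rw [hG, hy, hσu]
  have hhalf := mul_exp_neg_le_half hu1
  set G := Real.exp (-(Real.pi / 4 * u ^ 2)) with hGdef
  have hG0 : 0 < G := Real.exp_pos _
  have hT := one_div_one_sub_exp_neg_le (y := Real.pi * u ^ 2 / d) (by positivity)
  have hu2 : 1 ≤ u ^ 2 := by nlinarith
  have h1 : 2 * Real.pi * b / d * (1 + 1 / (Real.pi * u ^ 2 / d)) ≤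
      2 * Real.pi * b / d + 2 * b := by
    have : 2 * Real.pi * b / d * (1 + 1 / (Real.pi * u ^ 2 / d)) =
        2 * Real.pi * b / d + 2 * b / u ^ 2 := by field_simp
    rw [this]
    gcongr
    exact div_le_self (by positivity) hu2
  have h2 : (2 * Real.pi * b / d + 2 * b) * d ^ 2 ≤ 219 * b := by
    have h3 : (2 * Real.pi * b / d + 2 * b) * d ^ 2 = b * (2 * Real.pi * d + 2 * d ^ 2) := by
      field_simp
    rw [h3]
    -- The extreme case is d = 9.
    have h4 : 2 * Real.pi * d + 2 * (d : ℝ) ^ 2 ≤ 219 := by nlinarith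
    nlinarith
  have h5 : 219 * b ≤ 0.2 * 17.9 * (3.12 * b + u) ^ 3 := by
    have h6 : (3.12 * b + 1) ^ 3 ≤ (3.12 * b + u) ^ 3 := by gcongr
    have h7 : b ≤ b ^ 2 := by nlinarith
    have h8 : b ≤ b ^ 3 := by nlinarith
    nlinarith
  calc _ ≤ 2 * (G * (2 * Real.pi * b / d + 2 * b)) := by
        gcongr
        exact le_trans (by gcongr) h1
    _ = 2 * (u * G) * ((2 * Real.pi * b / d + 2 * b) * d ^ 2) * (1 / (u * d ^ 2)) := by
        field_simp
    _ ≤ 2 * (1 / 2) * (219 * b) * (1 / (u * d ^ 2)) := by gcongr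
    _ ≤ 0.2 * 17.9 * (3.12 * b + u) ^ 3 * (1 / (u * d ^ 2)) :=
        mul_le_mul_of_nonneg_right (by linarith) (by positivity)
    _ = _ := by ring

/-- For many levels the boundary contribution of the potential is at most its mean-square bound. -/
theorem potential_tail_le_of_ten_le (hd10 : 10 ≤ d) (hσ : 0 < σ) (hσd : σ < d) (hb : 0 ≤ b) :
    2 * Real.pi * b / d * (1 / (Real.sqrt (1 - Real.exp (-(2 * (Real.pi * d / σ ^ 2)))) *
      (1 - Real.exp (-(Real.pi * (d ^ 2 / σ ^ 2)))))) ≤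
        b / (1 - Real.exp (-(Real.pi * (d ^ 2 / σ ^ 2)))) := by
  have hd' : (0 : ℝ) < d := hσ.trans hσd
  have hpi := Real.pi_pos
  have he2 : 0 < 1 - Real.exp (-(Real.pi * (d ^ 2 / σ ^ 2))) :=
    sub_pos.2 (Real.exp_lt_one_iff.2 (neg_lt_zero.2 (by positivity)))
  have hd10' : (10 : ℝ) ≤ d := by exact_mod_cast hd10
  have hz : 2 * Real.pi / d ≤ 0.63 := by
    rw [div_le_iff₀ hd']
    linarith [Real.pi_lt_d2]
  have hzw : 2 * Real.pi / d ≤ 2 * (Real.pi * d / σ ^ 2) := by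
    rw [← mul_div_assoc, ← mul_assoc, div_le_div_iff₀ hd' (by positivity)]
    have : σ ^ 2 ≤ (d : ℝ) ^ 2 := by gcongr
    nlinarith
  have hsq := Real.le_sqrt_of_sq_le (sq_le_one_sub_exp_neg (by positivity) hz hzw)
  have hsq0 : 0 < Real.sqrt (1 - Real.exp (-(2 * (Real.pi * d / σ ^ 2)))) :=
    lt_of_lt_of_le (by positivity) hsq
  rw [mul_one_div, ← div_div]
  gcongr
  rw [div_le_iff₀ hsq0]
  calc _ = b * (2 * Real.pi / d) := by ring
    _ ≤ _ := by gcongr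

theorem add_bracket_le {X Y A G P P' : ℝ} (hGA : 0 ≤ 2 * A * G) (hX : X ≤ Y) (hP : P ≤ P') :
    X + 2 * (A * (G * P)) ≤ Y + 2 * A * P' * G := by
  have := mul_le_mul_of_nonneg_left hP hGA
  linarith

theorem exists_norm_tsum_residual_le (hσ : 0 < σ) {V0 : ℝ → ℝ}
    (hV0 : ContDiff ℝ ∞ V0) (hb : 0 ≤ b) (hn0 : 0 < n0) (hn0d : n0 < (d : ℝ) - 1)
    (hV : ∀ (k : ℕ) (x : ℝ), |iteratedDeriv k V0 x| ≤ 1 / 2 * b ^ (k + 1)) (s : ℝ) {h : ℝ}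
    (hh : 0 < h) : ‖∑' k : ℤ, residual d σ n0 V0 k0 s k‖ ≤
      2 * Real.pi * normConst d σ k0 * σ * shiftFactor d σ n0 b h := by
  have hd : 0 < d := by
    have : (0 : ℝ) < d := by linarith
    exact_mod_cast this
  have hα := alphaZero_mul_le hn0 hn0d
  have hmin1 := min_le_left n0 ((d : ℝ) - 1 - n0)
  have hmin2 := min_le_right n0 ((d : ℝ) - 1 - n0)
  rw [shiftFactor, ← mul_assoc]
  exact norm_tsum_residual_le hd hσ hV0 hb hV (by linarith) (by linarith) hn0.le hn0d.le s hh

/-- Three ways to place the potential tail. For b ≤ 1, (d - 1) + b ≤ d lets it share the 2π term.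
For b > 1 and d ≥ 10, orthonormal blocks bound it by the b term. For b > 1 and d ≤ 9 the exponential
regime is excluded and the spare fifth of `epsTwo` takes it. -/
theorem norm_window_residual_le_epsTotal (hσ : 0 < σ) (hσd : σ < d) {V0 : ℝ → ℝ}
    (hV0 : ContDiff ℝ ∞ V0) (hb : 0 ≤ b) (hn0 : 0 < n0) (hn0d : n0 < (d : ℝ) - 1)
    (hV : ∀ (k : ℕ) (x : ℝ), |iteratedDeriv k V0 x| ≤ 1 / 2 * b ^ (k + 1)) (m : ℤ) (s : ℝ)
    (hm : (m : ℝ) ≤ s + k0 + d / 2) (hm' : s + k0 + d / 2 ≤ m + 1) :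
    ‖∑ k ∈ Finset.Ioc (m - d) m, residual d σ n0 V0 k0 s k‖ ≤ epsTotal d σ n0 b k0 := by
  have hd2 : 2 ≤ d := by
    have : (1 : ℝ) < d := by linarith
    exact_mod_cast this
  have hd : 0 < d := by omega
  have hd' : (0 : ℝ) < d := by exact_mod_cast hd
  have hpi := Real.pi_pos
  have hα := alphaZero_pos hn0 hn0d
  have hα1 := alphaZero_le_one hn0 hn0d
  have hA := normConst_pos hd σ k0
  have hG : -(Real.pi / σ ^ 2) * ((d : ℝ) ^ 2 / 4) = -(Real.pi / 4) * (d ^ 2 / σ ^ 2) := by ring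
  have hT1 : Real.pi / σ ^ 2 * d = Real.pi * d / σ ^ 2 := by ring
  have hT2 : Real.pi * d / σ ^ 2 * d = Real.pi * (d ^ 2 / σ ^ 2) := by ring
  have he1 : 0 < 1 - Real.exp (-(Real.pi * d / σ ^ 2)) :=
    sub_pos.2 (Real.exp_lt_one_iff.2 (neg_lt_zero.2 (by positivity)))
  have he2 : 0 < 1 - Real.exp (-(Real.pi * (d ^ 2 / σ ^ 2))) :=
    sub_pos.2 (Real.exp_lt_one_iff.2 (neg_lt_zero.2 (by positivity)))
  have hGA : 0 ≤ 2 * normConst d σ k0 * Real.exp (-(Real.pi / 4) * (d ^ 2 / σ ^ 2)) := by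
    positivity
  have hw := fun X => norm_window_residual_le (k0 := k0) (X := X) hd2 hσ hσd hb hn0.le hn0d.le
    hV hm hm'
  have hw' := fun X => norm_window_residual_le' (k0 := k0) (X := X) hd2 hσ hσd hb hn0.le hn0d.le
    hV hm hm'
  simp only [hG, hT1] at hw
  simp only [hG, hT1, hT2] at hw'
  rw [epsTotal]
  have hpoly : 2 * (Real.pi / σ ^ 2) * d + Real.pi / σ ^ 2 * (d : ℝ) ^ 2 =
      2 * Real.pi * (d / σ ^ 2) + Real.pi * (d ^ 2 / σ ^ 2) := by ring
  have hB : 2 * Real.pi * ((d : ℝ) - 1) / d * (1 / (1 - Real.exp (-(Real.pi * d / σ ^ 2)))) ≤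
      2 * Real.pi / (1 - Real.exp (-(Real.pi * d / σ ^ 2))) := by
    rw [mul_one_div]
    gcongr
    rw [div_le_iff₀ hd']
    linarith
  have hV1 : 0 ≤ 2 * Real.pi / d / (1 - Real.exp (-(Real.pi * (d ^ 2 / σ ^ 2)))) := by positivity
  have hV2 : 0 ≤ b / (1 - Real.exp (-(Real.pi * (d ^ 2 / σ ^ 2)))) := by positivity
  have hd1 : (0 : ℝ) ≤ 1 / d := by positivity
  rw [add_div]
  by_cases hc : 8 ≤ decayNumber d σ n0 b ∧ 0 ≤ rateParam d σ n0 b ∨ b ≤ 1 ∨ 10 ≤ d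
  · have hX : ‖∑' k : ℤ, residual d σ n0 V0 k0 s k‖ ≤ epsTwo d σ n0 b k0 := by
      by_cases hc1 : 8 ≤ decayNumber d σ n0 b ∧ 0 ≤ rateParam d σ n0 b
      · obtain ⟨h, hh, hle⟩ := exists_shift_le_epsTwo_of_exponential (k0 := k0) hd hσ hα hα1
          hc1.1 hc1.2
        exact (exists_norm_tsum_residual_le hσ hV0 hb hn0 hn0d hV s hh).trans hle
      · obtain ⟨h, hh, hle⟩ := exists_shift_le_epsTwo_of_not_exponential (k0 := k0) hd hσ hα hα1
          hb hc1
        have heps := epsTwo_ge_of_not_exponential (k0 := k0) hd hσ hα hb hc1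
        have : 0 ≤ epsTwo d σ n0 b k0 := le_trans (by positivity) heps
        exact (exists_norm_tsum_residual_le hσ hV0 hb hn0 hn0d hV s hh).trans
          (hle.trans (by linarith))
    rcases le_or_gt b 1 with hb1 | hb1
    · refine (hw _ hX).trans ?_
      have hB' : (2 * Real.pi * ((d : ℝ) - 1) / d + 2 * Real.pi * b / d) *
          (1 / (1 - Real.exp (-(Real.pi * d / σ ^ 2)))) ≤
          2 * Real.pi / (1 - Real.exp (-(Real.pi * d / σ ^ 2))) := by
        rw [mul_one_div, ← add_div]
        gcongr
        rw [div_le_iff₀ hd']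
        nlinarith
      rw [hpoly]
      exact add_bracket_le hGA le_rfl (by linarith)
    · have hd10 : 10 ≤ d := by
        rcases hc with hc | hc | hc
        · exact ten_le_of_exponential hd hσ hα hα1 hb1 hc.1 hc.2
        · linarith
        · exact hc
      refine (hw' _ hX).trans ?_
      have hP := potential_tail_le_of_ten_le hd10 hσ hσd hb
      rw [hpoly]
      exact add_bracket_le hGA le_rfl (by linarith)
  · push Not at hc
    obtain ⟨hc1, hb1, hd9⟩ := hc
    have hc2 : ¬ (8 ≤ decayNumber d σ n0 b ∧ 0 ≤ rateParam d σ n0 b) :=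
      fun h => (hc1 h.1).not_ge h.2
    obtain ⟨h, hh, hle⟩ := exists_shift_le_epsTwo_of_not_exponential (k0 := k0) hd hσ hα hα1 hb hc2
    have heps := epsTwo_ge_of_not_exponential (k0 := k0) hd hσ hα hb hc2
    refine (hw _ ((exists_norm_tsum_residual_le hσ hV0 hb hn0 hn0d hV s hh).trans hle)).trans ?_
    have htail := potential_tail_le hd (by omega) hσ hσd hb1.le
    rw [hG, hT1] at htail
    have htail' := mul_le_mul_of_nonneg_left htail hA.le
    have hα3 : normConst d σ k0 ≤ normConst d σ k0 / alphaZero d n0 ^ 3 :=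
      le_div_self hA.le (by positivity) (pow_le_one₀ hα.le hα1)
    have h3 : normConst d σ k0 * (17.9 * ((3.12 * b + d / σ) ^ 3 * (σ / d ^ 3))) ≤
        epsTwo d σ n0 b k0 := by
      refine le_trans ?_ heps
      have : 0 ≤ 17.9 * ((3.12 * b + d / σ) ^ 3 * (σ / d ^ 3)) := by positivity
      calc _ ≤ normConst d σ k0 / alphaZero d n0 ^ 3 *
            (17.9 * ((3.12 * b + d / σ) ^ 3 * (σ / d ^ 3))) := by gcongr
        _ = _ := by ring
    rw [hpoly]
    set p := 2 * Real.pi * (d / σ ^ 2) + Real.pi * (d ^ 2 / σ ^ 2)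
    have hsum := add_bracket_le hGA (X := 0.8 * epsTwo d σ n0 b k0 + normConst d σ k0 *
      (2 * (Real.exp (-(Real.pi / 4) * (d ^ 2 / σ ^ 2)) * (2 * Real.pi * b / d *
        (1 / (1 - Real.exp (-(Real.pi * d / σ ^ 2))))))))
      (Y := epsTwo d σ n0 b k0) (by linarith) (add_le_add hB (le_refl p))
    have hle' := add_bracket_le hGA (le_refl (epsTwo d σ n0 b k0))
      (show 2 * Real.pi / (1 - Real.exp (-(Real.pi * d / σ ^ 2))) + p ≤
        2 * Real.pi / (1 - Real.exp (-(Real.pi * d / σ ^ 2))) +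
        (b / (1 - Real.exp (-(Real.pi * (d ^ 2 / σ ^ 2)))) +
          2 * Real.pi / d / (1 - Real.exp (-(Real.pi * (d ^ 2 / σ ^ 2))))) + (p + 1 / d) by
        linarith)
    exact le_trans (le_of_eq (by ring)) (hsum.trans (le_trans (le_of_eq (by ring)) hle'))

theorem epsNorExplicit_nonneg (hd : 0 < d) (hσ : 0 < σ) : 0 ≤ epsNorExplicit d σ := by
  have hd' : (0 : ℝ) < d := by exact_mod_cast hd
  have hpos : ∀ y : ℝ, 0 < y → 0 < 1 - Real.exp (-y) := fun y hy =>
    sub_pos.2 (Real.exp_lt_one_iff.2 (neg_lt_zero.2 hy))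
  have hpi := Real.pi_pos
  have h1 := hpos (Real.pi * d) (by positivity)
  have h2 := hpos (2 * Real.pi * d / σ ^ 2) (by positivity)
  have h3 := hpos (Real.pi * σ ^ 2) (by positivity)
  unfold epsNorExplicit
  split_ifs <;> positivity

end Tail
end QuantumClock
-- Assembly
theorem mainTheorem3
    (d : ℕ) (T0 : ℝ) (hT0 : 0 < T0)
    (σ : ℝ) (hσ0 : 0 < σ) (hσd : σ < d)
    (n0 : ℝ) (hn0 : 0 < n0) (hn0d : n0 < (d : ℝ) - 1)
    (V0 : ℝ → ℝ) (hV0 : ContDiff ℝ ∞ V0) (hper : Function.Periodic V0 (2 * Real.pi))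
    (Ω : ℝ) (hΩ : ∀ x : ℝ, ∫ y in x..(x + 2 * Real.pi), V0 y = Ω)
    (hΩ1 : -Real.pi ≤ Ω) (hΩ2 : Ω < Real.pi)
    (b : ℝ)
    (hb : ∀ k : ℕ, 1 ≤ k → ∀ x ∈ Set.Icc (0 : ℝ) (2 * Real.pi),
      (2 * |iteratedDeriv (k - 1) V0 x|) ^ (1 / (k : ℝ)) ≤ b)
    (k0 : ℝ) :
    (∀ x ∈ QuantumClock.closestInts d k0,
      QuantumClock.waveFunction d T0 σ n0 V0 k0 x 0 = QuantumClock.psiNor d σ n0 k0 x) ∧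
    ∀ t : ℝ, ∀ x ∈ QuantumClock.closestInts d (k0 + t * d / T0), ∃ ε : ℂ,
      QuantumClock.waveFunction d T0 σ n0 V0 k0 x t =
        Complex.exp (-Complex.I * QuantumClock.phase d V0 (t * d / T0) x) *
          QuantumClock.psiNor d σ n0 k0 (x - t * d / T0) + ε ∧
      ‖ε‖ < QuantumClock.epsV d T0 σ n0 b k0 t (QuantumClock.epsNor d T0 σ k0 t) ∧
      ‖ε‖ < QuantumClock.epsV d T0 σ n0 b k0 t (QuantumClock.epsNorExplicit d σ) := by
  have hd : 0 < d := by
    have : (0 : ℝ) < d := hσ0.trans hσd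
    exact_mod_cast this
  have hV := QuantumClock.abs_iteratedDeriv_le_of_rpow_le hper hb
  -- The case k = 1 of the hypothesis reads 2|V0| ≤ b.
  have hb0 : 0 ≤ b := by
    have := (abs_nonneg _).trans (hV 0 0)
    rw [zero_add, pow_one] at this
    linarith
  refine ⟨fun x hx => QuantumClock.waveFunction_zero hd hx, fun t x hx => ?_⟩
  have h := QuantumClock.norm_waveFunction_sub_lt (σ := σ) (n0 := n0) hd hT0 hV0.continuous hper
    (QuantumClock.norm_window_residual_le_epsTotal hσ0 hσd hV0 hb0 hn0 hn0d hV) t hx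
  -- The estimate already holds without ε_nor; only the sign of either form is used.
  refine ⟨_, (add_sub_cancel _ _).symm, ?_, ?_⟩
  · exact h.trans_le (le_add_of_nonneg_right (abs_nonneg _))
  · exact h.trans_le (le_add_of_nonneg_right (QuantumClock.epsNorExplicit_nonneg hd hσ0))
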